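/- **Setting.** Names are sorted into locations, function names and continuation names. Data are integers, locations and function names; values $v$ are tuples of data. A module $M$ has a header (exported and imported names), variable declarations with integer initial values and function declarations; $f@M$ is the definition of $f$ in $M$. A location store is a finite partial map from locations to data; a store has, in addition, a finite partial map $k\mapsto(t,k')$ from continuation names to pairs of a frame stack and a continuation name. $\nu(x)$ is the set of names in $x$, $s\upharpoonright X$ and $s\setminus X$ are the restrictions of $s$ to $X$ and to the complement of $X$, $s[s']$ is $s$ updated by $s'$, and $Cl(s,X)$ is the set of names reachable from $X$ through the location part of $s$. The states of the labelled transition system $[\![M]\!]$ are system configurations $\langle\!\langle N\mid P\vdash s\rangle\!\rangle$ and program configurations $\langle N\mid P\vdash s,t,e,k\rangle$, where $P\subseteq N$ are the public and the used names, $t$ is a frame stack, $e$ the expression being evaluated and $k$ a continuation name. Unlabelled steps are the steps of a call-by-value frame-stack machine for a C-like language (functions called by $f(\square)$ on top of the stack with argument value $v$). The labelled steps, with label $\alpha\in\{\mathtt{call}\,f,v,k;\ \mathtt{ret}\,v,k\}$ and a location store, are: - $\langle N\mid P\vdash s,t\circ f(\square),v,k\rangle\xrightarrow[s\upharpoonright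 P']{\mathtt{call}\,f,v,k'}\langle\!\langle N\cup\{k'\}\mid P'\cup\{k'\}\vdash s[k'\mapsto(t,k)]\rangle\!\rangle$ if $f@M$ is undefined and $k'\notin N$, and $\langle N\mid P\vdash s,-,v,k\rangle\xrightarrow[s\upharpoonright P']{\mathtt{ret}\,v,k}\langle\!\langle N\mid P'\vdash s\rangle\!\rangle$ (empty stack), with $P'=Cl(s,P\cup\nu(v))$; - $\langle\!\langle N\mid P\vdash s\rangle\!\rangle\xrightarrow[s']{\mathtt{call}\,f,v,k}\langle N\cup\{k\}\cup\nu(v,s')\mid P\cup\{k\}\cup\nu(v,s')\vdash s[s'],f(\square),v,k\rangle$ if $f@M$ is defined, $k\notin\mathrm{dom}(s)$ and $\nu(f,v,s')\cap N\subseteq P$; and $\langle\!\langle N\mid P\vdash s\rangle\!\rangle\xrightarrow[s']{\mathtt{ret}\,v,k'}\langle N\cup\nu(v,s')\mid P\cup\nu(v,s')\vdash s[s'],t,v,k\rangle$ if $s(k')=(t,k)$ and $\nu(v,s')\cap N\subseteq P$; in both cases all locations of $v$ and of $s'$ are in $\mathrm{dom}(s')$ (so $s'$ has no dangling pointers) and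 so is every public location of $\mathrm{dom}(s)$. Initially, $N$ consists of all exported, imported and declared names of $M$, $P$ of the exported and imported ones, and $s$ holds the declared initial values. Let $M,M'$ be well-scoped modules whose un-exported names have been renamed apart, which declare no common name, and such that every exported or imported variable is declared in one of them; $M\cdot M'$ is their concatenation. States of $[\![M]\!]\otimes[\![M']\!]$ are $X_1\otimes^{\Pi}_{s}X_2$, where $\Pi$ is the set of names communicated with the outside, its continuation names being split by polarity ($\Pi_S$: introduced by the outside), and $s$ is a location store. Initially $X_1,X_2$ are the initial configurations, $\Pi$ contains all exported and imported names, $\Pi_S=\emptyset$, and $s$ gives the initial values of the public locations. Write $p$ for programs and $c,c'$ for systems; all rules below have symmetric versions. - $p\otimes^{\Pi}_{s}c\to p'\otimes^{\Pi}_{s}c$ if $p\to p'$ and $\nu(p')\cap\nu(c)\subseteq\nu(p)$. - $p\otimes^{\Pi}_{s'}c\xrightarrow{\tau}c'\otimes^{\Pi}_{s'[s]}p'$ if $p\xrightarrow[s]{\alpha}c'$ and $c\xrightarrow[s]{\alpha}p'$, where, if $\alpha=\mathtt{call}\,f,v,k$, $k\notin\nu(c)$. - If $p\xrightarrow[s]{\alpha}c'$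 and $c$ has no transition with this label and store, let $s''=s'[s]$. If $\alpha=\mathtt{call}\,f,v,k$ with $k\notin\nu(c)$, then $p\otimes^{\Pi}_{s'}c\xrightarrow[s''\upharpoonright\Pi']{\alpha}c'\otimes^{\Pi'}_{s''}c$ with $\Pi'=Cl(s'',\nu(v)\cup\Pi)\cup\{k\}$ and $k\notin\Pi'_S$; if $\alpha=\mathtt{ret}\,v,k$, the same with $\Pi'=Cl(s'',\nu(v)\cup\Pi)$. - If $c\xrightarrow[s]{\alpha}p$, let $\bar\Pi=\nu(c,c')\setminus\Pi$ be the private names. Then $c\otimes^{\Pi}_{s'}c'\xrightarrow[s\upharpoonright\Pi']{\alpha}p\otimes^{\Pi'}_{s'[s]}c'$ with $\Pi'=\Pi\cup\nu(v,s\setminus\bar\Pi)\cup\{k\}$ and $k\in\Pi'_S$ if $\alpha=\mathtt{call}\,f,v,k$, and without $k$ if $\alpha=\mathtt{ret}\,v,k$, provided that $k\notin\nu(c')\setminus\Pi_S$ for calls, $k\notin\nu(c')$ for returns, $\mathrm{dom}(s'\upharpoonright\Pi)\subseteq\mathrm{dom}(s)$, $s'\setminus\Pi\subseteq s$, and the outside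 names no private name otherwise: $\mathrm{dom}(s)\cap\bar\Pi\subseteq\mathrm{dom}(s')$ and $\nu(v,s\setminus\bar\Pi)\cap\bar\Pi=\emptyset$, and for calls $f\notin\bar\Pi$. **The translation $R$.** Let $X_i$ have names $N_i,P_i$ and store $s_i$. Put $K=\{k\in P_1\cap P_2\mid k \text{ a continuation name},\ k\notin\Pi_S\}$. Let $(s_1,s_2)_K(t,k)=(t,k)$ if $k\notin K$, and $(s_1,s_2)_K(t,k)=(s_1,s_2)_K(t'\circ t,k')$ if $k\in K$ and $s_i(k)=(t',k')$. Let $\hat s_i$ be $s_i$ with each stored continuation $s_i(k)$ replaced by $(s_1,s_2)_K(s_i(k))$, and let $s_{12}=s\upharpoonright(P_1\cap P_2)$. If $X_1,X_2$ are both systems, $R(X_1\otimes^{\Pi}_sX_2)=\langle\!\langle(N_1\cup N_2)\setminus K\mid\Pi\vdash(\hat s_1[s_{12}]\cup\hat s_2[s_{12}])\setminus K\rangle\!\rangle$. If $X_i$ is a program with stack $t$, expression $e$ and continuation $k$, and $X_j$ is a system, then $R(X_1\otimes^{\Pi}_sX_2)=\langle(N_1\cup N_2)\setminus K\mid\Pi\vdash\hat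 s_j[\hat s_i]\setminus K,t',e,k'\rangle$ with $(t',k')=(s_1,s_2)_K(t,k)$. **Proposition.** For every reachable state $X=X_1\otimes^{\Pi}_sX_2$ of $[\![M]\!]\otimes[\![M']\!]$, $R(X)$ is well-defined and is a configuration whose names all belong to its finite set of used names, and, with $K$ computed from $X$: 1. if $X\xrightarrow{\tau}X'$ then $R(X)=R(X')$; 2. if $X\to X'$ then $R(X)\to R(X')$ in $[\![M\cdot M']\!]$; 3. if $R(X)\to Y$ in $[\![M\cdot M']\!]$ and $X$ has no $\tau$-transition, then $X\to X'$ for some $X'$ with $Y=R(X')$; 4. if $X\xrightarrow[s']{\alpha}X'$ then $R(X)\xrightarrow[s']{\alpha}R(X')$ in $[\![M\cdot M']\!]$; 5. if $R(X)\xrightarrow[s']{\alpha}Y$ in $[\![M\cdot M']\!]$, $X$ has no $\tau$-transition and $\nu(\alpha)\cap K=\emptyset$, then $X\xrightarrow[s']{\alpha}X'$ for some $X'$ with $Y=R(X')$. -/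

import Mathlib

namespace SLS

/-! ### Names, values, expressions, modules -/

abbrev LocName := ℕ
abbrev FunName := ℕ
abbrev ContName := ℕ
/-- Bound identifiers: formal parameters and local variables. Substitution removes them before
a term is evaluated, so they are kept apart from the names that a configuration can mention. -/
abbrev Var := ℕ

/-- The sorted names: locations, functions, function continuations. -/
inductive Name
  | loc (a : LocName)
  | fn (f : FunName)
  | cont (k : ContName)

/-- The data that a location can hold. -/
inductive Data
  | int (n : ℤ)
  | loc (a : LocName)
  | fn (f : FunName)

def Data.names : Data → Set Name
  | .int _ => ∅
  | .loc a => {Name.loc a}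
  | .fn f => {Name.fn f}

/-- Values are tuples of data; tupling is associative with unit `()`, so a tuple is a list and
a one-element list is the datum itself. -/
abbrev Value := List Data

def valNames (v : Value) : Set Name := {x | ∃ d ∈ v, x ∈ d.names}

/-- Binary operators: assignment, sequencing, and the operators `⋆`, which are an arithmetic or
logical operation on integers (possibly partial, like division) or an equality test. -/
inductive BinOp
  | assign
  | seq
  | arith (o : ℤ → ℤ → Option ℤ)
  | eq

open Classical in
/-- The evaluation `v ⋆ v'`. -/
noncomputable def BinOp.eval : BinOp → Value → Value → Option Value
  | .arith o, [.int m], [.int n] => (o m n).map fun r => [Data.int r]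
  | .eq, [d], [d'] => some [Data.int (if d = d' then 1 else 0)]
  | _, _, _ => none

inductive UnOp
  | deref
  | ret

/-- Statements and expressions. `newLocal x e` is `local x; e` and binds `x` in `e`. -/
inductive Exp
  | var (x : Var)
  | val (v : Value)
  | ite (e e₁ e₂ : Exp)
  | bin (op : BinOp) (e e' : Exp)
  | un (op : UnOp) (e : Exp)
  | new
  | newLocal (x : Var) (e : Exp)
  | app (e e' : Exp)
  | pair (e e' : Exp)

def Exp.names : Exp → Set Name
  | .var _ => ∅
  | .val v => valNames v
  | .ite e e₁ e₂ => e.names ∪ e₁.names ∪ e₂.names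
  | .bin _ e e' => e.names ∪ e'.names
  | .un _ e => e.names
  | .new => ∅
  | .newLocal _ e => e.names
  | .app e e' => e.names ∪ e'.names
  | .pair e e' => e.names ∪ e'.names

/-- Pairing; a pair of values is a value. -/
def Exp.mkPair : Exp → Exp → Exp
  | .val v, .val w => .val (v ++ w)
  | e, e' => .pair e e'

/-- Simultaneous substitution of values for identifiers. -/
def Exp.subst (σ : Var → Option Value) : Exp → Exp
  | .var x => match σ x with
    | some v => .val v
    | none => .var x
  | .val v => .val v
  | .ite e e₁ e₂ => .ite (e.subst σ) (e₁.subst σ) (e₂.subst σ)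
  | .bin op e e' => .bin op (e.subst σ) (e'.subst σ)
  | .un op e => .un op (e.subst σ)
  | .new => .new
  | .newLocal x e => .newLocal x (e.subst (Function.update σ x none))
  | .app e e' => .app (e.subst σ) (e'.subst σ)
  | .pair e e' => Exp.mkPair (e.subst σ) (e'.subst σ)

/-- `e[a/x]` for a location `a`. -/
def Exp.substLoc (x : Var) (a : LocName) (e : Exp) : Exp :=
  e.subst fun y => if y = x then some [Data.loc a] else none

structure Func where
  params : List Var
  body : Exp

/-- `e[v/x̄]`: the arguments are substituted point-wise for the parameters. -/
def Func.inst (F : Func) (v : Value) : Exp :=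
  F.body.subst fun y => ((F.params.zip v).lookup y).map fun d => [d]

/-- A module: the exported and imported names, the declarations of (global) variables with
their initial values, and the declarations of functions. -/
structure Mod where
  exports : List Name
  imports : List Name
  vars : List (LocName × ℤ)
  funs : List (FunName × Func)

namespace Mod

/-- The definition `f @ M` of `f` in `M`, if there is one. -/
def defn (M : Mod) (f : FunName) : Option Func := M.funs.lookup f

def publicNames (M : Mod) : Set Name := {x | x ∈ M.exports ∨ x ∈ M.imports}

def declared (M : Mod) : Set Name :=
  {x | (∃ p ∈ M.vars, x = Name.loc p.1) ∨ ∃ p ∈ M.funs, x = Name.fn p.1}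

def allNames (M : Mod) : Set Name := M.publicNames ∪ M.declared

/-- Concatenation of modules. -/
def comp (M M' : Mod) : Mod where
  exports := M.exports ++ M'.exports
  imports := M.imports ++ M'.imports
  vars := M.vars ++ M'.vars
  funs := M.funs ++ M'.funs

/-- Well-scoped modules: the header lists identifiers of variables and functions, and function
bodies mention declared, exported and imported names only. -/
structure WellScoped (M : Mod) : Prop where
  noCont : ∀ k, Name.cont k ∉ M.publicNames
  bodies : ∀ p ∈ M.funs, p.2.body.names ⊆ M.allNames

/-- Two modules that can be concatenated as they stand: un-exported names have been renamed
apart, no name is declared by both, and every exported or imported variable is declared in one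
of the two. -/
structure Composable (M M' : Mod) : Prop where
  left : M.WellScoped
  right : M'.WellScoped
  declared : Disjoint M.declared M'.declared
  privateLeft : Disjoint (M.declared \ M.publicNames) M'.allNames
  privateRight : Disjoint (M'.declared \ M'.publicNames) M.allNames
  publicVars : ∀ a, Name.loc a ∈ M.publicNames ∪ M'.publicNames →
    Name.loc a ∈ M.declared ∪ M'.declared

end Mod

/-! ### Frames and stores -/

inductive Frame
  | ite (e₁ e₂ : Exp)
  | binL (op : BinOp) (e : Exp)
  | binR (v : Value) (op : BinOp)
  | un (op : UnOp)
  | appL (e : Exp)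
  | appR (v : Value)
  | pairL (e : Exp)
  | pairR (v : Value)

def Frame.names : Frame → Set Name
  | .ite e₁ e₂ => e₁.names ∪ e₂.names
  | .binL _ e => e.names
  | .binR v _ => valNames v
  | .un _ => ∅
  | .appL e => e.names
  | .appR v => valNames v
  | .pairL e => e.names
  | .pairR v => valNames v

/-- Frame stacks, innermost frame first: `t ∘ φ` is `φ :: t`. -/
abbrev Stack := List Frame

def stackNames (t : Stack) : Set Name := {x | ∃ φ ∈ t, x ∈ φ.names}

/-- Stores of locations, as partial functions. (That their domains are finite is imposed where
stores enter, in the transitions of the system.) -/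
abbrev LocStore := LocName → Option Data

namespace LocStore

def dom (s : LocStore) : Set Name := {x | ∃ a d, x = Name.loc a ∧ s a = some d}

def names (s : LocStore) : Set Name := s.dom ∪ {x | ∃ a d, s a = some d ∧ x ∈ d.names}

open Classical in
/-- `s ↾ X` -/
noncomputable def restrict (s : LocStore) (X : Set Name) : LocStore :=
  fun a => if Name.loc a ∈ X then s a else none

open Classical in
/-- `s \ X` -/
noncomputable def without (s : LocStore) (X : Set Name) : LocStore :=
  fun a => if Name.loc a ∈ X then none else s a

/-- `s[s']` -/
def override (s s' : LocStore) : LocStore := fun a => (s' a).or (s a)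

/-- `s ⊑ s'` -/
def ValidExt (s s' : LocStore) : Prop := s.dom ⊆ s'.dom

/-- `s ⊆ s'` -/
def Sub (s s' : LocStore) : Prop := ∀ a d, s a = some d → s' a = some d

/-- No dangling pointers: all locations occurring in the store are in its domain. -/
def Closed (s : LocStore) : Prop := ∀ a, Name.loc a ∈ s.names → Name.loc a ∈ s.dom

/-- `Cl(s, X)` -/
inductive Cl (s : LocStore) (X : Set Name) : Set Name
  | base {x : Name} : x ∈ X → Cl s X x
  | step {a : LocName} {d : Data} {x : Name} :
      Cl s X (Name.loc a) → s a = some d → x ∈ d.names → Cl s X x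

end LocStore

/-- Stores: a store of locations and a store of continuations. -/
@[ext]
structure Store where
  loc : LocStore
  cont : ContName → Option (Stack × ContName)

def Store.names (s : Store) : Set Name :=
  s.loc.names ∪
    {x | ∃ k t k', s.cont k = some (t, k') ∧ (x = Name.cont k ∨ x ∈ stackNames t ∨ x = Name.cont k')}

/-- `s[a ↦ d]` -/
def Store.setLoc (s : Store) (a : LocName) (d : Data) : Store :=
  { s with loc := Function.update s.loc a (some d) }

/-- `s[k ↦ (t, k')]` -/
def Store.setCont (s : Store) (k : ContName) (t : Stack) (k' : ContName) : Store :=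
  { s with cont := Function.update s.cont k (some (t, k')) }

/-- `s[s']` for a store `s'` of locations. -/
def Store.overrideLoc (s : Store) (s' : LocStore) : Store :=
  { s with loc := s.loc.override s' }

/-! ### Configurations and transitions of a module -/

/-- System configurations `⟪N | P ⊢ s⟫`. -/
@[ext]
structure Sys where
  N : Set Name
  P : Set Name
  s : Store

/-- Program configurations `⟨N | P ⊢ s, t, e, k⟩`. -/
@[ext]
structure Prog where
  N : Set Name
  P : Set Name
  s : Store
  t : Stack
  e : Exp
  k : ContName

def Sys.names (c : Sys) : Set Name := c.N ∪ c.P ∪ c.s.names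

def Prog.names (c : Prog) : Set Name :=
  c.N ∪ c.P ∪ c.s.names ∪ stackNames c.t ∪ c.e.names ∪ {Name.cont c.k}

inductive State
  | sys (c : Sys)
  | prog (c : Prog)

namespace State

def N : State → Set Name
  | .sys c => c.N
  | .prog c => c.N

def P : State → Set Name
  | .sys c => c.P
  | .prog c => c.P

def store : State → Store
  | .sys c => c.s
  | .prog c => c.s

def names : State → Set Name
  | .sys c => c.names
  | .prog c => c.names

/-- `N` is a finite set that contains all names in use, in particular the public ones. -/
def WF (X : State) : Prop := X.N.Finite ∧ X.names ⊆ X.N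

end State

/-- Transitions of the abstract machine. -/
inductive Mod.Run (M : Mod) : Prog → Prog → Prop
  | iteTrue {N P s t e₁ e₂ n k} : n ≠ 0 →
      M.Run ⟨N, P, s, .ite e₁ e₂ :: t, .val [.int n], k⟩ ⟨N, P, s, t, e₁, k⟩
  | iteFalse {N P s t e₁ e₂ k} :
      M.Run ⟨N, P, s, .ite e₁ e₂ :: t, .val [.int 0], k⟩ ⟨N, P, s, t, e₂, k⟩
  | binLeft {N P s t op e v k} :
      M.Run ⟨N, P, s, .binL op e :: t, .val v, k⟩ ⟨N, P, s, .binR v op :: t, e, k⟩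
  | star {N P s t op v v' v'' k} : BinOp.eval op v v' = some v'' →
      M.Run ⟨N, P, s, .binR v op :: t, .val v', k⟩ ⟨N, P, s, t, .val v'', k⟩
  | seq {N P s t v v' k} :
      M.Run ⟨N, P, s, .binR v .seq :: t, .val v', k⟩ ⟨N, P, s, t, .val v', k⟩
  | assign {N P s t a d k} :
      M.Run ⟨N, P, s, .binR [.loc a] .assign :: t, .val [d], k⟩
        ⟨N, P, s.setLoc a d, t, .val [], k⟩
  | deref {N P s t a d k} : s.loc a = some d →
      M.Run ⟨N, P, s, .un .deref :: t, .val [.loc a], k⟩ ⟨N, P, s, t, .val [d], k⟩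
  | ret {N P s t v k} :
      M.Run ⟨N, P, s, .un .ret :: t, .val v, k⟩ ⟨N, P, s, t, .val v, k⟩
  | appLeft {N P s t e v k} :
      M.Run ⟨N, P, s, .appL e :: t, .val v, k⟩ ⟨N, P, s, .appR v :: t, e, k⟩
  | pairLeft {N P s t e v k} :
      M.Run ⟨N, P, s, .pairL e :: t, .val v, k⟩ ⟨N, P, s, .pairR v :: t, e, k⟩
  | pairRight {N P s t v v' k} :
      M.Run ⟨N, P, s, .pairR v :: t, .val v', k⟩ ⟨N, P, s, t, .val (v ++ v'), k⟩
  | call {N P s t f F v k} : M.defn f = some F → F.params.length = v.length →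
      M.Run ⟨N, P, s, .appR [.fn f] :: t, .val v, k⟩ ⟨N, P, s, t, F.inst v, k⟩
  | iteStart {N P s t e e₁ e₂ k} :
      M.Run ⟨N, P, s, t, .ite e e₁ e₂, k⟩ ⟨N, P, s, .ite e₁ e₂ :: t, e, k⟩
  | binStart {N P s t op e e' k} :
      M.Run ⟨N, P, s, t, .bin op e e', k⟩ ⟨N, P, s, .binL op e' :: t, e, k⟩
  | unStart {N P s t op e k} :
      M.Run ⟨N, P, s, t, .un op e, k⟩ ⟨N, P, s, .un op :: t, e, k⟩
  | new {N P s t a k} : Name.loc a ∉ N →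
      M.Run ⟨N, P, s, t, .new, k⟩ ⟨N ∪ {Name.loc a}, P, s.setLoc a (.int 0), t, .val [.loc a], k⟩
  | newLocal {N P s t x e a k} : Name.loc a ∉ N →
      M.Run ⟨N, P, s, t, .newLocal x e, k⟩
        ⟨N ∪ {Name.loc a}, P, s.setLoc a (.int 0), t, e.substLoc x a, k⟩
  | appStart {N P s t e e' k} :
      M.Run ⟨N, P, s, t, .app e e', k⟩ ⟨N, P, s, .appL e' :: t, e, k⟩
  | pairStart {N P s t e e' k} :
      M.Run ⟨N, P, s, t, .pair e e', k⟩ ⟨N, P, s, .pairL e' :: t, e, k⟩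

inductive Label
  | call (f : FunName) (v : Value) (k : ContName)
  | ret (v : Value) (k : ContName)

def Label.names : Label → Set Name
  | .call f v k => {Name.fn f} ∪ valNames v ∪ {Name.cont k}
  | .ret v k => valNames v ∪ {Name.cont k}

/-- Program-to-system transitions; the store in the label is the part of the store that the
system can observe. -/
inductive Mod.Out (M : Mod) : Prog → Label → LocStore → Sys → Prop
  | call {N P s t f v k k' P'} : M.defn f = none → Name.cont k' ∉ N →
      P' = s.loc.Cl (P ∪ valNames v) →
      M.Out ⟨N, P, s, .appR [.fn f] :: t, .val v, k⟩ (.call f v k') (s.loc.restrict P')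
        ⟨N ∪ {Name.cont k'}, P' ∪ {Name.cont k'}, s.setCont k' t k⟩
  | ret {N P s v k P'} : P' = s.loc.Cl (P ∪ valNames v) →
      M.Out ⟨N, P, s, [], .val v, k⟩ (.ret v k) (s.loc.restrict P') ⟨N, P', s⟩

/-- The constraints on the store `s'` that the system hands over, together with the value `v`,
to a module whose store is `s`: it is finite, has no dangling pointers, contains the locations
of `v` and still contains the public part of `s`. -/
structure Handover (P : Set Name) (s : Store) (v : Value) (s' : LocStore) : Prop where
  finite : s'.dom.Finite
  closed : s'.Closed
  value : ∀ a, Name.loc a ∈ valNames v → Name.loc a ∈ s'.dom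
  ext : (s.loc.restrict P).ValidExt s'

/-- System-to-program transitions; the store in the label is the update made by the system. -/
inductive Mod.In (M : Mod) : Sys → Label → LocStore → Prog → Prop
  | call {N P s f F v k s'} : M.defn f = some F → s.cont k = none →
      ({Name.fn f} ∪ valNames v ∪ s'.names) ∩ N ⊆ P → Handover P s v s' →
      M.In ⟨N, P, s⟩ (.call f v k) s'
        ⟨N ∪ {Name.cont k} ∪ (valNames v ∪ s'.names), P ∪ {Name.cont k} ∪ (valNames v ∪ s'.names),
          s.overrideLoc s', [.appR [.fn f]], .val v, k⟩
  | ret {N P s v k k' t s'} : s.cont k' = some (t, k) →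
      (valNames v ∪ s'.names) ∩ N ⊆ P → Handover P s v s' →
      M.In ⟨N, P, s⟩ (.ret v k') s'
        ⟨N ∪ (valNames v ∪ s'.names), P ∪ (valNames v ∪ s'.names), s.overrideLoc s', t, .val v, k⟩

/-- Unlabelled transitions of the system-level semantics of `M`. -/
inductive Mod.Step (M : Mod) : State → State → Prop
  | run {p p' : Prog} : M.Run p p' → M.Step (.prog p) (.prog p')

/-- Labelled transitions of the system-level semantics of `M`. -/
inductive Mod.LStep (M : Mod) : State → Label → LocStore → State → Prop
  | out {p : Prog} {α : Label} {s : LocStore} {c : Sys} :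
      M.Out p α s c → M.LStep (.prog p) α s (.sys c)
  | into {c : Sys} {α : Label} {s : LocStore} {p : Prog} :
      M.In c α s p → M.LStep (.sys c) α s (.prog p)

/-- The store of `M` in which all variables have their declared initial values. -/
def Mod.initLoc (M : Mod) : LocStore := fun a => (M.vars.lookup a).map Data.int

/-- The initial configuration of `M`. -/
def Mod.init (M : Mod) : Sys := ⟨M.allNames, M.publicNames, ⟨M.initLoc, fun _ => none⟩⟩

/-! ### Semantic composition -/

/-- Composite states `X₁ ⊗ X₂`, with the set `pub` of names that have been communicated with the
outside, the set `pubS` of the continuation names in `pub` that have system polarity (the others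
have program polarity), and the auxiliary store `s`. -/
@[ext]
structure Comp where
  X₁ : State
  X₂ : State
  pub : Set Name
  pubS : Set ContName
  s : LocStore

def Comp.swap (c : Comp) : Comp := ⟨c.X₂, c.X₁, c.pub, c.pubS, c.s⟩

/-- The side conditions on a store `s` that the outside system supplies to one of two system
configurations with private names `pr`: public locations stay defined; private locations shared
by the two modules keep their values; and, apart from that, no private name is mentioned, neither
in `s` nor among the names `A` of the function and the value in the label. -/
structure SysUpdate (pub pr A : Set Name) (s' s : LocStore) : Prop where
  ext : (s'.restrict pub).ValidExt s
  keep : (s'.without pub).Sub s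
  noGuess : s.dom ∩ pr ⊆ s'.dom
  private' : (A ∪ (s.without pr).names) ∩ pr = ∅

/-- Internal moves, with the left component active. -/
inductive IntL (M M' : Mod) : Comp → Comp → Prop
  | int {p p' : Prog} {c : Sys} {pub pubS s} : M.Run p p' → p'.names ∩ c.names ⊆ p.names →
      IntL M M' ⟨.prog p, .sys c, pub, pubS, s⟩ ⟨.prog p', .sys c, pub, pubS, s⟩

/-- Cross-calls and cross-returns, with the left component active. -/
inductive TauL (M M' : Mod) : Comp → Comp → Prop
  | call {p p' : Prog} {c c' : Sys} {pub pubS s s' f v k} :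
      M.Out p (.call f v k) s c' → M'.In c (.call f v k) s p' → Name.cont k ∉ c.names →
      TauL M M' ⟨.prog p, .sys c, pub, pubS, s'⟩ ⟨.sys c', .prog p', pub, pubS, s'.override s⟩
  | ret {p p' : Prog} {c c' : Sys} {pub pubS s s' v k} :
      M.Out p (.ret v k) s c' → M'.In c (.ret v k) s p' →
      TauL M M' ⟨.prog p, .sys c, pub, pubS, s'⟩ ⟨.sys c', .prog p', pub, pubS, s'.override s⟩

/-- Program calls and returns, system calls and returns, with the left component active. -/
inductive ExtL (M M' : Mod) : Comp → Label → LocStore → Comp → Prop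
  | progCall {p : Prog} {c c' : Sys} {pub pubS s s' s'' f v k pub'} :
      M.Out p (.call f v k) s c' → (¬ ∃ p', M'.In c (.call f v k) s p') →
      s'' = s'.override s → pub' = s''.Cl (valNames v ∪ pub) ∪ {Name.cont k} →
      Name.cont k ∉ c.names →
      ExtL M M' ⟨.prog p, .sys c, pub, pubS, s'⟩ (.call f v k) (s''.restrict pub')
        ⟨.sys c', .sys c, pub', pubS \ {k}, s''⟩
  | progRet {p : Prog} {c c' : Sys} {pub pubS s s' s'' v k pub'} :
      M.Out p (.ret v k) s c' → (¬ ∃ p', M'.In c (.ret v k) s p') →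
      s'' = s'.override s → pub' = s''.Cl (valNames v ∪ pub) →
      ExtL M M' ⟨.prog p, .sys c, pub, pubS, s'⟩ (.ret v k) (s''.restrict pub')
        ⟨.sys c', .sys c, pub', pubS, s''⟩
  | sysCall {c c' : Sys} {p : Prog} {pub pubS s s' f v k pr pub'} :
      M.In c (.call f v k) s p → pr = (c.names ∪ c'.names) \ pub →
      SysUpdate pub pr ({Name.fn f} ∪ valNames v) s' s →
      pub' = pub ∪ (valNames v ∪ (s.without pr).names) ∪ {Name.cont k} →
      (Name.cont k ∈ c'.names → k ∈ pubS) →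
      ExtL M M' ⟨.sys c, .sys c', pub, pubS, s'⟩ (.call f v k) (s.restrict pub')
        ⟨.prog p, .sys c', pub', pubS ∪ {k}, s'.override s⟩
  | sysRet {c c' : Sys} {p : Prog} {pub pubS s s' v k pr pub'} :
      M.In c (.ret v k) s p → pr = (c.names ∪ c'.names) \ pub →
      SysUpdate pub pr (valNames v) s' s →
      pub' = pub ∪ (valNames v ∪ (s.without pr).names) →
      Name.cont k ∉ c'.names →
      ExtL M M' ⟨.sys c, .sys c', pub, pubS, s'⟩ (.ret v k) (s.restrict pub')
        ⟨.prog p, .sys c', pub', pubS, s'.override s⟩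

/-- Unlabelled transitions of `⟦M⟧ ⊗ ⟦M'⟧`. -/
def IntStep (M M' : Mod) (c c' : Comp) : Prop :=
  IntL M M' c c' ∨ IntL M' M c.swap c'.swap

/-- `τ`-transitions of `⟦M⟧ ⊗ ⟦M'⟧`. -/
def TauStep (M M' : Mod) (c c' : Comp) : Prop :=
  TauL M M' c c' ∨ TauL M' M c.swap c'.swap

/-- Labelled transitions of `⟦M⟧ ⊗ ⟦M'⟧`. -/
def ExtStep (M M' : Mod) (c : Comp) (α : Label) (s : LocStore) (c' : Comp) : Prop :=
  ExtL M M' c α s c' ∨ ExtL M' M c.swap α s c'.swap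

/-- The initial state of `⟦M⟧ ⊗ ⟦M'⟧`. -/
noncomputable def initComp (M M' : Mod) : Comp where
  X₁ := .sys M.init
  X₂ := .sys M'.init
  pub := M.publicNames ∪ M'.publicNames
  pubS := ∅
  s := (M.initLoc.restrict M.publicNames).override (M'.initLoc.restrict M'.publicNames)

inductive Reachable (M M' : Mod) : Comp → Prop
  | init : Reachable M M' (initComp M M')
  | int {c c'} : Reachable M M' c → IntStep M M' c c' → Reachable M M' c'
  | tau {c c'} : Reachable M M' c → TauStep M M' c c' → Reachable M M' c'
  | ext {c α s c'} : Reachable M M' c → ExtStep M M' c α s c' → Reachable M M' c'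

/-! ### The translation -/

/-- The set `K` of private continuation names. -/
def Comp.K (c : Comp) : Set ContName := {k | Name.cont k ∈ c.X₁.P ∩ c.X₂.P ∧ k ∉ c.pubS}

/-- The graph of `(s₁, s₂)_K`: follow private continuation names back to an external one,
collecting the frame stacks. -/
inductive Fetch (s₁ s₂ : Store) (K : Set ContName) : Stack × ContName → Stack × ContName → Prop
  | done {t k} : k ∉ K → Fetch s₁ s₂ K (t, k) (t, k)
  | back {t k t' k' q} : k ∈ K → (s₁.cont k = some (t', k') ∨ s₂.cont k = some (t', k')) →
      Fetch s₁ s₂ K (t ++ t', k') q → Fetch s₁ s₂ K (t, k) q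

open Classical in
/-- `(s₁, s₂)_K` as a function (the identity where it is undefined). -/
noncomputable def fetch (s₁ s₂ : Store) (K : Set ContName) (p : Stack × ContName) :
    Stack × ContName :=
  if h : ∃ q, Fetch s₁ s₂ K p q then h.choose else p

namespace Comp

noncomputable def fetch (c : Comp) (p : Stack × ContName) : Stack × ContName :=
  SLS.fetch c.X₁.store c.X₂.store c.K p

open Classical in
/-- The continuations of the translated state: those of both components, completed by `fetch`,
without the private names. -/
noncomputable def hatCont (c : Comp) (k : ContName) : Option (Stack × ContName) :=
  if k ∈ c.K then none else ((c.X₁.store.cont k).or (c.X₂.store.cont k)).map c.fetch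

/-- The used names of the translated state. -/
def hatN (c : Comp) : Set Name := (c.X₁.N ∪ c.X₂.N) \ Name.cont '' c.K

/-- The values of the shared public locations, `s ↾ (P₁ ∩ P₂)`. -/
noncomputable def shared (c : Comp) : LocStore := c.s.restrict (c.X₁.P ∩ c.X₂.P)

/-- The program configuration into which a composite state with active program `p` and inactive
system configuration `σ` is translated. -/
noncomputable def transProg (c : Comp) (p : Prog) (σ : Sys) : State :=
  .prog ⟨c.hatN, c.pub, ⟨σ.s.loc.override p.s.loc, c.hatCont⟩,
    (c.fetch (p.t, p.k)).1, p.e, (c.fetch (p.t, p.k)).2⟩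

/-- The translation `R` of composite states (a junk value is given to pairs of programs, which
are never reached). The union of the two stores of system configurations is a function by
`Translatable`, hence may be computed as an override. -/
noncomputable def R (c : Comp) : State :=
  match c.X₁, c.X₂ with
  | .sys σ₁, .sys σ₂ => .sys ⟨c.hatN, c.pub,
      ⟨(σ₁.s.loc.override c.shared).override (σ₂.s.loc.override c.shared), c.hatCont⟩⟩
  | .sys σ₁, .prog p₂ => c.transProg p₂ σ₁
  | .prog p₁, .sys σ₂ => c.transProg p₁ σ₂
  | .prog p₁, .prog _ => .prog p₁

/-- The translation is well-defined at `c`: the continuation stores have disjoint domains,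
searching back from a stored continuation, or from the current one, ends in exactly one result;
for two system configurations, the stores that are united agree where both are defined; and not
both components are programs. -/
structure Translatable (c : Comp) : Prop where
  disjoint : ∀ k, c.X₁.store.cont k = none ∨ c.X₂.store.cont k = none
  stored : ∀ k p, (c.X₁.store.cont k = some p ∨ c.X₂.store.cont k = some p) →
    ∃! q, Fetch c.X₁.store c.X₂.store c.K p q
  current : ∀ p, (c.X₁ = .prog p ∨ c.X₂ = .prog p) →
    ∃! q, Fetch c.X₁.store c.X₂.store c.K (p.t, p.k) q
  union : ∀ σ₁ σ₂, c.X₁ = .sys σ₁ → c.X₂ = .sys σ₂ → ∀ a d₁ d₂,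
    (σ₁.s.loc.override c.shared) a = some d₁ → (σ₂.s.loc.override c.shared) a = some d₂ → d₁ = d₂
  notBoth : ∀ p₁ p₂, ¬ (c.X₁ = .prog p₁ ∧ c.X₂ = .prog p₂)

end Comp

end SLS

namespace SLS

/-! ### Names -/

/-! A reachable composite state is a single run of the concatenated module, cut in two at the
cross-calls, and `R` glues the halves back together: stack pieces along the private continuation
names in `K`, location stores by letting the most recent copy win. Both gluings are controlled by an
invariant `Inv` of reachable states.

Its location part `LocInv` says that a name known to both components is public in both; that the
active component has a value for every location it knows, among them all public locations of its
partner; that an inactive component agrees with the auxiliary store on the locations public in it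
alone; and that the auxiliary store is defined exactly on the locations public in either component.
Its continuation part `ContInv` says that no continuation name is stored twice, that a stored
continuation leads to a name stored by the partner or introduced by the outside, and that a rank
decreases along such links. Hence following names in `K` terminates (`exists_fetch`), has one result
(`Fetch.det`) and ends outside `K`.

A cross-call or cross-return only moves data between the halves. The combined store is unchanged
(`tau_override`), and the stack piece that is stored under the new name, or resumed, is the one that
`fetch` attaches anyway (`R_tauCall`, `R_tauRet`). For internal steps, `R` of a state with active
program `p` is `p` run over a fixed bottom stack in a larger store (`R_prog`). The machine inspects
only the top of the stack, so steps of `p` lift (`Mod.Run.embed`). They can be pulled back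
(`Mod.Run.of_embed`) except when `p` has finished above a nonempty bottom stack or calls a function
of the other module; then a τ-transition exists (`exists_tauRet`, `exists_tauCall`).

For labelled steps, the visible stores and closures of both sides are compared location by location
(`observed_Cl`, `observed_restrict`, `merged_out`, `merged_update`). A refusal by the inactive
component means just that the function is not defined there, or the continuation not stored there,
because all other side conditions of acceptance follow from the invariant (`accepts_call`,
`accepts_ret`). Reflection of labelled steps follows from their simulation: the label and its store
determine the target (`Mod.LStep.det`), so it suffices to exhibit some composite step with that
label and store. For a step of the outside this means rebuilding the full update from its visible
part, by adding the private part of the auxiliary store. Disjointness of the label from `K` is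
needed because the translated state has forgotten the names in `K`.

All arguments are made with the left component active; `Inv.swap` and `R_swap` give the other case.
-/

theorem cont_notMem_data (k : ContName) (d : Data) : Name.cont k ∉ d.names := by
  cases d <;> simp [Data.names]

theorem cont_notMem_valNames (k : ContName) (v : Value) : Name.cont k ∉ valNames v := by
  rintro ⟨d, _, h⟩
  exact cont_notMem_data k d h

theorem cont_notMem_exp (k : ContName) (e : Exp) : Name.cont k ∉ e.names := by
  induction e <;> simp_all [Exp.names, cont_notMem_valNames]

theorem cont_notMem_stackNames (k : ContName) (t : Stack) : Name.cont k ∉ stackNames t := by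
  rintro ⟨φ, _, h⟩
  cases φ <;> simp [Frame.names, cont_notMem_exp, cont_notMem_valNames] at h

theorem Data.names_finite (d : Data) : d.names.Finite := by
  cases d <;> simp [Data.names]

theorem valNames_finite (v : Value) : (valNames v).Finite := by
  have : valNames v = ⋃ d ∈ {d | d ∈ v}, d.names := by ext; simp [valNames]
  rw [this]
  exact (List.finite_toSet v).biUnion fun d _ => d.names_finite

@[simp] theorem valNames_nil : valNames [] = ∅ := by simp [valNames]

@[simp] theorem valNames_singleton (d : Data) : valNames [d] = d.names := by simp [valNames]

theorem valNames_append (v w : Value) : valNames (v ++ w) = valNames v ∪ valNames w := by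
  ext x
  simp only [valNames, List.mem_append, Set.mem_ofPred_eq, Set.mem_union]
  grind

@[simp] theorem stackNames_nil : stackNames [] = ∅ := by simp [stackNames]

@[simp] theorem stackNames_cons (φ : Frame) (t : Stack) :
    stackNames (φ :: t) = φ.names ∪ stackNames t := by
  ext x; simp [stackNames]

@[simp] theorem stackNames_append (t u : Stack) :
    stackNames (t ++ u) = stackNames t ∪ stackNames u := by
  ext x
  simp only [stackNames, List.mem_append, Set.mem_ofPred_eq, Set.mem_union]
  grind

theorem Exp.mkPair_names (e e' : Exp) : (e.mkPair e').names = e.names ∪ e'.names := by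
  cases e <;> cases e' <;> simp [Exp.mkPair, Exp.names, valNames_append]

theorem Exp.subst_names (e : Exp) (X : Set Name) (σ : Var → Option Value)
    (hσ : ∀ x v, σ x = some v → valNames v ⊆ X) : (e.subst σ).names ⊆ e.names ∪ X := by
  induction e generalizing σ with
  | var x =>
    simp only [Exp.subst]
    cases h : σ x with
    | none => simp [Exp.names]
    | some v => simpa [Exp.names] using hσ x v h
  | val v => simp [Exp.subst, Exp.names]
  | ite e e₁ e₂ h h₁ h₂ =>
    have := h σ hσ; have := h₁ σ hσ; have := h₂ σ hσ
    simp only [Exp.subst, Exp.names]; grind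
  | bin op e e' h h' =>
    have := h σ hσ; have := h' σ hσ
    simp only [Exp.subst, Exp.names]; grind
  | un op e h => simpa only [Exp.subst, Exp.names] using h σ hσ
  | new => simp [Exp.subst, Exp.names]
  | newLocal x e h =>
    simp only [Exp.subst, Exp.names]
    refine h _ fun y v hy => ?_
    by_cases hxy : y = x
    · subst hxy; simp at hy
    · rw [Function.update_of_ne hxy] at hy; exact hσ y v hy
  | app e e' h h' =>
    have := h σ hσ; have := h' σ hσ
    simp only [Exp.subst, Exp.names]; grind
  | pair e e' h h' =>
    have := h σ hσ; have := h' σ hσ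
    simp only [Exp.subst, Exp.names, Exp.mkPair_names]; grind

theorem Exp.substLoc_names (x : Var) (a : LocName) (e : Exp) :
    (e.substLoc x a).names ⊆ e.names ∪ {Name.loc a} := by
  refine e.subst_names _ _ fun y v h => ?_
  split at h
  · cases h; simp [Data.names]
  · cases h

theorem lookup_mem {α β : Type*} [BEq α] [LawfulBEq α] {l : List (α × β)} {a : α} {b : β}
    (h : l.lookup a = some b) : (a, b) ∈ l := by
  induction l with
  | nil => simp at h
  | cons p l ih =>
    obtain ⟨a', b'⟩ := p
    rw [List.lookup_cons] at h
    split at h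
    · rename_i hab
      simp only [beq_iff_eq] at hab
      cases h; simp [hab]
    · exact List.mem_cons_of_mem _ (ih h)

theorem lookup_isSome_of_mem {α β : Type*} [BEq α] [LawfulBEq α] {l : List (α × β)} {a : α} {b : β}
    (h : (a, b) ∈ l) : ∃ b', l.lookup a = some b' := by
  induction l with
  | nil => simp at h
  | cons p l ih =>
    obtain ⟨a', b'⟩ := p
    rw [List.lookup_cons]
    split
    · exact ⟨_, rfl⟩
    · rename_i hab
      rcases List.mem_cons.1 h with h | h
      · cases h; simp at hab
      · exact ih h

theorem Func.inst_names (F : Func) (v : Value) : (F.inst v).names ⊆ F.body.names ∪ valNames v := by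
  refine F.body.subst_names _ _ fun y w h => ?_
  simp only [Option.map_eq_some_iff] at h
  obtain ⟨d, h, rfl⟩ := h
  intro x hx
  exact ⟨d, (List.of_mem_zip (lookup_mem h)).2, by simpa using hx⟩

/-! ### Stores of locations -/

namespace LocStore

theorem loc_mem_dom {s : LocStore} {a : LocName} : Name.loc a ∈ s.dom ↔ ∃ d, s a = some d := by
  simp [dom]

theorem mem_names {s : LocStore} {x : Name} :
    x ∈ s.names ↔ ∃ a d, s a = some d ∧ (x = Name.loc a ∨ x ∈ d.names) := by
  simp only [names, dom, Set.mem_union, Set.mem_ofPred_eq]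
  grind

theorem cont_notMem_names (k : ContName) (s : LocStore) : Name.cont k ∉ s.names := by
  rw [mem_names]
  rintro ⟨a, d, -, h | h⟩
  · cases h
  · exact cont_notMem_data k d h

theorem names_finite {s : LocStore} (h : s.dom.Finite) : s.names.Finite := by
  have : s.names ⊆ ⋃ n ∈ s.dom, {x | ∃ a d, n = Name.loc a ∧ s a = some d ∧
      (x = Name.loc a ∨ x ∈ d.names)} := by
    intro x hx
    obtain ⟨a, d, h, hx⟩ := mem_names.1 hx
    simp only [Set.mem_iUnion]
    exact ⟨Name.loc a, ⟨a, d, rfl, h⟩, a, d, rfl, h, hx⟩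
  refine (h.biUnion ?_).subset this
  rintro _ ⟨a, d, rfl, h⟩
  refine (d.names_finite.insert (Name.loc a)).subset ?_
  rintro x ⟨a', d', h1, h2, h3⟩
  cases h1
  rw [h] at h2
  cases h2
  exact h3

theorem restrict_apply (s : LocStore) (X : Set Name) (a : LocName) (d : Data) :
    s.restrict X a = some d ↔ Name.loc a ∈ X ∧ s a = some d := by
  simp only [restrict]; split <;> simp_all

theorem without_apply (s : LocStore) (X : Set Name) (a : LocName) (d : Data) :
    s.without X a = some d ↔ Name.loc a ∉ X ∧ s a = some d := by
  simp only [without]; split <;> simp_all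

theorem override_apply (s s' : LocStore) (a : LocName) (d : Data) :
    s.override s' a = some d ↔ s' a = some d ∨ (s' a = none ∧ s a = some d) := by
  simp only [override]; cases s' a <;> simp

theorem override_of_none {s s' : LocStore} {a : LocName} (h : s' a = none) :
    s.override s' a = s a := by simp [override, h]

theorem override_of_some {s s' : LocStore} {a : LocName} {d : Data} (h : s' a = some d) :
    s.override s' a = some d := by simp [override, h]

theorem override_comm {s s' : LocStore}
    (h : ∀ a d d', s a = some d → s' a = some d' → d = d') : s.override s' = s'.override s := by
  funext a
  have := h a
  simp only [override]
  cases h₁ : s a <;> cases h₂ : s' a <;> simp_all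

theorem Cl_subset {s : LocStore} {X N : Set Name} (hX : X ⊆ N)
    (hs : ∀ a d x, Name.loc a ∈ N → s a = some d → x ∈ d.names → x ∈ N) : s.Cl X ⊆ N := by
  intro x hx
  change Cl s X x at hx
  induction hx with
  | base h => exact hX h
  | step _ h hd ih => exact hs _ _ _ ih h hd

theorem subset_Cl (s : LocStore) (X : Set Name) : X ⊆ s.Cl X := fun _ h => Cl.base h

theorem Cl_step {s : LocStore} {X : Set Name} {a : LocName} {d : Data} {x : Name}
    (h : Name.loc a ∈ s.Cl X) (hs : s a = some d) (hx : x ∈ d.names) : x ∈ s.Cl X :=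
  Cl.step h hs hx

theorem cont_mem_Cl {s : LocStore} {X : Set Name} {k : ContName} :
    Name.cont k ∈ s.Cl X ↔ Name.cont k ∈ X := by
  refine ⟨fun h => ?_, fun h => subset_Cl _ _ h⟩
  change Cl s X _ at h
  cases h with
  | base h => exact h
  | step _ _ h => exact absurd h (cont_notMem_data _ _)

/-- The set `N` is closed under `s`, and by agreement under `s'` as well, so neither closure leaves
the region where the two stores coincide. -/
theorem Cl_congr {s s' : LocStore} {X N : Set Name} (hX : X ⊆ N)
    (hs : ∀ a d x, Name.loc a ∈ N → s a = some d → x ∈ d.names → x ∈ N)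
    (h : ∀ a, Name.loc a ∈ N → s a = s' a) : s.Cl X = s'.Cl X := by
  have hs' : ∀ a d x, Name.loc a ∈ N → s' a = some d → x ∈ d.names → x ∈ N :=
    fun a d x ha hd => hs a d x ha ((h a ha).trans hd)
  refine Set.Subset.antisymm (Cl_subset (subset_Cl _ _) ?_) (Cl_subset (subset_Cl _ _) ?_)
  · exact fun a d x ha hd => Cl_step ha ((h a (Cl_subset hX hs' ha)).symm.trans hd)
  · exact fun a d x ha hd => Cl_step ha ((h a (Cl_subset hX hs ha)).trans hd)

end LocStore

/-! ### The location part of the invariant -/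

/-- Conditions on the used names `N`, the public names `P` and the location store `l` of a
component, relative to the names `N'`, `P'` of the other component and the auxiliary store `s`. -/
structure LocHalf (N P : Set Name) (l : LocStore) (act : Prop) (N' P' : Set Name) (s : LocStore) :
    Prop where
  fin : N.Finite
  sub : P ⊆ N
  dom : ∀ a d, l a = some d → Name.loc a ∈ N
  rng : ∀ a d x, l a = some d → x ∈ d.names → x ∈ N
  shared : ∀ x ∈ N, x ∈ N' → x ∈ P
  own : ∀ a, Name.loc a ∈ N → Name.loc a ∉ N' → ∃ d, l a = some d
  agree : ¬ act → ∀ a, Name.loc a ∈ P → Name.loc a ∉ P' → l a = s a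
  active : act → ∀ a, Name.loc a ∈ N → ∃ d, l a = some d
  cover : act → ∀ a, Name.loc a ∈ P' → Name.loc a ∈ P

/-- The auxiliary store records what has crossed a component boundary. Its domain and range
conditions make it a store over the names public in either component, and `pub` is the part of those
names that the outside has seen. -/
structure LocInv (N₁ P₁ : Set Name) (l₁ : LocStore) (act₁ : Prop)
    (N₂ P₂ : Set Name) (l₂ : LocStore) (act₂ : Prop) (pub : Set Name) (s : LocStore) : Prop where
  left : LocHalf N₁ P₁ l₁ act₁ N₂ P₂ s
  right : LocHalf N₂ P₂ l₂ act₂ N₁ P₁ s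
  dom : ∀ a, (∃ d, s a = some d) ↔ Name.loc a ∈ P₁ ∨ Name.loc a ∈ P₂
  rng : ∀ a d x, s a = some d → x ∈ d.names → x ∈ P₁ ∨ x ∈ P₂
  pub : ∀ x ∈ pub, x ∈ P₁ ∨ x ∈ P₂

namespace LocInv

variable {N₁ P₁ N₂ P₂ pub V J : Set Name} {l₁ l₂ s : LocStore} {act₁ act₂ : Prop}

theorem swap (h : LocInv N₁ P₁ l₁ act₁ N₂ P₂ l₂ act₂ pub s) :
    LocInv N₂ P₂ l₂ act₂ N₁ P₁ l₁ act₁ pub s :=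
  ⟨h.right, h.left, fun a => (h.dom a).trans or_comm, fun a d x hd hx => (h.rng a d x hd hx).symm,
    fun x hx => (h.pub x hx).symm⟩

theorem pub_left (h : LocInv N₁ P₁ l₁ act₁ N₂ P₂ l₂ act₂ pub s) {x : Name} (hx : x ∈ pub)
    (hN : x ∈ N₁) : x ∈ P₁ :=
  (h.pub x hx).elim id fun h2 => h.left.shared x hN (h.right.sub h2)

theorem exposed (h : LocInv N₁ P₁ l₁ act₁ N₂ P₂ l₂ act₂ pub s) (hV : V ⊆ N₁) :
    l₁.Cl (P₁ ∪ V) ⊆ N₁ :=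
  LocStore.Cl_subset (Set.union_subset h.left.sub hV) fun a d x _ => h.left.rng a d x

/-- The exposed set is closed under reachability, so handing over the store on it reveals nothing
beyond it. -/
theorem label_names :
    V ∪ (l₁.restrict (l₁.Cl (P₁ ∪ V))).names ⊆ l₁.Cl (P₁ ∪ V) := by
  rintro x (hx | hx)
  · exact LocStore.subset_Cl _ _ (Or.inr hx)
  · obtain ⟨a, d, hd, hx⟩ := LocStore.mem_names.1 hx
    rw [LocStore.restrict_apply] at hd
    rcases hx with rfl | hx
    · exact hd.1
    · exact LocStore.Cl_step hd.1 hd.2 hx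

/-- The store of an active component is total on its locations, so the store in its label is defined
on every exposed location. -/
theorem label_dom (h : LocInv N₁ P₁ l₁ act₁ N₂ P₂ l₂ act₂ pub s) (ha : act₁) (hV : V ⊆ N₁)
    {a : LocName} (hC : Name.loc a ∈ l₁.Cl (P₁ ∪ V)) :
    ∃ d, l₁.restrict (l₁.Cl (P₁ ∪ V)) a = some d := by
  obtain ⟨d, hd⟩ := h.left.active ha a (h.exposed hV hC)
  exact ⟨d, (LocStore.restrict_apply _ _ _ _).2 ⟨hC, hd⟩⟩

theorem label_mem (h : LocInv N₁ P₁ l₁ act₁ N₂ P₂ l₂ act₂ pub s) (ha : act₁) (hV : V ⊆ N₁)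
    {a : LocName} (hC : Name.loc a ∈ l₁.Cl (P₁ ∪ V)) :
    Name.loc a ∈ (l₁.restrict (l₁.Cl (P₁ ∪ V))).names :=
  let ⟨d, hd⟩ := h.label_dom ha hV hC
  LocStore.mem_names.2 ⟨a, d, hd, Or.inl rfl⟩

/-- A cross-call or cross-return preserves the invariant. -/
theorem tau (h : LocInv N₁ P₁ l₁ act₁ N₂ P₂ l₂ act₂ pub s) (ha : act₁) (ha' : ¬ act₂)
    (hV : V ⊆ N₁) (hJ : J.Finite) (hJl : ∀ a, Name.loc a ∉ J)
    {s₀ : LocStore} (hs₀ : s₀ = l₁.restrict (l₁.Cl (P₁ ∪ V))) (hfin : s₀.dom.Finite)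
    (hVf : V.Finite) (b₁ b₂ : Prop) :
    LocInv (N₁ ∪ J) (l₁.Cl (P₁ ∪ V) ∪ J) l₁ b₁
      (N₂ ∪ J ∪ (V ∪ s₀.names)) (P₂ ∪ J ∪ (V ∪ s₀.names)) (l₂.override s₀) b₂
      pub (s.override s₀) := by
  subst hs₀
  have hPC : P₁ ⊆ l₁.Cl (P₁ ∪ V) := fun x hx => LocStore.subset_Cl _ _ (Or.inl hx)
  have hCN := h.exposed hV
  have hlab := label_names (P₁ := P₁) (V := V) (l₁ := l₁)
  have hdom := fun a => h.label_dom ha hV (a := a)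
  have hmem := fun a => h.label_mem ha hV (a := a)
  have hstep := fun a d x => LocStore.Cl_step (s := l₁) (X := P₁ ∪ V) (a := a) (d := d) (x := x)
  have hres := LocStore.restrict_apply l₁ (l₁.Cl (P₁ ∪ V))
  have hnm : ∀ a d, l₁.restrict (l₁.Cl (P₁ ∪ V)) a = some d → Name.loc a ∈ l₁.Cl (P₁ ∪ V) :=
    fun a d hd => ((hres a d).1 hd).1
  have hnn := fun a => Option.eq_none_or_eq_some (l₁.restrict (l₁.Cl (P₁ ∪ V)) a)
  set C := l₁.Cl (P₁ ∪ V) with hC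
  set s₀ := l₁.restrict C with hs
  have hsn := LocStore.names_finite hfin
  have hmn := fun x => LocStore.mem_names (s := s₀) (x := x)
  have o1 := LocStore.override_apply l₂ s₀
  have o2 := LocStore.override_apply s s₀
  obtain ⟨⟨f1, sub1, dom1, rng1, sh1, own1, agr1, act1, cov1⟩,
    ⟨f2, sub2, dom2, rng2, sh2, own2, agr2, act2, cov2⟩, dm, rg, pb⟩ := h
  have act1 := act1 ha
  have cov1 := cov1 ha
  have agr2 := agr2 ha'
  clear_value C s₀
  -- The receiver becomes total on its locations. One that is not exposed cannot be known to the
  -- sender, since a shared name is public there and hence exposed; so the receiver owned it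
  -- already.
  have hac : ∀ a, Name.loc a ∈ N₂ ∪ J ∪ (V ∪ s₀.names) → ∃ d, l₂.override s₀ a = some d := by
    rintro a ((h1 | h1) | h1)
    · by_cases hC : Name.loc a ∈ C
      · obtain ⟨d, hd⟩ := hdom a hC
        exact ⟨d, (o1 _ _).2 (Or.inl hd)⟩
      · obtain ⟨d, hd⟩ := own2 a h1 fun h2 => hC (hPC (sh1 _ h2 h1))
        refine ⟨d, (o1 _ _).2 (Or.inr ⟨?_, hd⟩)⟩
        rcases hnn a with h3 | ⟨d, h3⟩
        · exact h3
        · exact absurd (hnm a d h3) hC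
    · exact absurd h1 (hJl a)
    · obtain ⟨d, hd⟩ := hdom a (hlab h1)
      exact ⟨d, (o1 _ _).2 (Or.inl hd)⟩
  refine ⟨⟨f1.union hJ, ?_, ?_, ?_, ?_, ?_, ?_, ?_, ?_⟩,
    ⟨?_, ?_, ?_, ?_, ?_, ?_, ?_, ?_, ?_⟩, ?_, ?_, ?_⟩
  · grind
  · grind
  · grind
  · grind
  · grind
  -- Agreement for the sender is vacuous: each of its exposed locations has just become public in
  -- the receiver.
  · intro _ a h1 h2
    exfalso
    rcases h1 with h1 | h1
    · exact h2 (Or.inr (Or.inr (hmem a h1)))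
    · exact hJl a h1
  · grind
  · grind
  · exact (f2.union hJ).union (hVf.union hsn)
  · grind
  · grind
  · grind
  · grind
  · exact fun a h1 _ => hac a h1
  · intro _ a h1 h2
    have h3 : Name.loc a ∉ C := fun h3 => h2 (Or.inl h3)
    have h4 : s₀ a = none := by
      rcases hnn a with h4 | ⟨d, h4⟩
      · exact h4
      · exact absurd (hnm a d h4) h3
    rw [LocStore.override_of_none h4, LocStore.override_of_none h4]
    refine agr2 a ?_ fun h5 => h3 (hPC h5)
    grind
  · exact fun _ => hac
  · grind
  · grind
  · grind
  · grind

/-- A call or a return of the program to the outside preserves the invariant. -/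
theorem out (h : LocInv N₁ P₁ l₁ act₁ N₂ P₂ l₂ act₂ pub s) (ha : act₁) (ha' : ¬ act₂)
    (hV : V ⊆ N₁) (hJ : J.Finite) (hJN : ∀ x ∈ J, x ∉ N₁ ∧ x ∉ N₂) (hJl : ∀ a, Name.loc a ∉ J)
    {s₀ : LocStore} (hs₀ : s₀ = s.override (l₁.restrict (l₁.Cl (P₁ ∪ V)))) (b₁ : Prop) :
    LocInv (N₁ ∪ J) (l₁.Cl (P₁ ∪ V) ∪ J) l₁ b₁ N₂ P₂ l₂ act₂ (s₀.Cl (V ∪ pub) ∪ J) s₀ := by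
  have hPC : P₁ ⊆ l₁.Cl (P₁ ∪ V) := fun x hx => LocStore.subset_Cl _ _ (Or.inl hx)
  have hVC : V ⊆ l₁.Cl (P₁ ∪ V) := fun x hx => LocStore.subset_Cl _ _ (Or.inr hx)
  have hCN := h.exposed hV
  have hdom := fun a => h.label_dom ha hV (a := a)
  have hstep := fun a d x => LocStore.Cl_step (s := l₁) (X := P₁ ∪ V) (a := a) (d := d) (x := x)
  have hres := LocStore.restrict_apply l₁ (l₁.Cl (P₁ ∪ V))
  have hnn := fun a => Option.eq_none_or_eq_some (l₁.restrict (l₁.Cl (P₁ ∪ V)) a)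
  have o2 := LocStore.override_apply s (l₁.restrict (l₁.Cl (P₁ ∪ V)))
  rw [← hs₀] at o2
  set C := l₁.Cl (P₁ ∪ V) with hC
  have hrg : ∀ a d x, s₀ a = some d → x ∈ d.names → x ∈ C ∨ x ∈ P₂ := by
    intro a d x hd hx
    rcases (o2 a d).1 hd with h1 | h1
    · have := (hres a d).1 h1
      exact Or.inl (hstep a d x this.1 this.2 hx)
    · exact (h.rng a d x h1.2 hx).imp_left (hPC ·)
  -- What the outside can now reach was either exposed by the program or is public in the inactive
  -- component.
  have hCl : s₀.Cl (V ∪ pub) ⊆ C ∪ P₂ := by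
    refine LocStore.Cl_subset ?_ fun a d x _ => hrg a d x
    rintro x (hx | hx)
    · exact Or.inl (hVC hx)
    · exact (h.pub x hx).imp_left (hPC ·)
  obtain ⟨⟨f1, sub1, dom1, rng1, sh1, own1, agr1, act1, cov1⟩,
    ⟨f2, sub2, dom2, rng2, sh2, own2, agr2, act2, cov2⟩, dm, rg, pb⟩ := h
  have act1 := act1 ha
  have cov1 := cov1 ha
  have agr2 := agr2 ha'
  clear_value C
  refine ⟨⟨f1.union hJ, ?_, ?_, ?_, ?_, ?_, ?_, ?_, ?_⟩,
    ⟨f2, sub2, dom2, rng2, ?_, ?_, ?_, ?_, ?_⟩, ?_, ?_, ?_⟩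
  · grind
  · grind
  · grind
  · grind
  · grind
  · intro _ a h1 h2
    have h1 : Name.loc a ∈ C := h1.resolve_right (hJl a)
    obtain ⟨d, hd⟩ := hdom a h1
    rw [(o2 a d).2 (Or.inl hd)]
    exact ((hres a d).1 hd).2
  · grind
  · grind
  · grind
  · grind
  -- A location outside the exposed set is not touched by the update of the auxiliary store, so the
  -- old agreement persists.
  · intro _ a h1 h2
    have h3 : l₁.restrict C a = none := by
      rcases hnn a with h4 | ⟨d, h4⟩
      · exact h4
      · exact absurd (Or.inl ((hres a d).1 h4).1) h2
    rw [hs₀, LocStore.override_of_none h3]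
    exact agr2 a h1 fun h4 => h2 (Or.inl (hPC h4))
  · grind
  · exact fun h => absurd h ha'
  · intro a
    constructor
    · rintro ⟨d, hd⟩
      grind
    · rintro ((h1 | h1) | h1)
      · obtain ⟨d, hd⟩ := hdom a h1
        exact ⟨d, (o2 a d).2 (Or.inl hd)⟩
      · exact absurd h1 (hJl a)
      · obtain ⟨d, hd⟩ := (dm a).2 (Or.inr h1)
        rcases hnn a with h4 | ⟨d', h4⟩
        · exact ⟨d, (o2 a d).2 (Or.inr ⟨h4, hd⟩)⟩
        · exact ⟨d', (o2 a d').2 (Or.inl h4)⟩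
  · intro a d x hd hx
    exact (hrg a d x hd hx).imp_left Or.inl
  · rintro x (hx | hx)
    · exact (hCl hx).imp_left Or.inl
    · exact Or.inl (Or.inr hx)

/-- Locations known to the outside remain defined by `ext`, the others keep their values by `keep`.
-/
theorem update_dom {pr A : Set Name} {S s₀ : LocStore} (hu : SysUpdate pub pr A S s₀)
    {a : LocName} {d : Data} (h : S a = some d) : ∃ d', s₀ a = some d' := by
  by_cases hp : Name.loc a ∈ pub
  · have : Name.loc a ∈ (S.restrict pub).dom :=
      ⟨a, d, rfl, (LocStore.restrict_apply _ _ _ _).2 ⟨hp, h⟩⟩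
    exact LocStore.loc_mem_dom.1 (hu.ext this)
  · exact ⟨d, hu.keep a d ((LocStore.without_apply _ _ _ _).2 ⟨hp, h⟩)⟩


/-- A call or a return from the outside preserves the invariant. -/
theorem into (h : LocInv N₁ P₁ l₁ act₁ N₂ P₂ l₂ act₂ pub s) (ha' : ¬ act₂)
    (hVf : V.Finite) (hJ : J.Finite) (hJN : ∀ x ∈ J, x ∈ N₁ ∪ N₂ → x ∈ pub)
    (hJl : ∀ a, Name.loc a ∉ J) {s₀ : LocStore} (hfin : s₀.dom.Finite) (hcl : s₀.Closed)
    (hval : ∀ a, Name.loc a ∈ V → Name.loc a ∈ s₀.dom)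
    {pr A : Set Name} (hpr : pr = (N₁ ∪ N₂) \ pub) (hVA : V ⊆ A)
    (hu : SysUpdate pub pr A s s₀) (b₁ : Prop) :
    LocInv (N₁ ∪ J ∪ (V ∪ s₀.names)) (P₁ ∪ J ∪ (V ∪ s₀.names)) (l₁.override s₀) b₁
      N₂ P₂ l₂ act₂ (pub ∪ (V ∪ (s₀.without pr).names) ∪ J) (s.override s₀) := by
  have hud := fun a d => update_dom hu (a := a) (d := d)
  have hsn := LocStore.names_finite hfin
  have hmn := fun x => LocStore.mem_names (s := s₀) (x := x)
  have hmw := fun x => LocStore.mem_names (s := s₀.without pr) (x := x)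
  have hw := LocStore.without_apply s₀ pr
  have o1 := LocStore.override_apply l₁ s₀
  have o2 := LocStore.override_apply s s₀
  have hcl' : ∀ a, Name.loc a ∈ s₀.names → ∃ d, s₀ a = some d :=
    fun a ha => LocStore.loc_mem_dom.1 (hcl a ha)
  have hval' : ∀ a, Name.loc a ∈ V → ∃ d, s₀ a = some d :=
    fun a ha => LocStore.loc_mem_dom.1 (hval a ha)
  have hpl := fun x => h.pub_left (x := x)
  have hpr' := fun x => h.swap.pub_left (x := x)
  obtain ⟨⟨f1, sub1, dom1, rng1, sh1, own1, agr1, act1, cov1⟩,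
    ⟨f2, sub2, dom2, rng2, sh2, own2, agr2, act2, cov2⟩, dm, rg, pb⟩ := h
  have agr2 := agr2 ha'
  have hpriv : ∀ x, x ∈ A ∪ (s₀.without pr).names → x ∉ pr := fun x h1 h2 =>
    (Set.eq_empty_iff_forall_notMem.1 hu.private' x) ⟨h1, h2⟩
  -- At a private location the update can only repeat the old value: `noGuess` puts the location
  -- into the old store, and `keep` fixes its content.
  have hold : ∀ a d, s₀ a = some d → Name.loc a ∈ pr → s a = some d := by
    intro a d hd hp
    obtain ⟨d', hd'⟩ := LocStore.loc_mem_dom.1 (hu.noGuess ⟨⟨a, d, rfl, hd⟩, hp⟩)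
    have := hu.keep a d' ((LocStore.without_apply _ _ _ _).2 ⟨by rw [hpr] at hp; exact hp.2, hd'⟩)
    rw [hd'] ; rw [← this, hd]
  -- A private name cannot occur in the visible part of the update. If it occurs through a private
  -- cell, the content of that cell is old, so the name had already been communicated between the
  -- components.
  have hsN2 : ∀ x ∈ s₀.names, x ∈ N₂ → x ∈ P₂ := by
    intro x hx hx2
    by_cases hxp : x ∈ pub
    · exact hpr' x hxp hx2
    · have hxpr : x ∈ pr := by rw [hpr]; exact ⟨Or.inr hx2, hxp⟩
      have hP : x ∈ P₁ ∨ x ∈ P₂ := by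
        obtain ⟨a, d, hd, hxd⟩ := (hmn x).1 hx
        by_cases hap : Name.loc a ∈ pr
        · have hd' := hold a d hd hap
          rcases hxd with rfl | hxd
          · exact (dm a).1 ⟨d, hd'⟩
          · exact rg a d x hd' hxd
        · exact absurd hxpr (hpriv x (Or.inr ((hmw x).2 ⟨a, d, (hw a d).2 ⟨hap, hd⟩, hxd⟩)))
      rcases hP with hP | hP
      · exact sh2 x hx2 (sub1 hP)
      · exact hP
  have hVN2 : ∀ x ∈ V, x ∈ N₂ → x ∈ P₂ := by
    intro x hx hx2
    by_cases hxp : x ∈ pub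
    · exact hpr' x hxp hx2
    · exact absurd (by rw [hpr]; exact ⟨Or.inr hx2, hxp⟩) (hpriv x (Or.inl (hVA hx)))
  have hac : ∀ a, Name.loc a ∈ N₁ ∪ J ∪ (V ∪ s₀.names) → ∃ d, l₁.override s₀ a = some d := by
    have key : ∀ a, (∃ d, s₀ a = some d) → ∃ d, l₁.override s₀ a = some d :=
      fun a ⟨d, hd⟩ => ⟨d, (o1 _ _).2 (Or.inl hd)⟩
    rintro a ((h1 | h1) | h1 | h1)
    · rcases Option.eq_none_or_eq_some (s₀ a) with h2 | ⟨d, h2⟩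
      · by_cases h3 : Name.loc a ∈ N₂
        · obtain ⟨d, hd⟩ := (dm a).2 (Or.inl (sh1 _ h1 h3))
          exact key a (hud a d hd)
        · obtain ⟨d, hd⟩ := own1 a h1 h3
          exact ⟨d, (o1 _ _).2 (Or.inr ⟨h2, hd⟩)⟩
      · exact key a ⟨d, h2⟩
    · exact absurd h1 (hJl a)
    · exact key a (hval' a h1)
    · exact key a (hcl' a h1)
  have hPs : ∀ a, (Name.loc a ∈ P₁ ∨ Name.loc a ∈ P₂) → ∃ d, s₀ a = some d :=
    fun a ha => let ⟨d, hd⟩ := (dm a).2 ha; hud a d hd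
  refine ⟨⟨(f1.union hJ).union (hVf.union hsn), ?_, ?_, ?_, ?_, ?_, ?_, ?_, ?_⟩,
    ⟨f2, sub2, dom2, rng2, ?_, ?_, ?_, ?_, ?_⟩, ?_, ?_, ?_⟩
  · grind
  · grind
  · grind
  · grind
  · exact fun a h1 _ => hac a h1
  -- The update is defined at every public location of the receiver, so both sides take their value
  -- from it.
  · intro _ a h1 h2
    have : ∃ d, s₀ a = some d := by
      rcases h1 with (h1 | h1) | h1 | h1
      · exact hPs a (Or.inl h1)
      · exact absurd h1 (hJl a)
      · exact hval' a h1
      · exact hcl' a h1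
    obtain ⟨d, hd⟩ := this
    rw [LocStore.override_of_some hd, LocStore.override_of_some hd]
  · exact fun _ => hac
  · intro _ a ha
    obtain ⟨d, hd⟩ := hPs a (Or.inr ha)
    exact Or.inr (Or.inr ((hmn _).2 ⟨a, d, hd, Or.inl rfl⟩))
  · rintro x hx ((h1 | h1) | h1 | h1)
    · exact sh2 x hx h1
    · exact hpr' x (hJN x h1 (Or.inr hx)) hx
    · exact hVN2 x h1 hx
    · exact hsN2 x h1 hx
  · grind
  -- Vacuous: the update contains every public location of the inactive component and makes it
  -- public in the receiver.
  · intro _ a h1 h2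
    obtain ⟨d, hd⟩ := hPs a (Or.inr h1)
    exact absurd (Or.inr (Or.inr ((hmn _).2 ⟨a, d, hd, Or.inl rfl⟩))) h2
  · exact fun h => absurd h ha'
  · exact fun h => absurd h ha'
  · intro a
    constructor
    · rintro ⟨d, hd⟩
      rcases (o2 a d).1 hd with h1 | h1
      · exact Or.inl (Or.inr (Or.inr ((hmn _).2 ⟨a, d, h1, Or.inl rfl⟩)))
      · exact ((dm a).1 ⟨d, h1.2⟩).imp_left fun h => Or.inl (Or.inl h)
    · have key : ∀ a, (∃ d, s₀ a = some d) → ∃ d, s.override s₀ a = some d :=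
        fun a ⟨d, hd⟩ => ⟨d, (o2 _ _).2 (Or.inl hd)⟩
      rintro (((h1 | h1) | h1 | h1) | h1)
      · exact key a (hPs a (Or.inl h1))
      · exact absurd h1 (hJl a)
      · exact key a (hval' a h1)
      · exact key a (hcl' a h1)
      · exact key a (hPs a (Or.inr h1))
  · intro a d x hd hx
    rcases (o2 a d).1 hd with h1 | h1
    · exact Or.inl (Or.inr (Or.inr ((hmn _).2 ⟨a, d, h1, Or.inr hx⟩)))
    · exact (rg a d x h1.2 hx).imp_left fun h => Or.inl (Or.inl h)
  · rintro x ((h1 | h1 | h1) | h1)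
    · exact (pb x h1).imp_left fun h => Or.inl (Or.inl h)
    · exact Or.inl (Or.inr (Or.inl h1))
    · obtain ⟨a, d, hd, hx⟩ := (hmw x).1 h1
      exact Or.inl (Or.inr (Or.inr ((hmn _).2 ⟨a, d, ((hw a d).1 hd).2, hx⟩)))
    · exact Or.inl (Or.inl (Or.inr h1))

end LocInv

/-! ### The continuation part of the invariant -/

/-- Conditions on the used continuation names `A`, the stored continuations `c` and the current
continuation `cur` of a component, relative to the continuations `c'` of the other component. -/
structure ContHalf (A : Set ContName) (c : ContName → Option (Stack × ContName))
    (cur : Option ContName) (c' : ContName → Option (Stack × ContName)) (pubS : Set ContName) :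
    Prop where
  dom : ∀ k p, c k = some p → k ∈ A
  tgt : ∀ k t k', c k = some (t, k') → k' ∈ A ∧ ((∃ p, c' k' = some p) ∨ k' ∈ pubS)
  cur : ∀ k, cur = some k → k ∈ A ∧ ((∃ p, c' k = some p) ∨ k ∈ pubS)
  src : ∀ k ∈ A, (∃ p, c k = some p) ∨ (∃ p, c' k = some p) ∨ k ∈ pubS
  disj : ∀ k p, c k = some p → c' k = none ∧ k ∉ pubS

/-- Here `Q` stands for the continuation names in `pub`. The rank excludes cycles among stored
continuations. The field `private'` keeps `K` apart from the public names: a public continuation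
known to both components was introduced by the outside. -/
structure ContInv (A₁ : Set ContName) (c₁ : ContName → Option (Stack × ContName))
    (cur₁ : Option ContName) (A₂ : Set ContName) (c₂ : ContName → Option (Stack × ContName))
    (cur₂ : Option ContName) (Q pubS : Set ContName) : Prop where
  left : ContHalf A₁ c₁ cur₁ c₂ pubS
  right : ContHalf A₂ c₂ cur₂ c₁ pubS
  rank : ∃ r : ContName → ℕ, ∀ k t k', c₁ k = some (t, k') ∨ c₂ k = some (t, k') → r k' < r k
  private' : ∀ k ∈ Q, k ∈ A₁ → k ∈ A₂ → k ∈ pubS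
  pubS_sub : ∀ k ∈ pubS, k ∈ Q
  sub : ∀ k ∈ Q, k ∈ A₁ ∨ k ∈ A₂

namespace ContInv

variable {A₁ A₂ Q pubS : Set ContName} {c₁ c₂ : ContName → Option (Stack × ContName)}
  {cur₁ cur₂ : Option ContName} {k k₀ : ContName} {t : Stack}

theorem swap (h : ContInv A₁ c₁ cur₁ A₂ c₂ cur₂ Q pubS) :
    ContInv A₂ c₂ cur₂ A₁ c₁ cur₁ Q pubS :=
  ⟨h.right, h.left, h.rank.imp fun _ hr k t k' hk => hr k t k' hk.symm,
    fun k hk h2 h1 => h.private' k hk h1 h2, h.pubS_sub, fun k hk => (h.sub k hk).symm⟩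

/-- The new name gets a rank one above that of its target. Being unused, it is itself the target of
no stored continuation, so the other ranks can stay. -/
theorem rank_push (h : ContInv A₁ c₁ cur₁ A₂ c₂ cur₂ Q pubS) (hk₀ : k₀ ∈ A₁)
    (hk₁ : k ∉ A₁) (hk₂ : k ∉ A₂) : ∃ r : ContName → ℕ, ∀ j t' k',
      Function.update c₁ k (some (t, k₀)) j = some (t', k') ∨ c₂ j = some (t', k') →
        r k' < r j := by
  obtain ⟨r, hr⟩ := h.rank
  refine ⟨Function.update r k (r k₀ + 1), fun j t' k' hj => ?_⟩
  by_cases hjk : j = k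
  · subst hjk
    rcases hj with hj | hj
    · simp only [Function.update_self, Option.some.injEq, Prod.mk.injEq] at hj
      obtain ⟨rfl, rfl⟩ := hj
      rw [Function.update_self, Function.update_of_ne (by rintro rfl; exact hk₁ hk₀)]
      omega
    · exact absurd (h.right.dom _ _ hj) hk₂
  · rw [Function.update_of_ne hjk] at hj
    have : k' ≠ k := by
      rintro rfl
      rcases hj with hj | hj
      · exact hk₁ (h.left.tgt _ _ _ hj).1
      · exact hk₂ (h.right.tgt _ _ _ hj).1
    rw [Function.update_of_ne hjk, Function.update_of_ne this]
    exact hr _ _ _ hj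

theorem tauCall (h : ContInv A₁ c₁ (some k₀) A₂ c₂ cur₂ Q pubS) (hk₁ : k ∉ A₁) (hk₂ : k ∉ A₂) :
    ContInv (insert k A₁) (Function.update c₁ k (some (t, k₀))) none (insert k A₂) c₂ (some k)
      Q pubS := by
  have hr := h.rank_push (t := t) (h.left.cur k₀ rfl).1 hk₁ hk₂
  obtain ⟨⟨dom1, tgt1, cur1, src1, dj1⟩, ⟨dom2, tgt2, cur2, src2, dj2⟩, -, pv, ps, sb⟩ := h
  have u : ∀ j p, Function.update c₁ k (some (t, k₀)) j = some p ↔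
      (j = k ∧ p = (t, k₀)) ∨ (j ≠ k ∧ c₁ j = some p) := by
    intro j p; by_cases hj : j = k
    · subst hj; simp [eq_comm]
    · simp [hj]
  have un : ∀ j, Function.update c₁ k (some (t, k₀)) j = none ↔ j ≠ k ∧ c₁ j = none := by
    intro j; by_cases hj : j = k
    · subst hj; simp
    · simp [hj]
  -- Names of system polarity are public and therefore used by some component; a fresh name is not
  -- among them.
  have hkp : k ∉ pubS := fun hp => (sb k (ps k hp)).elim hk₁ hk₂
  have c0 := cur1 k₀ rfl
  have nn := fun j => Option.eq_none_or_eq_some (c₂ j)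
  refine ⟨⟨?_, ?_, ?_, ?_, ?_⟩, ⟨?_, ?_, ?_, ?_, ?_⟩, hr, ?_, ps, ?_⟩ <;>
    (try simp only [u, un, Set.mem_insert_iff]) <;> grind

theorem outCall (h : ContInv A₁ c₁ (some k₀) A₂ c₂ none Q pubS) (hk₁ : k ∉ A₁) (hk₂ : k ∉ A₂) :
    ContInv (insert k A₁) (Function.update c₁ k (some (t, k₀))) none A₂ c₂ none
      (insert k Q) (pubS \ {k}) := by
  have hr := h.rank_push (t := t) (h.left.cur k₀ rfl).1 hk₁ hk₂
  obtain ⟨⟨dom1, tgt1, cur1, src1, dj1⟩, ⟨dom2, tgt2, cur2, src2, dj2⟩, -, pv, ps, sb⟩ := h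
  have u : ∀ j p, Function.update c₁ k (some (t, k₀)) j = some p ↔
      (j = k ∧ p = (t, k₀)) ∨ (j ≠ k ∧ c₁ j = some p) := by
    intro j p; by_cases hj : j = k
    · subst hj; simp [eq_comm]
    · simp [hj]
  have un : ∀ j, Function.update c₁ k (some (t, k₀)) j = none ↔ j ≠ k ∧ c₁ j = none := by
    intro j; by_cases hj : j = k
    · subst hj; simp
    · simp [hj]
  have hkp : k ∉ pubS := fun hp => (sb k (ps k hp)).elim hk₁ hk₂
  rw [Set.sdiff_singleton_eq_self hkp]
  have c0 := cur1 k₀ rfl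
  have nn := fun j => Option.eq_none_or_eq_some (c₂ j)
  refine ⟨⟨?_, ?_, ?_, ?_, ?_⟩, ⟨?_, ?_, ?_, ?_, ?_⟩, hr, ?_, ?_, ?_⟩ <;>
    (try simp only [u, un, Set.mem_insert_iff]) <;> grind

/-- This serves returns, which leave the continuation stores alone. A resumed continuation is the
target of a stored one, and targets satisfy what is required of a current continuation. -/
theorem setCur (h : ContInv A₁ c₁ cur₁ A₂ c₂ cur₂ Q pubS) (o₁ o₂ : Option ContName)
    (h₁ : ∀ k, o₁ = some k → ∃ j t, c₁ j = some (t, k))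
    (h₂ : ∀ k, o₂ = some k → ∃ j t, c₂ j = some (t, k)) :
    ContInv A₁ c₁ o₁ A₂ c₂ o₂ Q pubS :=
  { h with
    left := { h.left with cur := fun k hk => let ⟨_, _, hj⟩ := h₁ k hk; h.left.tgt _ _ _ hj }
    right := { h.right with cur := fun k hk => let ⟨_, _, hj⟩ := h₂ k hk; h.right.tgt _ _ _ hj } }

/-- A continuation introduced by the outside is an end point of the search and is stored nowhere, so
the rank needs no change. The name may have been used before, provided that it had system polarity
then. -/
theorem inCall (h : ContInv A₁ c₁ none A₂ c₂ none Q pubS) (hk₁ : c₁ k = none)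
    (hk₂ : k ∈ A₂ → k ∈ pubS) :
    ContInv (insert k A₁) c₁ (some k) A₂ c₂ none (insert k Q) (pubS ∪ {k}) := by
  obtain ⟨⟨dom1, tgt1, cur1, src1, dj1⟩, ⟨dom2, tgt2, cur2, src2, dj2⟩, hr, pv, ps, sb⟩ := h
  refine ⟨⟨?_, ?_, ?_, ?_, ?_⟩, ⟨?_, ?_, ?_, ?_, ?_⟩, hr, ?_, ?_, ?_⟩ <;>
    (try simp only [Set.mem_insert_iff, Set.mem_union, Set.mem_singleton_iff]) <;> grind

end ContInv

/-! ### Following continuations -/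

theorem Fetch.notMem {s₁ s₂ : Store} {K : Set ContName} {p q : Stack × ContName}
    (h : Fetch s₁ s₂ K p q) : q.2 ∉ K := by
  induction h with
  | done h => exact h
  | back _ _ _ ih => exact ih

theorem Fetch.append {s₁ s₂ : Store} {K : Set ContName} {p q : Stack × ContName}
    (h : Fetch s₁ s₂ K p q) (u : Stack) : Fetch s₁ s₂ K (u ++ p.1, p.2) (u ++ q.1, q.2) := by
  induction h with
  | done h => exact .done h
  | back hk hs _ ih => exact .back hk hs (by simpa using ih)

theorem Fetch.swap {s₁ s₂ : Store} {K : Set ContName} {p q : Stack × ContName}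
    (h : Fetch s₁ s₂ K p q) : Fetch s₂ s₁ K p q := by
  induction h with
  | done h => exact .done h
  | back hk hs _ ih => exact .back hk hs.symm ih

theorem Fetch.det {s₁ s₂ : Store} {K : Set ContName} {p q q' : Stack × ContName}
    (hd : ∀ k, s₁.cont k = none ∨ s₂.cont k = none)
    (h : Fetch s₁ s₂ K p q) (h' : Fetch s₁ s₂ K p q') : q' = q := by
  induction h with
  | done h =>
    cases h' with
    | done _ => rfl
    | back hk _ _ => exact absurd hk h
  | @back t k t' k' q hk hs _ ih =>
    cases h' with
    | done h => exact absurd hk h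
    | @back _ _ t'' k'' _ _ hs' h' =>
      have : (t'', k'') = (t', k') := by
        have := hd k
        grind
      obtain ⟨rfl, rfl⟩ := Prod.mk.inj this
      exact ih h'

/-- The search starts in `B` and `B` contains all targets, so only the stores and private names on
`B` matter. -/
theorem Fetch.transfer {s₁ s₂ s₁' s₂' : Store} {K K' : Set ContName} {p q : Stack × ContName}
    (h : Fetch s₁ s₂ K p q) (B : Set ContName) (hp : p.2 ∈ B)
    (hB : ∀ k t k', s₁.cont k = some (t, k') ∨ s₂.cont k = some (t, k') → k' ∈ B)
    (hK : ∀ k ∈ B, k ∈ K ↔ k ∈ K')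
    (hs : ∀ k ∈ B, ∀ x, s₁.cont k = some x ∨ s₂.cont k = some x →
      s₁'.cont k = some x ∨ s₂'.cont k = some x) : Fetch s₁' s₂' K' p q := by
  induction h with
  | @done t k h => exact .done fun h' => h ((hK k hp).2 h')
  | @back t k t' k' q hk hx _ ih =>
    exact .back ((hK k hp).1 hk) (hs k hp _ hx) (ih (hB _ _ _ hx))

theorem Fetch.mem {s₁ s₂ : Store} {K : Set ContName} {p q : Stack × ContName}
    (h : Fetch s₁ s₂ K p q) (B : Set ContName) (hp : p.2 ∈ B)
    (hB : ∀ k t k', s₁.cont k = some (t, k') ∨ s₂.cont k = some (t, k') → k' ∈ B) : q.2 ∈ B := by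
  induction h with
  | done h => exact hp
  | back hk hx _ ih => exact ih (hB _ _ _ hx)

theorem Fetch.names {s₁ s₂ : Store} {K : Set ContName} {p q : Stack × ContName}
    (h : Fetch s₁ s₂ K p q) (X : Set Name) (hp : stackNames p.1 ⊆ X)
    (hX : ∀ k t k', s₁.cont k = some (t, k') ∨ s₂.cont k = some (t, k') → stackNames t ⊆ X) :
    stackNames q.1 ⊆ X := by
  induction h with
  | done h => exact hp
  | back hk hx _ ih => exact ih (by simpa using ⟨hp, hX _ _ _ hx⟩)

theorem fetch_eq {s₁ s₂ : Store} {K : Set ContName} {p q : Stack × ContName}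
    (hd : ∀ k, s₁.cont k = none ∨ s₂.cont k = none) (h : Fetch s₁ s₂ K p q) :
    fetch s₁ s₂ K p = q := by
  have : ∃ q, Fetch s₁ s₂ K p q := ⟨q, h⟩
  rw [fetch, dif_pos this]
  exact h.det hd this.choose_spec

theorem fetch_swap (s₁ s₂ : Store) (K : Set ContName) : fetch s₁ s₂ K = fetch s₂ s₁ K := by
  have : Fetch s₁ s₂ K = Fetch s₂ s₁ K := by
    ext p q
    exact ⟨Fetch.swap, Fetch.swap⟩
  funext p
  unfold fetch
  rw [this]

/-- Strong induction on the rank of the current name: a name in `K` is stored somewhere and leads to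
a name of smaller rank. The collected stack plays no part in termination. -/
theorem exists_fetch {s₁ s₂ : Store} {K : Set ContName}
    (hr : ∃ r : ContName → ℕ, ∀ k t k', s₁.cont k = some (t, k') ∨ s₂.cont k = some (t, k') →
      r k' < r k)
    (hK : ∀ k ∈ K, ∃ p, s₁.cont k = some p ∨ s₂.cont k = some p) (p : Stack × ContName) :
    ∃ q, Fetch s₁ s₂ K p q := by
  obtain ⟨r, hr⟩ := hr
  obtain ⟨t, k⟩ := p
  induction hn : r k using Nat.strong_induction_on generalizing t k with
  | _ n ih =>
    by_cases hk : k ∈ K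
    · obtain ⟨⟨t', k'⟩, hs⟩ := hK k hk
      obtain ⟨q, hq⟩ := ih (r k') (hn ▸ hr _ _ _ hs) (t ++ t') k' rfl
      exact ⟨q, .back hk hs hq⟩
    · exact ⟨_, .done hk⟩

/-! ### The invariant -/

def State.cur : State → Option ContName
  | .sys _ => none
  | .prog p => some p.k

/-- The names of `M`, of stored stacks and of the term under evaluation are in use. -/
structure TermInv (M : Mod) (X : State) : Prop where
  all : M.allNames ⊆ X.N
  stored : ∀ k t k', X.store.cont k = some (t, k') → stackNames t ⊆ X.N
  term : ∀ p, X = .prog p → stackNames p.t ⊆ p.N ∧ p.e.names ⊆ p.N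

/-- A component counts as active when it has a current continuation, that is, when it is a program.
-/
structure Inv (M M' : Mod) (c : Comp) : Prop where
  passive : c.X₁.cur = none ∨ c.X₂.cur = none
  left : TermInv M c.X₁
  right : TermInv M' c.X₂
  loc : LocInv c.X₁.N c.X₁.P c.X₁.store.loc (c.X₁.cur ≠ none)
    c.X₂.N c.X₂.P c.X₂.store.loc (c.X₂.cur ≠ none) c.pub c.s
  cont : ContInv (Name.cont ⁻¹' c.X₁.N) c.X₁.store.cont c.X₁.cur
    (Name.cont ⁻¹' c.X₂.N) c.X₂.store.cont c.X₂.cur (Name.cont ⁻¹' c.pub) c.pubS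

namespace Inv

variable {M M' : Mod} {c : Comp}

theorem swap (h : Inv M M' c) : Inv M' M c.swap :=
  ⟨h.passive.symm, h.right, h.left, h.loc.swap, h.cont.swap⟩

/-- Shared names are public in both components, so used names may replace public ones. This makes
`K` easy to track, since the moves change used names in a simpler way than public ones. -/
theorem mem_K (h : Inv M M' c) {k : ContName} :
    k ∈ c.K ↔ Name.cont k ∈ c.X₁.N ∧ Name.cont k ∈ c.X₂.N ∧ k ∉ c.pubS := by
  constructor
  · rintro ⟨⟨h1, h2⟩, h3⟩
    exact ⟨h.loc.left.sub h1, h.loc.right.sub h2, h3⟩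
  · rintro ⟨h1, h2, h3⟩
    exact ⟨⟨h.loc.left.shared _ h1 h2, h.loc.right.shared _ h2 h1⟩, h3⟩

theorem disj (h : Inv M M' c) (k : ContName) :
    c.X₁.store.cont k = none ∨ c.X₂.store.cont k = none := by
  rcases Option.eq_none_or_eq_some (c.X₁.store.cont k) with h1 | ⟨p, h1⟩
  · exact Or.inl h1
  · exact Or.inr (h.cont.left.disj k p h1).1

theorem fetch_spec (h : Inv M M' c) (p : Stack × ContName) :
    Fetch c.X₁.store c.X₂.store c.K p (c.fetch p) := by
  obtain ⟨q, hq⟩ := exists_fetch (K := c.K) h.cont.rank (fun k hk => by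
    have := h.mem_K.1 hk
    rcases h.cont.left.src k this.1 with ⟨p, hp⟩ | ⟨p, hp⟩ | h3
    · exact ⟨p, Or.inl hp⟩
    · exact ⟨p, Or.inr hp⟩
    · exact absurd h3 this.2.2) p
  rw [Comp.fetch, fetch_eq h.disj hq]
  exact hq

theorem fetch_eq (h : Inv M M' c) {p q : Stack × ContName}
    (hq : Fetch c.X₁.store c.X₂.store c.K p q) : c.fetch p = q :=
  SLS.fetch_eq h.disj hq

theorem fetch_of_notMem (h : Inv M M' c) (t : Stack) {k : ContName} (hk : k ∉ c.K) :
    c.fetch (t, k) = (t, k) := h.fetch_eq (.done hk)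

theorem fetch_of_mem (h : Inv M M' c) (t : Stack) {k : ContName} (hk : k ∈ c.K)
    {p : Stack × ContName} (hs : c.X₁.store.cont k = some p ∨ c.X₂.store.cont k = some p) :
    c.fetch (t, k) = c.fetch (t ++ p.1, p.2) :=
  h.fetch_eq (.back hk hs (h.fetch_spec _))

/-- The frames already on top are carried along unchanged, so the fetched remainder can be treated
as a fixed bottom stack. -/
theorem fetch_append (h : Inv M M' c) (u t : Stack) (k : ContName) :
    c.fetch (u ++ t, k) = (u ++ (c.fetch (t, k)).1, (c.fetch (t, k)).2) :=
  h.fetch_eq ((h.fetch_spec (t, k)).append u)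

theorem tgt (h : Inv M M' c) (k : ContName) (t : Stack) (k' : ContName)
    (hk : c.X₁.store.cont k = some (t, k') ∨ c.X₂.store.cont k = some (t, k')) :
    Name.cont k' ∈ c.X₁.N ∪ c.X₂.N :=
  hk.imp (fun h1 => (h.cont.left.tgt _ _ _ h1).1) fun h2 => (h.cont.right.tgt _ _ _ h2).1

/-- The stored continuations are followed in the same way after a change that does not affect
the names used before. -/
theorem fetch_congr (h : Inv M M' c) {c' : Comp} (h' : Inv M M' c')
    (hK : ∀ k, Name.cont k ∈ c.X₁.N ∪ c.X₂.N → (k ∈ c.K ↔ k ∈ c'.K))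
    (hs : ∀ k, Name.cont k ∈ c.X₁.N ∪ c.X₂.N → ∀ x,
      c.X₁.store.cont k = some x ∨ c.X₂.store.cont k = some x →
      c'.X₁.store.cont k = some x ∨ c'.X₂.store.cont k = some x)
    {t : Stack} {k : ContName} (hk : Name.cont k ∈ c.X₁.N ∪ c.X₂.N) :
    c'.fetch (t, k) = c.fetch (t, k) :=
  h'.fetch_eq ((h.fetch_spec (t, k)).transfer (Name.cont ⁻¹' (c.X₁.N ∪ c.X₂.N)) hk h.tgt
    (fun k hk => hK k hk) fun k hk => hs k hk)

theorem hatCont_eq_some (h : Inv M M' c) {k : ContName} {q : Stack × ContName} :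
    c.hatCont k = some q ↔ k ∉ c.K ∧
      ∃ p, (c.X₁.store.cont k = some p ∨ c.X₂.store.cont k = some p) ∧ q = c.fetch p := by
  have := h.disj k
  simp only [Comp.hatCont]
  split
  · simp_all
  · rename_i hk
    simp only [hk, not_false_eq_true, true_and, Option.map_eq_some_iff, Option.or_eq_some_iff]
    grind

theorem K_swap : c.swap.K = c.K := by
  simp only [Comp.K, Comp.swap, Set.inter_comm]

theorem fetch_swap : c.swap.fetch = c.fetch := by
  funext p
  simp only [Comp.fetch, K_swap]
  rw [SLS.fetch_swap]
  rfl

theorem hatCont_swap (h : Inv M M' c) : c.swap.hatCont = c.hatCont := by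
  funext k
  refine Option.ext fun q => ?_
  rw [h.hatCont_eq_some, h.swap.hatCont_eq_some, K_swap, fetch_swap]
  simp only [Comp.swap, or_comm]

/-- The two location stores that `R` unites agree. -/
theorem compatible (h : Inv M M' c) (a : LocName) {d₁ d₂ : Data}
    (h₁ : (c.X₁.store.loc.override c.shared) a = some d₁)
    (h₂ : (c.X₂.store.loc.override c.shared) a = some d₂) : d₁ = d₂ := by
  rcases Option.eq_none_or_eq_some (c.shared a) with hs | ⟨d, hs⟩
  · rw [LocStore.override_of_none hs] at h₁ h₂
    have n1 := h.loc.left.dom a d₁ h₁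
    have n2 := h.loc.right.dom a d₂ h₂
    have p1 := h.loc.left.shared _ n1 n2
    obtain ⟨d, hd⟩ := (h.loc.dom a).2 (Or.inl p1)
    have : c.shared a = some d :=
      (LocStore.restrict_apply _ _ _ _).2 ⟨⟨p1, h.loc.right.shared _ n2 n1⟩, hd⟩
    rw [hs] at this; cases this
  · rw [LocStore.override_of_some hs] at h₁ h₂
    exact Option.some.inj (h₁.symm.trans h₂)

/-- The only asymmetry of `R` is the order in which the stores of two systems are united, and
`compatible` makes it immaterial. Every symmetric rule is reduced to its left version through this
equation. -/
theorem R_swap (h : Inv M M' c) : c.swap.R = c.R := by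
  have hN : c.swap.hatN = c.hatN := by
    simp only [Comp.hatN, K_swap]; simp only [Comp.swap, Set.union_comm]
  have hc := h.hatCont_swap
  have hf : c.swap.fetch = c.fetch := fetch_swap
  have hsh : c.swap.shared = c.shared := by
    simp only [Comp.shared, Comp.swap, Set.inter_comm]
  have hp := h.passive
  have hcomp := fun a d₁ d₂ => h.compatible a (d₁ := d₁) (d₂ := d₂)
  obtain ⟨X₁, X₂, pub, pubS, s⟩ := c
  generalize hC : (⟨X₁, X₂, pub, pubS, s⟩ : Comp) = c at *
  cases X₁ <;> cases X₂ <;> subst hC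
  · refine congrArg State.sys (Sys.ext hN rfl (Store.ext ?_ hc))
    rw [hsh]
    exact (LocStore.override_comm hcomp).symm
  · simp only [Comp.R, Comp.swap, Comp.transProg] at *
    rw [hN, hc, hf]
  · simp only [Comp.R, Comp.swap, Comp.transProg] at *
    rw [hN, hc, hf]
  · rcases hp with hp | hp <;> cases hp

end Inv

/-! ### Steps of the abstract machine -/

theorem BinOp.eval_names {op : BinOp} {v v' w : Value} (h : op.eval v v' = some w) :
    valNames w = ∅ := by
  unfold BinOp.eval at h
  split at h
  · simp only [Option.map_eq_some_iff] at h
    obtain ⟨r, -, rfl⟩ := h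
    simp [Data.names]
  · cases h
    simp [Data.names]
  · cases h

@[simp] theorem Store.setLoc_loc (s : Store) (a : LocName) (d : Data) :
    (s.setLoc a d).loc = Function.update s.loc a (some d) := rfl

@[simp] theorem Store.setLoc_cont (s : Store) (a : LocName) (d : Data) :
    (s.setLoc a d).cont = s.cont := rfl

/-- Covers assignment, where `N'` is `N`, and allocation, where `N'` has the one additional location
`a`. -/
theorem update_loc {s : LocStore} {N N' : Set Name} {a : LocName} {d : Data}
    (hd : ∀ a d, s a = some d → Name.loc a ∈ N)
    (hl : ∀ a d x, s a = some d → x ∈ d.names → x ∈ N)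
    (ha : ∀ a, Name.loc a ∈ N → ∃ d, s a = some d)
    (hN : N ⊆ N') (haN : Name.loc a ∈ N') (hdN : d.names ⊆ N')
    (hN' : ∀ b, Name.loc b ∈ N' → Name.loc b ∈ N ∨ b = a) :
    (∀ b d', Function.update s a (some d) b = some d' → Name.loc b ∈ N') ∧
    (∀ b d' x, Function.update s a (some d) b = some d' → x ∈ d'.names → x ∈ N') ∧
    (∀ b, Name.loc b ∈ N' → ∃ d', Function.update s a (some d) b = some d') := by
  refine ⟨fun b d' h => ?_, fun b d' x h hx => ?_, fun b h => ?_⟩ <;> by_cases hb : b = a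
  · exact hb ▸ haN
  · rw [Function.update_of_ne hb] at h
    exact hN (hd b d' h)
  · subst hb
    rw [Function.update_self] at h
    cases h
    exact hdN hx
  · rw [Function.update_of_ne hb] at h
    exact hN (hl b d' x h hx)
  · subst hb
    exact ⟨d, Function.update_self _ _ _⟩
  · rw [Function.update_of_ne hb]
    exact ha b ((hN' b h).resolve_right hb)

namespace Mod.Run

variable {M L : Mod} {p p' q : Prog}

theorem unchanged (h : M.Run p p') : p'.P = p.P ∧ p'.k = p.k ∧ p'.s.cont = p.s.cont := by
  cases h <;> simp

theorem used (h : M.Run p p') :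
    p'.N = p.N ∨ ∃ a, Name.loc a ∉ p.N ∧ p'.N = p.N ∪ {Name.loc a} := by
  cases h <;> first | exact Or.inl rfl | exact Or.inr ⟨_, ‹_›, rfl⟩

theorem terms (h : M.Run p p') (hM : M.WellScoped) (hall : M.allNames ⊆ p.N)
    (ht : stackNames p.t ⊆ p.N) (he : p.e.names ⊆ p.N)
    (hl : ∀ a d x, p.s.loc a = some d → x ∈ d.names → x ∈ p.N) :
    stackNames p'.t ⊆ p'.N ∧ p'.e.names ⊆ p'.N := by
  cases h with
  | star h =>
    have := BinOp.eval_names h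
    simp_all [Exp.names]
  | deref h =>
    refine ⟨by simp_all, fun x hx => hl _ _ x h ?_⟩
    simpa [Exp.names] using hx
  | @call N P s t f F v k hf hlen =>
    refine ⟨by simp_all, (F.inst_names v).trans (Set.union_subset ?_ he)⟩
    exact (hM.bodies (f, F) (lookup_mem hf)).trans hall
  | newLocal h =>
    refine ⟨ht.trans Set.subset_union_left, (Exp.substLoc_names _ _ _).trans ?_⟩
    exact Set.union_subset_union_left _ he
  | new h =>
    exact ⟨ht.trans Set.subset_union_left, by simp [Exp.names, Data.names]⟩
  | _ => simp_all [Exp.names, Frame.names, valNames_append, Set.union_subset_iff]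

theorem stores (h : M.Run p p') (ht : stackNames p.t ⊆ p.N) (he : p.e.names ⊆ p.N)
    (hd : ∀ a d, p.s.loc a = some d → Name.loc a ∈ p.N)
    (hl : ∀ a d x, p.s.loc a = some d → x ∈ d.names → x ∈ p.N)
    (ha : ∀ a, Name.loc a ∈ p.N → ∃ d, p.s.loc a = some d) :
    (∀ a d, p'.s.loc a = some d → Name.loc a ∈ p'.N) ∧
    (∀ a d x, p'.s.loc a = some d → x ∈ d.names → x ∈ p'.N) ∧
    (∀ a, Name.loc a ∈ p'.N → ∃ d, p'.s.loc a = some d) := by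
  cases h with
  | @assign N P s t a d k =>
    have h1 : Name.loc a ∈ N := ht (by simp [Frame.names, Data.names])
    have h2 : d.names ⊆ N := by simpa [Exp.names] using he
    exact update_loc hd hl ha (fun _ h => h) h1 h2 fun b h => Or.inl h
  | @new N P s t a k h =>
    exact update_loc hd hl ha Set.subset_union_left (Or.inr rfl) (by simp [Data.names])
      fun _ hb => hb.imp_right Name.loc.inj
  | @newLocal N P s t x e a k h =>
    exact update_loc hd hl ha Set.subset_union_left (Or.inr rfl) (by simp [Data.names])
      fun _ hb => hb.imp_right Name.loc.inj
  | _ => exact ⟨hd, hl, ha⟩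

end Mod.Run

/-! ### Running a program inside a larger configuration -/

/-- The program configuration `p` run within a larger used name space and store, on top of the
stack `u` and with final continuation `k`. -/
noncomputable def Prog.embed (N : Set Name) (C : Set ContName) (pub : Set Name) (l : LocStore)
    (hc : ContName → Option (Stack × ContName)) (u : Stack) (k : ContName) (p : Prog) : Prog :=
  ⟨(p.N ∪ N) \ Name.cont '' C, pub, ⟨l.override p.s.loc, hc⟩, p.t ++ u, p.e, k⟩

theorem LocStore.override_update (l s : LocStore) (a : LocName) (d : Data) :
    l.override (Function.update s a (some d)) = Function.update (l.override s) a (some d) := by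
  funext b
  by_cases h : b = a
  · subst h; simp [override]
  · simp [override, h]

theorem union_loc_diff (N N' : Set Name) (C : Set ContName) (a : LocName) :
    (N ∪ {Name.loc a} ∪ N') \ Name.cont '' C = (N ∪ N') \ Name.cont '' C ∪ {Name.loc a} := by
  ext x
  simp only [Set.mem_sdiff, Set.mem_union, Set.mem_singleton_iff, Set.mem_image]
  grind

section embed

variable {M L : Mod} {N pub : Set Name} {C : Set ContName} {l : LocStore}
  {hc : ContName → Option (Stack × ContName)} {u : Stack} {k : ContName} {p p' q : Prog}

/-- No rule looks below the top frame, and the store of `p` takes precedence over `l`, so reads and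
writes are unaffected. The hypothesis `hN` makes new locations fresh in the larger name space too.
-/
theorem Mod.Run.embed (hL : ∀ f F, M.defn f = some F → L.defn f = some F) (h : M.Run p p')
    (hN : ∀ x ∈ p'.N, x ∈ N → x ∈ p.N) :
    L.Run (p.embed N C pub l hc u k) (p'.embed N C pub l hc u k) := by
  cases h with
  | iteTrue h => exact .iteTrue h
  | iteFalse => exact .iteFalse
  | binLeft => exact .binLeft
  | star h => exact .star h
  | seq => exact .seq
  | @assign N P s t a d k =>
    simp only [Prog.embed, Store.setLoc_loc, LocStore.override_update]
    exact .assign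
  | deref h => exact .deref (LocStore.override_of_some h)
  | ret => exact .ret
  | appLeft => exact .appLeft
  | pairLeft => exact .pairLeft
  | pairRight => exact .pairRight
  | call h h' => exact .call (hL _ _ h) h'
  | iteStart => exact .iteStart
  | binStart => exact .binStart
  | unStart => exact .unStart
  | new h =>
    simp only [Prog.embed, Store.setLoc_loc, LocStore.override_update, union_loc_diff]
    exact .new fun h' => h'.1.elim h fun h2 => h (hN _ (Or.inr rfl) h2)
  | newLocal h =>
    simp only [Prog.embed, Store.setLoc_loc, LocStore.override_update, union_loc_diff]
    exact .newLocal fun h' => h'.1.elim h fun h2 => h (hN _ (Or.inr rfl) h2)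
  | appStart => exact .appStart
  | pairStart => exact .pairStart

/-- The larger machine can do more than `p` in three ways: pop a frame of `u`, call a function that
`M` lacks, or read a location that only `l` defines. The hypotheses `hv`, `hL` and `ha` exclude
these. Freshness for the larger machine means freshness for both components, which gives the last
conclusion. -/
theorem Mod.Run.of_embed (h : L.Run (p.embed N C pub l hc u k) q)
    (hv : ∀ v, p.t = [] → p.e = .val v → u = [])
    (hL : ∀ f t v F, p.t = .appR [.fn f] :: t → p.e = .val v → L.defn f = some F →
      M.defn f = some F)
    (ht : stackNames p.t ⊆ p.N) (he : p.e.names ⊆ p.N)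
    (ha : ∀ a, Name.loc a ∈ p.N → ∃ d, p.s.loc a = some d) :
    ∃ p', M.Run p p' ∧ q = p'.embed N C pub l hc u k ∧ ∀ x ∈ p'.N, x ∈ N → x ∈ p.N := by
  obtain ⟨N₁, P, s, t, e, k₁⟩ := p
  have fresh : ∀ a, Name.loc a ∉ (N₁ ∪ N) \ Name.cont '' C → Name.loc a ∉ N₁ ∧ Name.loc a ∉ N := by
    intro a h
    simp only [Set.mem_sdiff, Set.mem_union, Set.mem_image] at h
    grind
  have new_mem : ∀ a, Name.loc a ∉ N → ∀ x ∈ N₁ ∪ {Name.loc a}, x ∈ N → x ∈ N₁ := by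
    rintro a h x (h1 | rfl) h2
    · exact h1
    · exact absurd h2 h
  simp only [Prog.embed] at h
  rcases t with _ | ⟨φ, t⟩
  · by_cases hval : ∃ v, e = .val v
    · obtain ⟨v, rfl⟩ := hval
      obtain rfl := hv v rfl rfl
      cases h
    · generalize hT : [] ++ u = T at h
      cases h <;> first | exact absurd ⟨_, rfl⟩ hval | skip
      case iteStart => subst hT; exact ⟨_, .iteStart, rfl, fun _ h _ => h⟩
      case binStart => subst hT; exact ⟨_, .binStart, rfl, fun _ h _ => h⟩
      case unStart => subst hT; exact ⟨_, .unStart, rfl, fun _ h _ => h⟩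
      case appStart => subst hT; exact ⟨_, .appStart, rfl, fun _ h _ => h⟩
      case pairStart => subst hT; exact ⟨_, .pairStart, rfl, fun _ h _ => h⟩
      case new a h =>
        subst hT
        refine ⟨_, .new (fresh a h).1, ?_, new_mem a (fresh a h).2⟩
        simp only [Prog.embed, Store.setLoc_loc, LocStore.override_update, union_loc_diff]
        rfl
      case newLocal a h =>
        subst hT
        refine ⟨_, .newLocal (fresh a h).1, ?_, new_mem a (fresh a h).2⟩
        simp only [Prog.embed, Store.setLoc_loc, LocStore.override_update, union_loc_diff]
        rfl
  · simp only [List.cons_append] at h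
    generalize hT : t ++ u = T at h
    cases h
    case iteTrue h => subst hT; exact ⟨_, .iteTrue h, rfl, fun _ h _ => h⟩
    case iteFalse => subst hT; exact ⟨_, .iteFalse, rfl, fun _ h _ => h⟩
    case binLeft => subst hT; exact ⟨_, .binLeft, rfl, fun _ h _ => h⟩
    case star h => subst hT; exact ⟨_, .star h, rfl, fun _ h _ => h⟩
    case seq => subst hT; exact ⟨_, .seq, rfl, fun _ h _ => h⟩
    case assign =>
      subst hT
      refine ⟨_, .assign, ?_, fun _ h _ => h⟩
      simp only [Prog.embed, Store.setLoc_loc, LocStore.override_update]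
      rfl
    case deref a d h =>
      subst hT
      -- The location occurs in the term, so it is used by `p` and has a value in the store of `p`;
      -- `l` is not consulted.
      obtain ⟨d', hd⟩ := ha a (he (by simp [Exp.names, Data.names]))
      have h : l.override s.loc a = some d := h
      rw [LocStore.override_of_some hd] at h
      cases h
      exact ⟨_, .deref hd, rfl, fun _ h _ => h⟩
    case ret => subst hT; exact ⟨_, .ret, rfl, fun _ h _ => h⟩
    case appLeft => subst hT; exact ⟨_, .appLeft, rfl, fun _ h _ => h⟩
    case pairLeft => subst hT; exact ⟨_, .pairLeft, rfl, fun _ h _ => h⟩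
    case pairRight => subst hT; exact ⟨_, .pairRight, rfl, fun _ h _ => h⟩
    case call h h' =>
      subst hT; exact ⟨_, .call (hL _ _ _ _ rfl rfl h) h', rfl, fun _ h _ => h⟩
    case iteStart => subst hT; exact ⟨_, .iteStart, rfl, fun _ h _ => h⟩
    case binStart => subst hT; exact ⟨_, .binStart, rfl, fun _ h _ => h⟩
    case unStart => subst hT; exact ⟨_, .unStart, rfl, fun _ h _ => h⟩
    case appStart => subst hT; exact ⟨_, .appStart, rfl, fun _ h _ => h⟩
    case pairStart => subst hT; exact ⟨_, .pairStart, rfl, fun _ h _ => h⟩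
    case new a h =>
      subst hT
      refine ⟨_, .new (fresh a h).1, ?_, new_mem a (fresh a h).2⟩
      simp only [Prog.embed, Store.setLoc_loc, LocStore.override_update, union_loc_diff]
      rfl
    case newLocal a h =>
      subst hT
      refine ⟨_, .newLocal (fresh a h).1, ?_, new_mem a (fresh a h).2⟩
      simp only [Prog.embed, Store.setLoc_loc, LocStore.override_update, union_loc_diff]
      rfl

end embed

/-! ### Preservation of the invariant -/

@[simp] theorem preimage_cont_valNames (v : Value) : Name.cont ⁻¹' valNames v = ∅ := by
  ext k; simp [cont_notMem_valNames]

@[simp] theorem preimage_cont_names (s : LocStore) : Name.cont ⁻¹' s.names = ∅ := by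
  ext k; simp [LocStore.cont_notMem_names]

@[simp] theorem preimage_cont_singleton (k : ContName) :
    Name.cont ⁻¹' {Name.cont k} = {k} := by
  ext j; simp

@[simp] theorem preimage_cont_insert (k : ContName) (N : Set Name) :
    Name.cont ⁻¹' insert (Name.cont k) N = insert k (Name.cont ⁻¹' N) := by
  ext j; simp

@[simp] theorem preimage_cont_Cl (s : LocStore) (X : Set Name) :
    Name.cont ⁻¹' (s.Cl X) = Name.cont ⁻¹' X := by
  ext k; simp [LocStore.cont_mem_Cl]

theorem Mod.defn_mem {M : Mod} {f : FunName} {F : Func} (h : M.defn f = some F) :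
    Name.fn f ∈ M.declared := Or.inr ⟨(f, F), lookup_mem h, rfl⟩

/-- Agreement with the auxiliary store is demanded of inactive components only, so the active one
may write freely. New locations must merely be unknown to the partner. -/
theorem LocInv.run {N₁ P₁ N₂ P₂ pub N₁' : Set Name} {l₁ l₂ s l₁' : LocStore} {act₁ act₂ : Prop}
    (h : LocInv N₁ P₁ l₁ act₁ N₂ P₂ l₂ act₂ pub s) (ha : act₁) (hfin : N₁'.Finite)
    (hN : N₁ ⊆ N₁') (hnew : ∀ x ∈ N₁', x ∈ N₂ → x ∈ N₁)
    (hd : ∀ a d, l₁' a = some d → Name.loc a ∈ N₁')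
    (hr : ∀ a d x, l₁' a = some d → x ∈ d.names → x ∈ N₁')
    (hl : ∀ a, Name.loc a ∈ N₁' → ∃ d, l₁' a = some d) :
    LocInv N₁' P₁ l₁' act₁ N₂ P₂ l₂ act₂ pub s := by
  obtain ⟨⟨f1, sub1, dom1, rng1, sh1, own1, agr1, act1, cov1⟩,
    ⟨f2, sub2, dom2, rng2, sh2, own2, agr2, act2, cov2⟩, dm, rg, pb⟩ := h
  exact ⟨⟨hfin, sub1.trans hN, hd, hr, fun x h1 h2 => sh1 x (hnew x h1 h2) h2,
    fun a h1 _ => hl a h1, fun h => absurd ha h, fun _ => hl, cov1⟩,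
    ⟨f2, sub2, dom2, rng2, fun x h1 h2 => sh2 x h1 (hnew x h2 h1),
    fun a h1 h2 => own2 a h1 fun h3 => h2 (hN h3), agr2, act2, cov2⟩, dm, rg, pb⟩

namespace Inv

variable {M M' : Mod} {c : Comp}

theorem store_names_left (h : Inv M M' c) : c.X₁.store.names ⊆ c.X₁.N := by
  rintro x (hx | ⟨k, t, k', hk, hx⟩)
  · obtain ⟨a, d, hd, hx⟩ := LocStore.mem_names.1 hx
    rcases hx with rfl | hx
    · exact h.loc.left.dom a d hd
    · exact h.loc.left.rng a d x hd hx
  · rcases hx with rfl | hx | rfl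
    · exact h.cont.left.dom _ _ hk
    · exact h.left.stored _ _ _ hk hx
    · exact (h.cont.left.tgt _ _ _ hk).1

theorem names_left (h : Inv M M' c) : c.X₁.names ⊆ c.X₁.N := by
  have h1 := h.store_names_left
  have h2 := h.loc.left.sub
  have h3 := h.left.term
  have h4 := h.cont.left.cur
  cases hX : c.X₁ with
  | sys σ =>
    rw [hX] at h1 h2
    exact Set.union_subset (Set.union_subset subset_rfl h2) h1
  | prog p =>
    rw [hX] at h1 h2 h4
    have h5 := h3 p hX
    refine Set.union_subset (Set.union_subset (Set.union_subset (Set.union_subset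
      (Set.union_subset subset_rfl h2) h1) h5.1) h5.2) ?_
    rintro x rfl
    exact (h4 p.k rfl).1

/-- Turns the side conditions of the composite rules, stated for all names occurring in a component,
into conditions on its used names. -/
theorem names_left_eq (h : Inv M M' c) : c.X₁.names = c.X₁.N := by
  refine h.names_left.antisymm ?_
  cases c.X₁ with
  | sys σ => exact fun x hx => Or.inl (Or.inl hx)
  | prog p => exact fun x hx => Or.inl (Or.inl (Or.inl (Or.inl (Or.inl hx))))

theorem names_right_eq (h : Inv M M' c) : c.X₂.names = c.X₂.N := h.swap.names_left_eq

theorem int {p p' : Prog} {σ : Sys} {pub : Set Name} {pubS : Set ContName} {s : LocStore}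
    (hM : M.WellScoped) (h : Inv M M' ⟨.prog p, .sys σ, pub, pubS, s⟩) (hr : M.Run p p')
    (hnew : ∀ x ∈ p'.N, x ∈ σ.N → x ∈ p.N) : Inv M M' ⟨.prog p', .sys σ, pub, pubS, s⟩ := by
  have hterm := h.left.term p rfl
  have hst := hr.stores hterm.1 hterm.2 h.loc.left.dom h.loc.left.rng
    (h.loc.left.active (by simp [State.cur]))
  have htm := hr.terms hM h.left.all hterm.1 hterm.2 h.loc.left.rng
  obtain ⟨hP, hk, hc⟩ := hr.unchanged
  have hN : p.N ⊆ p'.N := by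
    rcases hr.used with h1 | ⟨a, -, h1⟩ <;> rw [h1]
    exact Set.subset_union_left
  have hNf : p'.N.Finite := by
    rcases hr.used with h1 | ⟨a, -, h1⟩ <;> rw [h1]
    · exact h.loc.left.fin
    · exact h.loc.left.fin.union (Set.finite_singleton _)
  have hNc : Name.cont ⁻¹' p'.N = Name.cont ⁻¹' p.N := by
    rcases hr.used with h1 | ⟨a, -, h1⟩ <;> rw [h1]
    ext k; simp
  refine ⟨Or.inr rfl, ⟨h.left.all.trans hN, ?_, ?_⟩, h.right, ?_, ?_⟩
  · intro k t k' hk'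
    refine (h.left.stored k t k' ?_).trans hN
    exact (congrFun hc k).symm.trans hk'
  · rintro _ ⟨⟩
    exact htm
  · have := h.loc.run (by simp [State.cur]) hNf hN hnew hst.1 hst.2.1 hst.2.2
    simp only [State.N, State.P, State.store, State.cur] at this ⊢
    rw [hP]
    simpa using this
  · have := h.cont
    simp only [State.N, State.store, State.cur] at this ⊢
    rw [hNc, hk, hc]
    exact this

/-! ### The calls and returns, with the left component active -/

section

variable {N P N₂ P₂ pub : Set Name} {S S₂ : Store} {t t' : Stack} {f : FunName} {v : Value}
  {k k₀ : ContName} {pubS : Set ContName} {s l : LocStore}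

theorem label_finite {e : Exp}
    (h : Inv M M' ⟨.prog ⟨N, P, S, t, e, k₀⟩, .sys ⟨N₂, P₂, S₂⟩, pub, pubS, s⟩) (X : Set Name) :
    (S.loc.restrict X).dom.Finite := by
  refine h.loc.left.fin.subset ?_
  rintro _ ⟨a, d, rfl, hd⟩
  exact h.loc.left.dom a d ((LocStore.restrict_apply _ _ _ _).1 hd).2

theorem update_stored {t₀ : Stack} {c : ContName → Option (Stack × ContName)}
    (hc : ∀ k t k', c k = some (t, k') → stackNames t ⊆ N) (ht : stackNames t₀ ⊆ N) :
    ∀ j t k', Function.update c k (some (t₀, k₀)) j = some (t, k') → stackNames t ⊆ N := by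
  intro j t k' h
  by_cases hj : j = k
  · subst hj
    rw [Function.update_self] at h
    cases h
    exact ht
  · rw [Function.update_of_ne hj] at h
    exact hc _ _ _ h

theorem tauCall
    (h : Inv M M' ⟨.prog ⟨N, P, S, .appR [.fn f] :: t, .val v, k₀⟩, .sys ⟨N₂, P₂, S₂⟩,
      pub, pubS, s⟩)
    (hf : Name.fn f ∈ N₂) (hk : Name.cont k ∉ N) (hk₂ : Name.cont k ∉ N₂)
    (hl : l = S.loc.restrict (S.loc.Cl (P ∪ valNames v))) :
    Inv M M' ⟨.sys ⟨N ∪ {Name.cont k}, S.loc.Cl (P ∪ valNames v) ∪ {Name.cont k},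
        S.setCont k t k₀⟩,
      .prog ⟨N₂ ∪ {Name.cont k} ∪ (valNames v ∪ l.names), P₂ ∪ {Name.cont k} ∪ (valNames v ∪ l.names),
        S₂.overrideLoc l, [.appR [.fn f]], .val v, k⟩, pub, pubS, s.override l⟩ := by
  have hterm := h.left.term _ rfl
  have hsub : N ⊆ N ∪ {Name.cont k} := Set.subset_union_left
  have hsub₂ : N₂ ⊆ N₂ ∪ {Name.cont k} ∪ (valNames v ∪ l.names) :=
    fun x hx => Or.inl (Or.inl hx)
  refine ⟨Or.inl rfl, ⟨h.left.all.trans hsub, ?_, by rintro _ ⟨⟩⟩,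
    ⟨h.right.all.trans hsub₂, fun k t k' hk => (h.right.stored k t k' hk).trans hsub₂, ?_⟩, ?_, ?_⟩
  · refine update_stored (fun k t k' hk => (h.left.stored k t k' hk).trans hsub) ?_
    exact fun x hx => hsub (hterm.1 (by rw [stackNames_cons]; exact Or.inr hx))
  · rintro _ ⟨⟩
    refine ⟨?_, fun x hx => Or.inr (Or.inl hx)⟩
    simpa [Frame.names, Data.names] using Or.inl hf
  · exact h.loc.tau (by simp [State.cur]) (by simp [State.cur]) hterm.2 (Set.finite_singleton _)
      (by simp) hl (hl ▸ h.label_finite _) (valNames_finite v) _ _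
  · have := h.cont.tauCall (t := t) hk hk₂
    simpa [State.N, State.cur, State.store, Store.setCont, Store.overrideLoc] using this

theorem tauRet (h : Inv M M' ⟨.prog ⟨N, P, S, [], .val v, k⟩, .sys ⟨N₂, P₂, S₂⟩, pub, pubS, s⟩)
    (hk : S₂.cont k = some (t, k₀)) (hl : l = S.loc.restrict (S.loc.Cl (P ∪ valNames v))) :
    Inv M M' ⟨.sys ⟨N, S.loc.Cl (P ∪ valNames v), S⟩,
      .prog ⟨N₂ ∪ (valNames v ∪ l.names), P₂ ∪ (valNames v ∪ l.names),
        S₂.overrideLoc l, t, .val v, k₀⟩, pub, pubS, s.override l⟩ := by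
  have hterm := h.left.term _ rfl
  have hsub₂ : N₂ ⊆ N₂ ∪ (valNames v ∪ l.names) := fun x hx => Or.inl hx
  refine ⟨Or.inl rfl, ⟨h.left.all, h.left.stored, by rintro _ ⟨⟩⟩,
    ⟨h.right.all.trans hsub₂, fun k t k' hk => (h.right.stored k t k' hk).trans hsub₂, ?_⟩, ?_, ?_⟩
  · rintro _ ⟨⟩
    exact ⟨(h.right.stored _ _ _ hk).trans hsub₂, fun x hx => Or.inr (Or.inl hx)⟩
  · have := h.loc.tau (J := ∅) (by simp [State.cur]) (by simp [State.cur]) hterm.2 (by simp)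
      (by simp) hl (hl ▸ h.label_finite _) (valNames_finite v) ((none : Option ContName) ≠ none)
      (some k₀ ≠ none)
    simp only [Set.union_empty] at this
    exact this
  · have := h.cont.setCur none (some k₀) (by simp) fun j hj => by
      cases hj; exact ⟨_, _, hk⟩
    simpa [State.N, State.cur, State.store, Store.overrideLoc] using this

theorem outCall
    (h : Inv M M' ⟨.prog ⟨N, P, S, .appR [.fn f] :: t, .val v, k₀⟩, .sys ⟨N₂, P₂, S₂⟩,
      pub, pubS, s⟩)
    (hk : Name.cont k ∉ N) (hk₂ : Name.cont k ∉ N₂)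
    (hl : l = s.override (S.loc.restrict (S.loc.Cl (P ∪ valNames v)))) :
    Inv M M' ⟨.sys ⟨N ∪ {Name.cont k}, S.loc.Cl (P ∪ valNames v) ∪ {Name.cont k},
        S.setCont k t k₀⟩, .sys ⟨N₂, P₂, S₂⟩,
      l.Cl (valNames v ∪ pub) ∪ {Name.cont k}, pubS \ {k}, l⟩ := by
  have hterm := h.left.term _ rfl
  have hsub : N ⊆ N ∪ {Name.cont k} := Set.subset_union_left
  refine ⟨Or.inl rfl, ⟨h.left.all.trans hsub, ?_, by rintro _ ⟨⟩⟩, h.right, ?_, ?_⟩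
  · refine update_stored (fun k t k' hk => (h.left.stored k t k' hk).trans hsub) ?_
    exact fun x hx => hsub (hterm.1 (by rw [stackNames_cons]; exact Or.inr hx))
  · exact h.loc.out (by simp [State.cur]) (by simp [State.cur]) hterm.2 (Set.finite_singleton _)
      (by rintro _ rfl; exact ⟨hk, hk₂⟩) (by simp) hl _
  · have := h.cont.outCall (t := t) hk hk₂
    simpa [State.N, State.cur, State.store, Store.setCont] using this

theorem outRet (h : Inv M M' ⟨.prog ⟨N, P, S, [], .val v, k⟩, .sys ⟨N₂, P₂, S₂⟩, pub, pubS, s⟩)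
    (hl : l = s.override (S.loc.restrict (S.loc.Cl (P ∪ valNames v)))) :
    Inv M M' ⟨.sys ⟨N, S.loc.Cl (P ∪ valNames v), S⟩, .sys ⟨N₂, P₂, S₂⟩,
      l.Cl (valNames v ∪ pub), pubS, l⟩ := by
  have hterm := h.left.term _ rfl
  refine ⟨Or.inl rfl, ⟨h.left.all, h.left.stored, by rintro _ ⟨⟩⟩, h.right, ?_, ?_⟩
  · have := h.loc.out (J := ∅) (by simp [State.cur]) (by simp [State.cur]) hterm.2 (by simp)
      (by simp) (by simp) hl ((none : Option ContName) ≠ none)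
    simp only [Set.union_empty] at this
    exact this
  · have := h.cont.setCur none none (by simp) (by simp)
    simpa [State.N, State.cur, State.store] using this

theorem inCall {pr : Set Name}
    (h : Inv M M' ⟨.sys ⟨N, P, S⟩, .sys ⟨N₂, P₂, S₂⟩, pub, pubS, s⟩)
    (hf : Name.fn f ∈ N) (hk : S.cont k = none) (hk₂ : Name.cont k ∈ N₂ → k ∈ pubS)
    (hh : Handover P S v l) (hpr : pr = (N ∪ N₂) \ pub)
    (hu : SysUpdate pub pr ({Name.fn f} ∪ valNames v) s l) :
    Inv M M' ⟨.prog ⟨N ∪ {Name.cont k} ∪ (valNames v ∪ l.names),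
        P ∪ {Name.cont k} ∪ (valNames v ∪ l.names), S.overrideLoc l, [.appR [.fn f]], .val v, k⟩,
      .sys ⟨N₂, P₂, S₂⟩,
      pub ∪ (valNames v ∪ (l.without pr).names) ∪ {Name.cont k}, pubS ∪ {k}, s.override l⟩ := by
  have hsub : N ⊆ N ∪ {Name.cont k} ∪ (valNames v ∪ l.names) := fun x hx => Or.inl (Or.inl hx)
  refine ⟨Or.inr rfl, ⟨h.left.all.trans hsub,
    fun k t k' hk => (h.left.stored k t k' hk).trans hsub, ?_⟩, h.right, ?_, ?_⟩
  · rintro _ ⟨⟩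
    refine ⟨?_, fun x hx => Or.inr (Or.inl hx)⟩
    simpa [Frame.names, Data.names] using Or.inl hf
  · refine h.loc.into (by simp [State.cur]) (valNames_finite v) (Set.finite_singleton _) ?_
      (by simp) hh.finite hh.closed hh.value hpr Set.subset_union_right hu _
    -- The continuation of the call may already be in use. Since the caller's side does not store
    -- it, it must then have system polarity, and such names are public.
    rintro _ rfl hx
    refine h.cont.pubS_sub k ?_
    rcases hx with hx | hx
    · rcases h.cont.left.src k hx with ⟨p, hp⟩ | ⟨p, hp⟩ | h1
      · exact absurd hp (by simp [State.store, hk])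
      · exact hk₂ (h.cont.right.dom k p hp)
      · exact h1
    · exact hk₂ hx
  · have := h.cont.inCall hk hk₂
    simpa [State.N, State.cur, State.store, Store.overrideLoc] using this

theorem inRet {pr : Set Name}
    (h : Inv M M' ⟨.sys ⟨N, P, S⟩, .sys ⟨N₂, P₂, S₂⟩, pub, pubS, s⟩)
    (hk : S.cont k = some (t, k₀)) (hh : Handover P S v l) (hpr : pr = (N ∪ N₂) \ pub)
    (hu : SysUpdate pub pr (valNames v) s l) :
    Inv M M' ⟨.prog ⟨N ∪ (valNames v ∪ l.names), P ∪ (valNames v ∪ l.names),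
        S.overrideLoc l, t, .val v, k₀⟩, .sys ⟨N₂, P₂, S₂⟩,
      pub ∪ (valNames v ∪ (l.without pr).names), pubS, s.override l⟩ := by
  have hsub : N ⊆ N ∪ (valNames v ∪ l.names) := fun x hx => Or.inl hx
  refine ⟨Or.inr rfl, ⟨h.left.all.trans hsub,
    fun k t k' hk => (h.left.stored k t k' hk).trans hsub, ?_⟩, h.right, ?_, ?_⟩
  · rintro _ ⟨⟩
    exact ⟨(h.left.stored _ _ _ hk).trans hsub, fun x hx => Or.inr (Or.inl hx)⟩
  · have := h.loc.into (J := ∅) (by simp [State.cur]) (valNames_finite v) (by simp)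
      (by simp) (by simp) hh.finite hh.closed hh.value hpr subset_rfl hu (some k₀ ≠ none)
    simp only [Set.union_empty] at this
    exact this
  · have := h.cont.setCur (some k₀) none (fun j hj => by cases hj; exact ⟨_, _, hk⟩) (by simp)
    simpa [State.N, State.cur, State.store, Store.overrideLoc] using this

end

theorem of_intL {c' : Comp} (hM : M.WellScoped) (h : Inv M M' c) (hs : IntL M M' c c') :
    Inv M M' c' := by
  cases hs with
  | @int p p' σ pub pubS s hr hn =>
    refine h.int hM hr fun x h1 h2 => ?_
    have e1 : p.names = p.N := h.names_left_eq
    have e2 : σ.names = σ.N := h.names_right_eq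
    rw [e1, e2] at hn
    exact hn ⟨Or.inl (Or.inl (Or.inl (Or.inl (Or.inl h1)))), h2⟩

theorem of_tauL {c' : Comp} (h : Inv M M' c) (hs : TauL M M' c c') : Inv M M' c' := by
  cases hs with
  | call ho hi hk =>
    have e2 := h.names_right_eq
    cases ho with
    | call hd hk' hP =>
      cases hi with
      | call hd' hc hn hh =>
        subst hP
        exact h.tauCall (h.right.all (Or.inr (Mod.defn_mem hd'))) hk'
          (fun hx => hk (e2.ge hx)) rfl
  | ret ho hi =>
    cases ho with
    | ret hP =>
      cases hi with
      | ret hc hn hh =>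
        subst hP
        exact h.tauRet hc rfl

theorem of_extL {c' : Comp} {α : Label} {s' : LocStore} (h : Inv M M' c)
    (hs : ExtL M M' c α s' c') : Inv M M' c' := by
  have e1 := h.names_left_eq
  have e2 := h.names_right_eq
  cases hs with
  | progCall ho hi hs hp hk =>
    cases ho with
    | call hd hk' hP =>
      subst hP hp
      exact h.outCall hk' (fun hx => hk (e2.ge hx)) hs
  | progRet ho hi hs hp =>
    cases ho with
    | ret hP =>
      subst hP hp
      exact h.outRet hs
  | @sysCall σ σ' _ _ _ _ _ _ _ _ pr _ hi hpr hu hp hk =>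
    cases hi with
    | call hd hc hn hh =>
      subst hp
      have e1 : Sys.names _ = _ := e1
      have e2 : Sys.names _ = _ := e2
      rw [e1, e2] at hpr
      exact h.inCall (h.left.all (Or.inr (Mod.defn_mem hd))) hc (fun hx => hk (e2.ge hx)) hh hpr hu
  | sysRet hi hpr hu hp hk =>
    cases hi with
    | ret hc hn hh =>
      subst hp
      have e1 : Sys.names _ = _ := e1
      have e2 : Sys.names _ = _ := e2
      rw [e1, e2] at hpr
      exact h.inRet hc hh hpr hu

end Inv

/-! ### The initial state and reachability -/

theorem Mod.allNames_finite (M : Mod) : M.allNames.Finite := by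
  refine Set.Finite.union ?_ ?_
  · refine ((List.finite_toSet M.exports).union (List.finite_toSet M.imports)).subset ?_
    exact fun x hx => hx
  · refine (((List.finite_toSet M.vars).image fun p => Name.loc p.1).union
      ((List.finite_toSet M.funs).image fun p => Name.fn p.1)).subset ?_
    rintro x (⟨p, hp, rfl⟩ | ⟨p, hp, rfl⟩)
    · exact Or.inl ⟨p, hp, rfl⟩
    · exact Or.inr ⟨p, hp, rfl⟩

theorem Mod.initLoc_names {M : Mod} {a : LocName} {d : Data} (h : M.initLoc a = some d) :
    Name.loc a ∈ M.declared ∧ d.names = ∅ := by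
  simp only [initLoc, Option.map_eq_some_iff] at h
  obtain ⟨n, hn, rfl⟩ := h
  exact ⟨Or.inl ⟨(a, n), lookup_mem hn, rfl⟩, rfl⟩

theorem Mod.initLoc_isSome {M : Mod} {a : LocName} (h : Name.loc a ∈ M.declared) :
    ∃ d, M.initLoc a = some d := by
  rcases h with ⟨p, hp, h⟩ | ⟨p, -, h⟩
  · cases h
    obtain ⟨n, hn⟩ := lookup_isSome_of_mem hp
    exact ⟨.int n, by simp [initLoc, hn]⟩
  · cases h

theorem Mod.Composable.swap {M M' : Mod} (h : M.Composable M') : M'.Composable M :=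
  ⟨h.right, h.left, h.declared.symm, h.privateRight, h.privateLeft,
    fun a ha => (h.publicVars a ha.symm).symm⟩

theorem Mod.Composable.shared {M M' : Mod} (h : M.Composable M') {x : Name}
    (h₁ : x ∈ M.allNames) (h₂ : x ∈ M'.allNames) : x ∈ M.publicNames := by
  rcases h₁ with h₁ | h₁
  · exact h₁
  · by_contra h3
    exact Set.disjoint_left.1 h.privateLeft ⟨h₁, h3⟩ h₂

theorem Mod.Composable.own {M M' : Mod} (h : M.Composable M') {a : LocName}
    (h₁ : Name.loc a ∈ M.allNames) (h₂ : Name.loc a ∉ M'.allNames) : Name.loc a ∈ M.declared := by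
  rcases h₁ with h₁ | h₁
  · exact (h.publicVars a (Or.inl h₁)).resolve_right fun h3 => h₂ (Or.inr h3)
  · exact h₁

theorem Inv.init {M M' : Mod} (hM : M.Composable M') : Inv M M' (initComp M M') := by
  have half : ∀ {M M' : Mod} (s : LocStore), M.Composable M' →
      (∀ a, Name.loc a ∈ M.publicNames → Name.loc a ∉ M'.publicNames → M.initLoc a = s a) →
      LocHalf M.allNames M.publicNames M.initLoc (State.cur (.sys M.init) ≠ none)
        M'.allNames M'.publicNames s := by
    intro M M' s h hs
    exact ⟨M.allNames_finite, Set.subset_union_left,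
      fun a d hd => Or.inr (Mod.initLoc_names hd).1,
      fun a d x hd hx => by rw [(Mod.initLoc_names hd).2] at hx; exact hx.elim,
      fun x h1 h2 => h.shared h1 h2, fun a h1 h2 => Mod.initLoc_isSome (h.own h1 h2),
      fun _ a h1 h2 => hs a h1 h2, fun h => absurd rfl h, fun h => absurd rfl h⟩
  have res := fun M : Mod => LocStore.restrict_apply M.initLoc M.publicNames
  have key : ∀ {M M' : Mod}, M.Composable M' → ∀ a, Name.loc a ∈ M.publicNames →
      Name.loc a ∉ M'.allNames → ∃ d, M.initLoc.restrict M.publicNames a = some d := by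
    intro M M' h a h1 h2
    obtain ⟨d, hd⟩ := Mod.initLoc_isSome (h.own (Or.inl h1) h2)
    exact ⟨d, (res M a d).2 ⟨h1, hd⟩⟩
  have noCont : ∀ {M : Mod}, M.WellScoped → Name.cont ⁻¹' M.allNames = ∅ := by
    intro M h
    ext k
    simp only [Set.mem_preimage, Set.mem_empty_iff_false, iff_false]
    rintro (h1 | ⟨p, -, h1⟩ | ⟨p, -, h1⟩)
    · exact h.noCont k h1
    · cases h1
    · cases h1
  have noConts : Name.cont ⁻¹' (M.publicNames ∪ M'.publicNames) = ∅ := by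
    ext k
    simp only [Set.mem_preimage, Set.mem_empty_iff_false, iff_false]
    rintro (h1 | h1)
    · exact hM.left.noCont k h1
    · exact hM.right.noCont k h1
  have ov := LocStore.override_apply (M.initLoc.restrict M.publicNames)
    (M'.initLoc.restrict M'.publicNames)
  have none_of : ∀ {M : Mod} {a}, Name.loc a ∉ M.publicNames →
      M.initLoc.restrict M.publicNames a = none := by
    intro M a h
    rw [Option.eq_none_iff_forall_ne_some]
    exact fun d hd => h ((res M a d).1 hd).1
  have res_eq : ∀ {M : Mod} {a}, Name.loc a ∈ M.publicNames →
      M.initLoc.restrict M.publicNames a = M.initLoc a :=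
    fun {M a} h => Option.ext fun d => by rw [res]; simp [h]
  refine ⟨Or.inl rfl, ⟨subset_rfl, by rintro _ _ _ ⟨⟩, by rintro _ ⟨⟩⟩,
    ⟨subset_rfl, by rintro _ _ _ ⟨⟩, by rintro _ ⟨⟩⟩, ⟨half _ hM ?_, half _ hM.swap ?_, ?_, ?_, ?_⟩, ?_⟩
  · intro a h1 h2
    simp only [initComp]
    rw [LocStore.override_of_none (none_of h2), res_eq h1]
  · intro a h1 h2
    -- The right module cannot leave this variable to the left one, which does not know it; so it
    -- declares the variable, and the override takes its value.
    have : Name.loc a ∉ M.allNames := fun h3 => h2 (hM.shared h3 (Or.inl h1))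
    obtain ⟨d, hd⟩ := key hM.swap a h1 this
    simp only [initComp]
    rw [LocStore.override_of_some hd, ← res_eq h1, hd]
  · intro a
    constructor
    · rintro ⟨d, hd⟩
      rcases (ov a d).1 hd with h1 | h1
      · exact Or.inr ((res M' a d).1 h1).1
      · exact Or.inl ((res M a d).1 h1.2).1
    · intro ha
      have : ∃ d, M.initLoc.restrict M.publicNames a = some d ∨
          M'.initLoc.restrict M'.publicNames a = some d := by
        have both : ∀ {M M' : Mod}, M.Composable M' →
            Name.loc a ∈ M.publicNames ∪ M'.publicNames → Name.loc a ∈ M.declared →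
            ∃ d, M.initLoc.restrict M.publicNames a = some d := by
          intro M M' h h1 h2
          obtain ⟨d, hd⟩ := Mod.initLoc_isSome h2
          refine ⟨d, (res M a d).2 ⟨?_, hd⟩⟩
          exact h1.elim id fun h3 => h.shared (Or.inr h2) (Or.inl h3)
        rcases hM.publicVars a ha with h1 | h1
        · exact (both hM ha h1).imp fun _ => Or.inl
        · exact (both hM.swap ha.symm h1).imp fun _ => Or.inr
      obtain ⟨d, hd⟩ := this
      rcases Option.eq_none_or_eq_some (M'.initLoc.restrict M'.publicNames a) with h1 | ⟨d', h1⟩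
      · exact ⟨d, (ov a d).2 (Or.inr ⟨h1, hd.resolve_right (by simp [h1])⟩)⟩
      · exact ⟨d', (ov a d').2 (Or.inl h1)⟩
  · intro a d x hd hx
    exfalso
    have : d.names = ∅ := by
      rcases (ov a d).1 hd with h1 | h1
      · exact (Mod.initLoc_names ((res M' a d).1 h1).2).2
      · exact (Mod.initLoc_names ((res M a d).1 h1.2).2).2
    rw [this] at hx
    exact hx
  · exact fun x hx => hx
  · have e₁ : Name.cont ⁻¹' (initComp M M').X₁.N = ∅ := noCont hM.left
    have e₂ : Name.cont ⁻¹' (initComp M M').X₂.N = ∅ := noCont hM.right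
    have e₃ : Name.cont ⁻¹' (initComp M M').pub = ∅ := noConts
    rw [e₁, e₂, e₃]
    refine ⟨⟨?_, ?_, ?_, ?_, ?_⟩, ⟨?_, ?_, ?_, ?_, ?_⟩, ⟨fun _ => 0, ?_⟩, ?_, ?_, ?_⟩ <;>
      simp [initComp, Mod.init, State.store, State.cur]

theorem Reachable.inv {M M' : Mod} (hM : M.Composable M') {c : Comp} (h : Reachable M M' c) :
    Inv M M' c := by
  induction h with
  | init => exact Inv.init hM
  | int _ hs ih =>
    exact hs.elim (ih.of_intL hM.left) fun h => (ih.swap.of_intL hM.right h).swap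
  | tau _ hs ih => exact hs.elim ih.of_tauL fun h => (ih.swap.of_tauL h).swap
  | ext _ hs ih => exact hs.elim ih.of_extL fun h => (ih.swap.of_extL h).swap

/-! ### Location stores of the translated states -/

namespace LocInv

variable {N₁ P₁ N₂ P₂ pub V J : Set Name} {l₁ l₂ s : LocStore} {act₁ act₂ : Prop}

/-- The location store of the translation of two system configurations. -/
noncomputable def merged (P₁ P₂ : Set Name) (l₁ l₂ s : LocStore) : LocStore :=
  (l₁.override (s.restrict (P₁ ∩ P₂))).override (l₂.override (s.restrict (P₁ ∩ P₂)))

theorem merged_shared (h : LocInv N₁ P₁ l₁ act₁ N₂ P₂ l₂ act₂ pub s) {a : LocName}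
    (h₁ : Name.loc a ∈ P₁) (h₂ : Name.loc a ∈ P₂) : merged P₁ P₂ l₁ l₂ s a = s a := by
  obtain ⟨d, hd⟩ := (h.dom a).2 (Or.inl h₁)
  have : s.restrict (P₁ ∩ P₂) a = some d := (LocStore.restrict_apply _ _ _ _).2 ⟨⟨h₁, h₂⟩, hd⟩
  rw [merged, LocStore.override_of_some (d := d) (LocStore.override_of_some this), hd]

theorem merged_of_not_shared (l₁ l₂ s : LocStore) {a : LocName}
    (h' : ¬ (Name.loc a ∈ P₁ ∧ Name.loc a ∈ P₂)) :
    merged P₁ P₂ l₁ l₂ s a = l₁.override l₂ a := by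
  have : s.restrict (P₁ ∩ P₂) a = none :=
    Option.eq_none_iff_forall_ne_some.2 fun d hd =>
      h' ((LocStore.restrict_apply _ _ _ _).1 hd).1
  simp only [merged, LocStore.override, this, Option.none_or]

/-- A location in both domains is used by both components, hence public in both. Elsewhere at most
one store is defined and the order is irrelevant. -/
theorem override_comm_apply (h : LocInv N₁ P₁ l₁ act₁ N₂ P₂ l₂ act₂ pub s) {a : LocName}
    (h' : ¬ (Name.loc a ∈ P₁ ∧ Name.loc a ∈ P₂)) : l₁.override l₂ a = l₂.override l₁ a := by
  rcases Option.eq_none_or_eq_some (l₁ a) with h₁ | ⟨d₁, h₁⟩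
  · simp [LocStore.override, h₁]
  · rcases Option.eq_none_or_eq_some (l₂ a) with h₂ | ⟨d₂, h₂⟩
    · simp [LocStore.override, h₂]
    · have n₁ := h.left.dom a _ h₁
      have n₂ := h.right.dom a _ h₂
      exact absurd ⟨h.left.shared _ n₁ n₂, h.right.shared _ n₂ n₁⟩ h'

/-- On the shared public locations the auxiliary store decides, and by hypothesis it carries the
values of the combined store; off them the two stores do not overlap. -/
theorem merged_out (h : LocInv N₁ P₁ l₁ act₁ N₂ P₂ l₂ act₂ pub s)
    (hl : ∀ a, Name.loc a ∈ P₁ → s a = l₂.override l₁ a) :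
    merged P₁ P₂ l₁ l₂ s = l₂.override l₁ := by
  funext a
  by_cases h' : Name.loc a ∈ P₁ ∧ Name.loc a ∈ P₂
  · rw [h.merged_shared h'.1 h'.2, hl a h'.1]
  · rw [merged_of_not_shared _ _ _ h', h.override_comm_apply h']

theorem observed (h : LocInv N₁ P₁ l₁ act₁ N₂ P₂ l₂ act₂ pub s) (ha : act₁) (hV : V ⊆ N₁)
    {a : LocName} (haC : Name.loc a ∈ l₁.Cl (P₁ ∪ V)) :
    s.override (l₁.restrict (l₁.Cl (P₁ ∪ V))) a = l₂.override l₁ a := by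
  obtain ⟨d, hd⟩ := h.label_dom ha hV haC
  rw [LocStore.override_of_some hd,
    LocStore.override_of_some ((LocStore.restrict_apply _ _ _ _).1 hd).2]

theorem pub_sub_exposed (h : LocInv N₁ P₁ l₁ act₁ N₂ P₂ l₂ act₂ pub s) {x : Name}
    (hx : x ∈ pub) : x ∈ l₁.Cl (P₁ ∪ V) ∪ P₂ :=
  (h.pub x hx).imp_left fun h => LocStore.subset_Cl _ _ (Or.inl h)

/-- The composite computes reachability in the auxiliary store, the concatenation in the combined
store. Both start inside the exposed names and the public names of the partner. On the locations
among these the two stores agree, because every public location of the partner is public in the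
active component as well. -/
theorem observed_Cl (h : LocInv N₁ P₁ l₁ act₁ N₂ P₂ l₂ act₂ pub s) (ha : act₁) (hV : V ⊆ N₁)
    {s₀ : LocStore} (hs₀ : s₀ = s.override (l₁.restrict (l₁.Cl (P₁ ∪ V)))) :
    s₀.Cl (V ∪ pub) = (l₂.override l₁).Cl (pub ∪ V) := by
  subst hs₀
  rw [Set.union_comm pub V]
  have hloc : ∀ a, Name.loc a ∈ l₁.Cl (P₁ ∪ V) ∪ P₂ → Name.loc a ∈ l₁.Cl (P₁ ∪ V) :=
    fun a h1 => h1.elim id fun h1 => LocStore.subset_Cl _ _ (Or.inl (h.left.cover ha a h1))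
  refine LocStore.Cl_congr (N := l₁.Cl (P₁ ∪ V) ∪ P₂) ?_ ?_
    fun a h1 => h.observed ha hV (hloc a h1)
  · rintro x (hx | hx)
    · exact Or.inl (LocStore.subset_Cl _ _ (Or.inr hx))
    · exact h.pub_sub_exposed hx
  · intro a d x h1 hd hx
    rw [h.observed ha hV (hloc a h1)] at hd
    obtain ⟨d', hd'⟩ := h.label_dom ha hV (hloc a h1)
    have := ((LocStore.restrict_apply _ _ _ _).1 hd').2
    rw [LocStore.override_of_some this] at hd
    cases hd
    exact Or.inl (LocStore.Cl_step (hloc a h1) this hx)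

theorem observed_restrict (h : LocInv N₁ P₁ l₁ act₁ N₂ P₂ l₂ act₂ pub s) (ha : act₁)
    (hV : V ⊆ N₁) (hJl : ∀ a, Name.loc a ∉ J)
    {s₀ : LocStore} (hs₀ : s₀ = s.override (l₁.restrict (l₁.Cl (P₁ ∪ V)))) :
    s₀.restrict (s₀.Cl (V ∪ pub) ∪ J) =
      (l₂.override l₁).restrict ((l₂.override l₁).Cl (pub ∪ V)) := by
  have hC := h.observed_Cl ha hV hs₀
  have hsub : s₀.Cl (V ∪ pub) ⊆ l₁.Cl (P₁ ∪ V) ∪ P₂ := by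
    refine LocStore.Cl_subset ?_ ?_
    · rintro x (hx | hx)
      · exact Or.inl (LocStore.subset_Cl _ _ (Or.inr hx))
      · exact h.pub_sub_exposed hx
    · intro a d x _ hd hx
      rw [hs₀, LocStore.override_apply, LocStore.restrict_apply] at hd
      rcases hd with hd | hd
      · exact Or.inl (LocStore.Cl_step hd.1 hd.2 hx)
      · exact (h.rng a d x hd.2 hx).imp_left fun h => LocStore.subset_Cl _ _ (Or.inl h)
  funext a
  rw [← hC]
  simp only [LocStore.restrict]
  by_cases ha' : Name.loc a ∈ s₀.Cl (V ∪ pub)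
  · have hl : Name.loc a ∈ l₁.Cl (P₁ ∪ V) := (hsub ha').elim id fun h1 =>
      LocStore.subset_Cl _ _ (Or.inl (h.left.cover ha a h1))
    have hm : Name.loc a ∈ s₀.Cl (V ∪ pub) ∪ J := Or.inl ha'
    rw [if_pos ha', if_pos hm, hs₀, h.observed ha hV hl]
  · have hm : Name.loc a ∉ s₀.Cl (V ∪ pub) ∪ J := fun h1 => h1.elim ha' (hJl a)
    rw [if_neg ha', if_neg hm]

/-- The inactive component accepts whatever the active component hands over. -/
theorem handover {v : Value} {S₂ : Store} {P : Set Name}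
    (h : LocInv N₁ P₁ l₁ act₁ N₂ P S₂.loc act₂ pub s) (ha : act₁) (hV : valNames v ⊆ N₁) :
    Handover P S₂ v (l₁.restrict (l₁.Cl (P₁ ∪ valNames v))) := by
  refine ⟨h.left.fin.subset ?_, ?_, ?_, ?_⟩
  · rintro _ ⟨a, d, rfl, hd⟩
    exact h.left.dom a d ((LocStore.restrict_apply _ _ _ _).1 hd).2
  · exact fun a ha' => LocStore.loc_mem_dom.2 (h.label_dom ha hV (label_names (Or.inr ha')))
  · exact fun a ha' => LocStore.loc_mem_dom.2 (h.label_dom ha hV (label_names (Or.inl ha')))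
  · rintro _ ⟨a, d, rfl, hd⟩
    rw [LocStore.restrict_apply] at hd
    exact LocStore.loc_mem_dom.2 (h.label_dom ha hV
      (LocStore.subset_Cl _ _ (Or.inl (h.left.cover ha a hd.1))))

/-- Giving priority to the other component after a handover does not change the combined store.
Handed-over locations carry the sender's values on both sides; elsewhere, a shared location would be
public in the sender and thus handed over had the sender a value for it, and the remaining locations
do not overlap. -/
theorem tau_override (h : LocInv N₁ P₁ l₁ act₁ N₂ P₂ l₂ act₂ pub s) {C : Set Name}
    (hPC : P₁ ⊆ C) : l₁.override (l₂.override (l₁.restrict C)) = l₂.override l₁ := by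
  funext a
  rcases Option.eq_none_or_eq_some (l₁.restrict C a) with h1 | ⟨d, h1⟩
  · have : l₁.override (l₂.override (l₁.restrict C)) a = l₁.override l₂ a := by
      simp [LocStore.override, h1]
    rw [this]
    by_cases hP : Name.loc a ∈ P₁ ∧ Name.loc a ∈ P₂
    · have hl : l₁ a = none := Option.eq_none_iff_forall_ne_some.2 fun d hd =>
        absurd ((LocStore.restrict_apply _ _ _ _).2 ⟨hPC hP.1, hd⟩) (by simp [h1])
      simp [LocStore.override, hl]
    · exact h.override_comm_apply hP
  · rw [LocStore.override_of_some (LocStore.override_of_some h1),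
      LocStore.override_of_some ((LocStore.restrict_apply _ _ _ _).1 h1).2]

/-! ### Updates from the outside -/

section update

variable {pr A : Set Name} {s₀ : LocStore}

theorem update_notMem (hu : SysUpdate pub pr A s s₀) {x : Name}
    (hx : x ∈ A ∪ (s₀.without pr).names) : x ∉ pr := fun h =>
  (Set.eq_empty_iff_forall_notMem.1 hu.private' x) ⟨hx, h⟩

/-- The store in the composite label is the update without its private part: visible locations
become public, and by the side conditions no private location does. -/
theorem update_restrict (hpr : pr = (N₁ ∪ N₂) \ pub) (hVA : V ⊆ A)
    (hu : SysUpdate pub pr A s s₀) (hJl : ∀ a, Name.loc a ∉ J) :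
    s₀.restrict (pub ∪ (V ∪ (s₀.without pr).names) ∪ J) = s₀.without pr := by
  funext a
  refine Option.ext fun d => ?_
  rw [LocStore.restrict_apply, LocStore.without_apply]
  refine and_congr_left fun hd => ⟨?_, fun h1 => ?_⟩
  · rintro ((h1 | h1) | h1)
    · rw [hpr]
      exact fun h2 => h2.2 h1
    · exact update_notMem hu (h1.imp_left fun h => hVA h)
    · exact absurd h1 (hJl a)
  · exact Or.inl (Or.inr (Or.inr (LocStore.mem_names.2
      ⟨a, d, (LocStore.without_apply _ _ _ _).2 ⟨h1, hd⟩, Or.inl rfl⟩)))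

theorem update_private (hpr : pr = (N₁ ∪ N₂) \ pub) (hu : SysUpdate pub pr A s s₀)
    {a : LocName} {d : Data} (hd : s₀ a = some d) (hp : Name.loc a ∈ pr) : s a = some d := by
  obtain ⟨d', hd'⟩ := LocStore.loc_mem_dom.1 (hu.noGuess ⟨⟨a, d, rfl, hd⟩, hp⟩)
  have := hu.keep a d' ((LocStore.without_apply _ _ _ _).2 ⟨by rw [hpr] at hp; exact hp.2, hd'⟩)
  rw [hd', ← this, hd]

/-- Where the update is undefined, so is the auxiliary store, and the location is not shared. At a
private location the update repeats the auxiliary store, which the merged store already contains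
because both components are inactive. At the remaining locations of its domain the visible part
carries the new value. -/
theorem merged_update (h : LocInv N₁ P₁ l₁ act₁ N₂ P₂ l₂ act₂ pub s) (ha : ¬ act₁)
    (ha' : ¬ act₂) (hpr : pr = (N₁ ∪ N₂) \ pub) (hu : SysUpdate pub pr A s s₀) :
    (merged P₁ P₂ l₁ l₂ s).override (s₀.without pr) = l₂.override (l₁.override s₀) := by
  funext a
  rcases Option.eq_none_or_eq_some (s₀ a) with h1 | ⟨d, h1⟩
  · have h2 : s₀.without pr a = none := Option.eq_none_iff_forall_ne_some.2 fun d hd =>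
      absurd ((LocStore.without_apply _ _ _ _).1 hd).2 (by simp [h1])
    have hs : s a = none := Option.eq_none_iff_forall_ne_some.2 fun d hd => by
      obtain ⟨d', hd'⟩ := update_dom hu hd
      simp [h1] at hd'
    have hP : ¬ (Name.loc a ∈ P₁ ∧ Name.loc a ∈ P₂) := fun hP => by
      obtain ⟨d', hd'⟩ := (h.dom a).2 (Or.inl hP.1)
      simp [hs] at hd'
    rw [LocStore.override_of_none h2, merged_of_not_shared _ _ _ hP, h.override_comm_apply hP]
    simp [LocStore.override, h1]
  · have hR : l₂.override (l₁.override s₀) a = some d :=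
      LocStore.override_of_some (LocStore.override_of_some h1)
    rw [hR]
    by_cases hp : Name.loc a ∈ pr
    · have h2 : s₀.without pr a = none := Option.eq_none_iff_forall_ne_some.2 fun d hd =>
        ((LocStore.without_apply _ _ _ _).1 hd).1 hp
      have hs := update_private hpr hu h1 hp
      rw [LocStore.override_of_none h2]
      by_cases hP : Name.loc a ∈ P₁ ∧ Name.loc a ∈ P₂
      · rw [h.merged_shared hP.1 hP.2, hs]
      · rw [merged_of_not_shared _ _ _ hP]
        rcases (h.dom a).1 ⟨d, hs⟩ with h3 | h3
        · have h4 := h.left.agree ha a h3 fun h4 => hP ⟨h3, h4⟩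
          rw [h.override_comm_apply hP, LocStore.override_of_some (h4.trans hs)]
        · have h4 := h.right.agree ha' a h3 fun h4 => hP ⟨h4, h3⟩
          rw [LocStore.override_of_some (h4.trans hs)]
    · exact LocStore.override_of_some ((LocStore.without_apply _ _ _ _).2 ⟨hp, h1⟩)

theorem merged_isSome (h : LocInv N₁ P₁ l₁ act₁ N₂ P₂ l₂ act₂ pub s) (ha : ¬ act₁)
    (ha' : ¬ act₂) {a : LocName} (hP : Name.loc a ∈ P₁ ∨ Name.loc a ∈ P₂) :
    ∃ d, merged P₁ P₂ l₁ l₂ s a = some d := by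
  obtain ⟨d, hd⟩ := (h.dom a).2 hP
  refine ⟨d, ?_⟩
  by_cases hP' : Name.loc a ∈ P₁ ∧ Name.loc a ∈ P₂
  · rw [h.merged_shared hP'.1 hP'.2, hd]
  · rw [merged_of_not_shared _ _ _ hP']
    rcases hP with h3 | h3
    · have h4 := h.left.agree ha a h3 fun h4 => hP' ⟨h3, h4⟩
      rw [h.override_comm_apply hP', LocStore.override_of_some (h4.trans hd)]
    · have h4 := h.right.agree ha' a h3 fun h4 => hP' ⟨h4, h3⟩
      rw [LocStore.override_of_some (h4.trans hd)]

/-- Dropping the private part leaves no dangling pointer, since neither the visible part nor the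
value names a private location. -/
theorem handover_update (h : LocInv N₁ P₁ l₁ act₁ N₂ P₂ l₂ act₂ pub s)
    {v : Value} {S P : _} (hh : Handover P S v s₀) (hVA : valNames v ⊆ A)
    (hpr : pr = (N₁ ∪ N₂) \ pub) (hu : SysUpdate pub pr A s s₀)
    (c : ContName → Option (Stack × ContName)) :
    Handover pub ⟨merged P₁ P₂ l₁ l₂ s, c⟩ v (s₀.without pr) := by
  have hdom : ∀ a, Name.loc a ∈ s₀.dom → Name.loc a ∉ pr → Name.loc a ∈ (s₀.without pr).dom := by
    intro a h1 h2
    obtain ⟨d, hd⟩ := LocStore.loc_mem_dom.1 h1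
    exact LocStore.loc_mem_dom.2 ⟨d, (LocStore.without_apply _ _ _ _).2 ⟨h2, hd⟩⟩
  refine ⟨hh.finite.subset ?_, ?_, ?_, ?_⟩
  · rintro _ ⟨a, d, rfl, hd⟩
    exact ⟨a, d, rfl, ((LocStore.without_apply _ _ _ _).1 hd).2⟩
  · intro a ha
    refine hdom a (hh.closed a ?_) (update_notMem hu (Or.inr ha))
    obtain ⟨b, d, hd, hx⟩ := LocStore.mem_names.1 ha
    exact LocStore.mem_names.2 ⟨b, d, ((LocStore.without_apply _ _ _ _).1 hd).2, hx⟩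
  · exact fun a ha => hdom a (hh.value a ha) (update_notMem hu (Or.inl (hVA ha)))
  · rintro _ ⟨a, d, rfl, hd⟩
    have hp := ((LocStore.restrict_apply _ _ _ _).1 hd).1
    refine hdom a ?_ (by rw [hpr]; exact fun h2 => h2.2 hp)
    obtain ⟨d', hd'⟩ := (h.dom a).2 (h.pub _ hp)
    exact LocStore.loc_mem_dom.2 (update_dom hu hd')

theorem update_names (h : LocInv N₁ P₁ l₁ act₁ N₂ P₂ l₂ act₂ pub s)
    (hpr : pr = (N₁ ∪ N₂) \ pub) (hu : SysUpdate pub pr A s s₀) {x : Name} (hx : x ∈ s₀.names) :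
    x ∈ N₁ ∪ N₂ ∨ x ∈ (s₀.without pr).names := by
  obtain ⟨a, d, hd, hx⟩ := LocStore.mem_names.1 hx
  by_cases hp : Name.loc a ∈ pr
  · left
    have hs := update_private hpr hu hd hp
    have hP : x ∈ P₁ ∨ x ∈ P₂ := by
      rcases hx with rfl | hx
      · exact (h.dom a).1 ⟨d, hs⟩
      · exact h.rng a d x hs hx
    exact hP.imp (h.left.sub ·) (h.right.sub ·)
  · exact Or.inr (LocStore.mem_names.2 ⟨a, d, (LocStore.without_apply _ _ _ _).2 ⟨hp, hd⟩, hx⟩)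

/-! ### Reconstruction of an update from the part that the outside can see -/

variable {s' : LocStore} {v : Value}

/-- The update to be given to a component is the outside's store `s'` laid over the private part of
the auxiliary store. The two parts do not compete: `s'` cannot name a private location. -/
theorem rebuilt_apply (a : LocName) (d : Data) :
    (s.without pub).override s' a = some d ↔
      s' a = some d ∨ (s' a = none ∧ Name.loc a ∉ pub ∧ s a = some d) := by
  rw [LocStore.override_apply, LocStore.without_apply]

theorem rebuilt_names {x : Name} (hx : x ∈ ((s.without pub).override s').names) :
    x ∈ s'.names ∨ ∃ a d, s a = some d ∧ Name.loc a ∉ pub ∧ (x = Name.loc a ∨ x ∈ d.names) := by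
  obtain ⟨a, d, hd, hx⟩ := LocStore.mem_names.1 hx
  rcases (rebuilt_apply a d).1 hd with h1 | h1
  · exact Or.inl (LocStore.mem_names.2 ⟨a, d, h1, hx⟩)
  · exact Or.inr ⟨a, d, h1.2.2, h1.2.1, hx⟩

theorem rebuilt_handover (h : LocInv N₁ P₁ l₁ act₁ N₂ P₂ l₂ act₂ pub s) (ha : ¬ act₁)
    (ha' : ¬ act₂) {c c' : ContName → Option (Stack × ContName)}
    (hh : Handover pub ⟨merged P₁ P₂ l₁ l₂ s, c⟩ v s') :
    Handover P₁ ⟨l₁, c'⟩ v ((s.without pub).override s') := by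
  -- The rebuilt update is defined wherever the auxiliary store is: `s'` must contain the locations
  -- in `pub`, and the others are copied.
  have hpub : ∀ a d, s a = some d → Name.loc a ∈ ((s.without pub).override s').dom := by
    intro a d hd
    rw [LocStore.loc_mem_dom]
    by_cases hp : Name.loc a ∈ pub
    · obtain ⟨d', hd'⟩ := h.merged_isSome ha ha' ((h.dom a).1 ⟨d, hd⟩)
      obtain ⟨d'', hd''⟩ := LocStore.loc_mem_dom.1 (hh.ext
        (⟨a, d', rfl, (LocStore.restrict_apply _ _ _ _).2 ⟨hp, hd'⟩⟩))
      exact ⟨d'', (rebuilt_apply a _).2 (Or.inl hd'')⟩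
    · rcases Option.eq_none_or_eq_some (s' a) with h1 | ⟨d', h1⟩
      · exact ⟨d, (rebuilt_apply a _).2 (Or.inr ⟨h1, hp, hd⟩)⟩
      · exact ⟨d', (rebuilt_apply a _).2 (Or.inl h1)⟩
  have hs' : ∀ a, Name.loc a ∈ s'.dom → Name.loc a ∈ ((s.without pub).override s').dom := by
    intro a h1
    obtain ⟨d, hd⟩ := LocStore.loc_mem_dom.1 h1
    exact LocStore.loc_mem_dom.2 ⟨d, (rebuilt_apply a _).2 (Or.inl hd)⟩
  refine ⟨?_, ?_, fun a ha => hs' a (hh.value a ha), ?_⟩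
  · refine ((h.left.fin.union h.right.fin).union hh.finite).subset ?_
    rintro _ ⟨a, d, rfl, hd⟩
    rcases (rebuilt_apply a d).1 hd with h1 | h1
    · exact Or.inr ⟨a, d, rfl, h1⟩
    · exact Or.inl (((h.dom a).1 ⟨d, h1.2.2⟩).imp (h.left.sub ·) (h.right.sub ·))
  · intro a hx
    rcases rebuilt_names hx with h1 | ⟨b, d, hd, -, h1⟩
    · exact hs' a (hh.closed a h1)
    · have hP : Name.loc a ∈ P₁ ∨ Name.loc a ∈ P₂ := by
        rcases h1 with h1 | h1
        · exact (h.dom a).1 (by cases h1; exact ⟨d, hd⟩)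
        · exact h.rng b d _ hd h1
      obtain ⟨d', hd'⟩ := (h.dom a).2 hP
      exact hpub a d' hd'
  · rintro _ ⟨a, d, rfl, hd⟩
    obtain ⟨d', hd'⟩ := (h.dom a).2 (Or.inl ((LocStore.restrict_apply _ _ _ _).1 hd).1)
    exact hpub a d' hd'

theorem rebuilt_names_left (h : LocInv N₁ P₁ l₁ act₁ N₂ P₂ l₂ act₂ pub s)
    (hs : ∀ x ∈ s'.names, x ∈ N₁ → x ∈ pub) {x : Name}
    (hx : x ∈ ((s.without pub).override s').names) (hN : x ∈ N₁) : x ∈ P₁ := by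
  rcases rebuilt_names hx with h1 | ⟨b, d, hd, -, h1⟩
  · exact h.pub_left (hs x h1 hN) hN
  · have hP : x ∈ P₁ ∨ x ∈ P₂ := by
      rcases h1 with rfl | h1
      · exact (h.dom b).1 ⟨d, hd⟩
      · exact h.rng b d _ hd h1
    exact hP.elim id fun hP => h.left.shared x hN (h.right.sub hP)

/-- The copied locations are exactly of the private kind, so removing private locations returns what
the outside supplied. -/
theorem rebuilt_without (h : LocInv N₁ P₁ l₁ act₁ N₂ P₂ l₂ act₂ pub s)
    (hpr : pr = (N₁ ∪ N₂) \ pub) (hs : ∀ x ∈ s'.names, x ∈ N₁ ∪ N₂ → x ∈ pub) :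
    ((s.without pub).override s').without pr = s' := by
  funext a
  refine Option.ext fun d => ?_
  rw [LocStore.without_apply, rebuilt_apply]
  constructor
  · rintro ⟨h1, h2 | h2⟩
    · exact h2
    · refine absurd ?_ h1
      rw [hpr]
      exact ⟨((h.dom a).1 ⟨d, h2.2.2⟩).imp (h.left.sub ·) (h.right.sub ·), h2.2.1⟩
  · intro hd
    refine ⟨?_, Or.inl hd⟩
    rw [hpr]
    exact fun h2 => h2.2 (hs _ (LocStore.mem_names.2 ⟨a, d, hd, Or.inl rfl⟩) h2.1)

theorem rebuilt_update (h : LocInv N₁ P₁ l₁ act₁ N₂ P₂ l₂ act₂ pub s) (ha : ¬ act₁)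
    (ha' : ¬ act₂) {c : ContName → Option (Stack × ContName)}
    (hpr : pr = (N₁ ∪ N₂) \ pub) (hh : Handover pub ⟨merged P₁ P₂ l₁ l₂ s, c⟩ v s')
    (hs : ∀ x ∈ A ∪ s'.names, x ∈ N₁ ∪ N₂ → x ∈ pub) :
    SysUpdate pub pr A s ((s.without pub).override s') := by
  have hs' : ∀ x ∈ s'.names, x ∈ N₁ ∪ N₂ → x ∈ pub := fun x hx => hs x (Or.inr hx)
  refine ⟨?_, ?_, ?_, ?_⟩
  · rintro _ ⟨a, d, rfl, hd⟩
    obtain ⟨hp, hd⟩ := (LocStore.restrict_apply _ _ _ _).1 hd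
    obtain ⟨d', hd'⟩ := h.merged_isSome ha ha' ((h.dom a).1 ⟨d, hd⟩)
    obtain ⟨d'', hd''⟩ := LocStore.loc_mem_dom.1 (hh.ext
      (⟨a, d', rfl, (LocStore.restrict_apply _ _ _ _).2 ⟨hp, hd'⟩⟩))
    exact LocStore.loc_mem_dom.2 ⟨d'', (rebuilt_apply a _).2 (Or.inl hd'')⟩
  · intro a d hd
    obtain ⟨hp, hd⟩ := (LocStore.without_apply _ _ _ _).1 hd
    refine (rebuilt_apply a d).2 (Or.inr ⟨Option.eq_none_iff_forall_ne_some.2 fun d' hd' => ?_, hp, hd⟩)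
    exact hp (hs' _ (LocStore.mem_names.2 ⟨a, d', hd', Or.inl rfl⟩)
      (((h.dom a).1 ⟨d, hd⟩).imp (h.left.sub ·) (h.right.sub ·)))
  · rintro _ ⟨⟨a, d, rfl, hd⟩, hp⟩
    rw [hpr] at hp
    rcases (rebuilt_apply a d).1 hd with h1 | h1
    · exact absurd (hs' _ (LocStore.mem_names.2 ⟨a, d, h1, Or.inl rfl⟩) hp.1) hp.2
    · exact ⟨a, d, rfl, h1.2.2⟩
  · rw [h.rebuilt_without hpr hs', Set.eq_empty_iff_forall_notMem]
    rintro x ⟨h1, h2⟩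
    rw [hpr] at h2
    exact h2.2 (hs x h1 h2.1)

end update
end LocInv

/-! ### Simulation -/

namespace Inv

variable {M M' L : Mod} {c c' : Comp}

theorem hatCont_of_notMem (h : Inv M M' c) {k : ContName}
    (hk : Name.cont k ∉ c.X₁.N ∪ c.X₂.N) : c.hatCont k = none := by
  rw [Option.eq_none_iff_forall_ne_some]
  intro q hq
  obtain ⟨-, p, hp, -⟩ := h.hatCont_eq_some.1 hq
  exact hk (hp.imp (h.cont.left.dom _ _) (h.cont.right.dom _ _))

/-- The old continuations are stored and classified alike in `c` and `c'`. -/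
structure ContAgree (c c' : Comp) : Prop where
  K : ∀ k, Name.cont k ∈ c.X₁.N ∪ c.X₂.N → (k ∈ c.K ↔ k ∈ c'.K)
  stored : ∀ k, Name.cont k ∈ c.X₁.N ∪ c.X₂.N → ∀ x,
    (c.X₁.store.cont k = some x ∨ c.X₂.store.cont k = some x ↔
      c'.X₁.store.cont k = some x ∨ c'.X₂.store.cont k = some x)

theorem fetch_of_agree (h : Inv M M' c) (h' : Inv M M' c') (hcc : ContAgree c c')
    {t : Stack} {k : ContName} (hk : Name.cont k ∈ c.X₁.N ∪ c.X₂.N) :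
    c'.fetch (t, k) = c.fetch (t, k) :=
  h.fetch_congr h' hcc.K (fun k hk x => (hcc.stored k hk x).1) hk

theorem hatCont_of_agree (h : Inv M M' c) (h' : Inv M M' c') (hcc : ContAgree c c')
    {k : ContName} (hk : Name.cont k ∈ c.X₁.N ∪ c.X₂.N) : c'.hatCont k = c.hatCont k := by
  refine Option.ext fun q => ?_
  rw [h.hatCont_eq_some, h'.hatCont_eq_some, hcc.K k hk]
  refine and_congr_right fun _ => exists_congr fun p => ?_
  rw [hcc.stored k hk p]
  refine and_congr_right fun hp => ?_
  obtain ⟨t, k'⟩ := p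
  rw [h.fetch_of_agree h' hcc (h.tgt _ _ _ ((hcc.stored k hk _).2 hp))]

theorem hatCont_eq_of_agree (h : Inv M M' c) (h' : Inv M M' c') (hcc : ContAgree c c')
    (hn : ∀ k, Name.cont k ∉ c.X₁.N ∪ c.X₂.N → c'.hatCont k = none) : c'.hatCont = c.hatCont := by
  funext k
  by_cases hk : Name.cont k ∈ c.X₁.N ∪ c.X₂.N
  · exact h.hatCont_of_agree h' hcc hk
  · rw [hn k hk, h.hatCont_of_notMem hk]

/-! ### How `R` transforms under the individual moves -/

section

variable {N P N₂ P₂ pub : Set Name} {S S₂ : Store} {t t' : Stack} {e : Exp} {f : FunName}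
  {v : Value} {k k₀ : ContName} {pubS : Set ContName} {s l : LocStore} {pr : Set Name}

theorem R_prog {p : Prog} {σ : Sys} (h : Inv M M' ⟨.prog p, .sys σ, pub, pubS, s⟩) :
    Comp.R ⟨.prog p, .sys σ, pub, pubS, s⟩ = .prog (p.embed σ.N
      (Comp.K ⟨.prog p, .sys σ, pub, pubS, s⟩) pub σ.s.loc
      (Comp.hatCont ⟨.prog p, .sys σ, pub, pubS, s⟩)
      (Comp.fetch ⟨.prog p, .sys σ, pub, pubS, s⟩ ([], p.k)).1
      (Comp.fetch ⟨.prog p, .sys σ, pub, pubS, s⟩ ([], p.k)).2) := by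
  have := h.fetch_append p.t [] p.k
  rw [List.append_nil] at this
  refine congrArg State.prog (Prog.ext rfl rfl rfl ?_ rfl ?_)
  · exact congrArg Prod.fst this
  · exact (congrArg Prod.snd this :)

theorem notMem_pubS (h : Inv M M' c) (hk : Name.cont k ∉ c.X₁.N ∪ c.X₂.N) : k ∉ c.pubS :=
  fun hp => hk (h.cont.sub k (h.cont.pubS_sub k hp))

/-- The new name joins `K` and is thereby invisible in the translated state. Following it once puts
the stored frames back below the call frame, so the complete stack is what it was. -/
theorem R_tauCall
    (h : Inv M M' ⟨.prog ⟨N, P, S, .appR [.fn f] :: t, .val v, k₀⟩, .sys ⟨N₂, P₂, S₂⟩,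
      pub, pubS, s⟩)
    (hf : Name.fn f ∈ N₂) (hk : Name.cont k ∉ N) (hk₂ : Name.cont k ∉ N₂)
    (hl : l = S.loc.restrict (S.loc.Cl (P ∪ valNames v))) :
    Comp.R ⟨.prog ⟨N, P, S, .appR [.fn f] :: t, .val v, k₀⟩, .sys ⟨N₂, P₂, S₂⟩, pub, pubS, s⟩ =
    Comp.R ⟨.sys ⟨N ∪ {Name.cont k}, S.loc.Cl (P ∪ valNames v) ∪ {Name.cont k},
        S.setCont k t k₀⟩,
      .prog ⟨N₂ ∪ {Name.cont k} ∪ (valNames v ∪ l.names), P₂ ∪ {Name.cont k} ∪ (valNames v ∪ l.names),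
        S₂.overrideLoc l, [.appR [.fn f]], .val v, k⟩, pub, pubS, s.override l⟩ := by
  have h' := h.tauCall hf hk hk₂ hl
  generalize hc : (⟨.prog ⟨N, P, S, .appR [.fn f] :: t, .val v, k₀⟩, .sys ⟨N₂, P₂, S₂⟩, pub, pubS,
    s⟩ : Comp) = c at h ⊢
  generalize hc' : (⟨.sys ⟨N ∪ {Name.cont k}, S.loc.Cl (P ∪ valNames v) ∪ {Name.cont k},
        S.setCont k t k₀⟩,
      .prog ⟨N₂ ∪ {Name.cont k} ∪ (valNames v ∪ l.names), P₂ ∪ {Name.cont k} ∪ (valNames v ∪ l.names),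
        S₂.overrideLoc l, [.appR [.fn f]], .val v, k⟩, pub, pubS, s.override l⟩ : Comp) = c' at h' ⊢
  have hlN : valNames v ∪ l.names ⊆ N := by
    subst hl hc
    exact LocInv.label_names.trans (h.loc.exposed (h.left.term _ rfl).2)
  have hkp : k ∉ pubS := by
    subst hc
    exact h.notMem_pubS fun hx => hx.elim hk hk₂
  have hK : c'.K = insert k c.K := by
    ext j
    rw [Set.mem_insert_iff, h'.mem_K, h.mem_K]
    subst hc hc'
    simp only [State.N, Set.mem_union, Set.mem_singleton_iff, Name.cont.injEq,
      cont_notMem_valNames, LocStore.cont_notMem_names, or_false]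
    grind
  have hcc : ContAgree c c' := by
    refine ⟨fun j hj => ?_, fun j hj x => ?_⟩
    all_goals
      have hjk : j ≠ k := by
        rintro rfl; subst hc; exact hj.elim hk hk₂
    · rw [hK, Set.mem_insert_iff, or_iff_right hjk]
    · subst hc hc'
      simp [State.store, Store.setCont, Store.overrideLoc, hjk]
  have hkK : k ∈ c'.K := hK ▸ Set.mem_insert _ _
  have hft : c'.fetch ([.appR [.fn f]], k) = c.fetch (.appR [.fn f] :: t, k₀) := by
    rw [h'.fetch_of_mem _ hkK (p := (t, k₀)) (by subst hc'; simp [State.store, Store.setCont])]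
    refine h.fetch_of_agree h' hcc (Or.inl (h.cont.left.cur _ ?_).1)
    subst hc
    rfl
  have hct : c'.hatCont = c.hatCont := by
    refine h.hatCont_eq_of_agree h' hcc fun j hj => ?_
    by_cases hjk : j = k
    · subst hjk
      exact if_pos hkK
    · refine h'.hatCont_of_notMem fun h1 => hj ?_
      subst hc hc'
      simpa [State.N, hjk, cont_notMem_valNames, LocStore.cont_notMem_names] using h1
  have hN : c'.hatN = c.hatN := by
    simp only [Comp.hatN, hK, Set.image_insert_eq]
    subst hc hc'
    ext x
    have := @hlN x
    simp only [State.N, Set.mem_sdiff, Set.mem_union, Set.mem_singleton_iff, Set.mem_insert_iff] at *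
    grind
  have hloc : S.loc.override (S₂.loc.override l) = S₂.loc.override S.loc := by
    subst hl hc
    exact h.loc.tau_override fun x hx => LocStore.subset_Cl _ _ (Or.inl hx)
  subst hc hc'
  refine congrArg State.prog (Prog.ext hN.symm rfl (Store.ext hloc.symm hct.symm) ?_ rfl ?_)
  · exact congrArg Prod.fst hft.symm
  · exact congrArg Prod.snd hft.symm

/-- The name returned to is stored by the partner, hence used by both components and not of system
polarity: it lies in `K`. The resumed stack is the first piece that `fetch` would have collected. -/
theorem R_tauRet
    (h : Inv M M' ⟨.prog ⟨N, P, S, [], .val v, k⟩, .sys ⟨N₂, P₂, S₂⟩, pub, pubS, s⟩)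
    (hk : S₂.cont k = some (t, k₀)) (hl : l = S.loc.restrict (S.loc.Cl (P ∪ valNames v))) :
    Comp.R ⟨.prog ⟨N, P, S, [], .val v, k⟩, .sys ⟨N₂, P₂, S₂⟩, pub, pubS, s⟩ =
    Comp.R ⟨.sys ⟨N, S.loc.Cl (P ∪ valNames v), S⟩,
      .prog ⟨N₂ ∪ (valNames v ∪ l.names), P₂ ∪ (valNames v ∪ l.names),
        S₂.overrideLoc l, t, .val v, k₀⟩, pub, pubS, s.override l⟩ := by
  have h' := h.tauRet hk hl
  generalize hc : (⟨.prog ⟨N, P, S, [], .val v, k⟩, .sys ⟨N₂, P₂, S₂⟩, pub, pubS,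
    s⟩ : Comp) = c at h ⊢
  generalize hc' : (⟨.sys ⟨N, S.loc.Cl (P ∪ valNames v), S⟩,
      .prog ⟨N₂ ∪ (valNames v ∪ l.names), P₂ ∪ (valNames v ∪ l.names),
        S₂.overrideLoc l, t, .val v, k₀⟩, pub, pubS, s.override l⟩ : Comp) = c' at h' ⊢
  have hlN : valNames v ∪ l.names ⊆ N := by
    subst hl hc
    exact LocInv.label_names.trans (h.loc.exposed (h.left.term _ rfl).2)
  have hK : c'.K = c.K := by
    ext j
    rw [h'.mem_K, h.mem_K]
    subst hc hc'
    simp [State.N, cont_notMem_valNames, LocStore.cont_notMem_names]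
  have hcc : ContAgree c c' := by
    refine ⟨fun j hj => by rw [hK], fun j hj x => ?_⟩
    subst hc hc'
    simp [State.store, Store.overrideLoc]
  have hkK : k ∈ c.K := by
    rw [h.mem_K]
    subst hc
    exact ⟨(h.cont.left.cur k rfl).1, h.cont.right.dom _ _ hk, (h.cont.right.disj _ _ hk).2⟩
  have hft : c'.fetch (t, k₀) = c.fetch ([], k) := by
    rw [h.fetch_of_mem _ hkK (p := (t, k₀)) (by subst hc; exact Or.inr hk)]
    refine h.fetch_of_agree h' hcc (Or.inr (h.cont.right.tgt k t _ ?_).1)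
    subst hc
    exact hk
  have hct : c'.hatCont = c.hatCont := by
    refine h.hatCont_eq_of_agree h' hcc fun j hj => ?_
    refine h'.hatCont_of_notMem fun h1 => hj ?_
    subst hc hc'
    simpa [State.N, cont_notMem_valNames, LocStore.cont_notMem_names] using h1
  have hN : c'.hatN = c.hatN := by
    simp only [Comp.hatN, hK]
    subst hc hc'
    ext x
    have := @hlN x
    simp only [State.N, Set.mem_sdiff, Set.mem_union] at *
    grind
  have hloc : S.loc.override (S₂.loc.override l) = S₂.loc.override S.loc := by
    subst hl hc
    exact h.loc.tau_override fun x hx => LocStore.subset_Cl _ _ (Or.inl hx)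
  subst hc hc'
  refine congrArg State.prog (Prog.ext hN.symm rfl (Store.ext hloc.symm hct.symm) ?_ rfl ?_)
  · exact congrArg Prod.fst hft.symm
  · exact congrArg Prod.snd hft.symm

theorem R_outCall
    (h : Inv M M' ⟨.prog ⟨N, P, S, .appR [.fn f] :: t, .val v, k₀⟩, .sys ⟨N₂, P₂, S₂⟩,
      pub, pubS, s⟩)
    (hf : L.defn f = none) (hk : Name.cont k ∉ N) (hk₂ : Name.cont k ∉ N₂)
    (hl : l = s.override (S.loc.restrict (S.loc.Cl (P ∪ valNames v)))) :
    L.LStep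
      (Comp.R ⟨.prog ⟨N, P, S, .appR [.fn f] :: t, .val v, k₀⟩, .sys ⟨N₂, P₂, S₂⟩, pub, pubS, s⟩)
      (.call f v k) (l.restrict (l.Cl (valNames v ∪ pub) ∪ {Name.cont k}))
      (Comp.R ⟨.sys ⟨N ∪ {Name.cont k}, S.loc.Cl (P ∪ valNames v) ∪ {Name.cont k},
          S.setCont k t k₀⟩, .sys ⟨N₂, P₂, S₂⟩,
        l.Cl (valNames v ∪ pub) ∪ {Name.cont k}, pubS \ {k}, l⟩) := by
  have h' := h.outCall hk hk₂ hl
  have hV : valNames v ⊆ N := (h.left.term _ rfl).2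
  have hact : (State.prog ⟨N, P, S, .appR [.fn f] :: t, .val v, k₀⟩).cur ≠ none := by
    simp [State.cur]
  rw [h.loc.observed_restrict hact hV (by simp) hl]
  have hCl := h.loc.observed_Cl hact hV hl
  have hloc : LocInv.merged (S.loc.Cl (P ∪ valNames v) ∪ {Name.cont k}) P₂ S.loc S₂.loc l =
      S₂.loc.override S.loc := by
    refine h'.loc.merged_out fun a ha => ?_
    rw [hl]
    exact h.loc.observed hact hV (ha.resolve_right (by simp))
  generalize hc : (⟨.prog ⟨N, P, S, .appR [.fn f] :: t, .val v, k₀⟩, .sys ⟨N₂, P₂, S₂⟩, pub, pubS,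
    s⟩ : Comp) = c at h ⊢
  generalize hc' : (⟨.sys ⟨N ∪ {Name.cont k}, S.loc.Cl (P ∪ valNames v) ∪ {Name.cont k},
          S.setCont k t k₀⟩, .sys ⟨N₂, P₂, S₂⟩,
        l.Cl (valNames v ∪ pub) ∪ {Name.cont k}, pubS \ {k}, l⟩ : Comp) = c' at h' ⊢
  have hkp : k ∉ pubS := by
    subst hc
    exact h.notMem_pubS fun hx => hx.elim hk hk₂
  -- The new name is known to the calling component only, so it is not private in the sense of `K`.
  have hK : c'.K = c.K := by
    ext j
    rw [h'.mem_K, h.mem_K]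
    subst hc hc'
    simp only [State.N, Set.mem_union, Set.mem_singleton_iff, Name.cont.injEq, Set.mem_sdiff]
    grind
  have hcc : ContAgree c c' := by
    refine ⟨fun j hj => by rw [hK], fun j hj x => ?_⟩
    have hjk : j ≠ k := by
      rintro rfl; subst hc; exact hj.elim hk hk₂
    subst hc hc'
    simp [State.store, Store.setCont, hjk]
  have hkK : k ∉ c.K := by
    rw [h.mem_K]
    subst hc
    exact fun h1 => hk h1.1
  have hft : c'.fetch (t, k₀) = c.fetch (t, k₀) := by
    refine h.fetch_of_agree h' hcc (Or.inl (h.cont.left.cur _ ?_).1)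
    subst hc
    rfl
  have hct : c'.hatCont = Function.update c.hatCont k
      (some ((c.fetch (t, k₀)).1, (c.fetch (t, k₀)).2)) := by
    funext j
    by_cases hjk : j = k
    · subst hjk
      rw [Function.update_self, h'.hatCont_eq_some, hK]
      exact ⟨hkK, (t, k₀), Or.inl (by subst hc'; simp [State.store, Store.setCont]), hft.symm⟩
    · rw [Function.update_of_ne hjk]
      by_cases hj : Name.cont j ∈ c.X₁.N ∪ c.X₂.N
      · exact h.hatCont_of_agree h' hcc hj
      · rw [h.hatCont_of_notMem hj, h'.hatCont_of_notMem]
        refine fun h1 => hj ?_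
        subst hc hc'
        simpa [State.N, hjk] using h1
  have hN : c'.hatN = c.hatN ∪ {Name.cont k} := by
    simp only [Comp.hatN, hK]
    subst hc hc'
    ext x
    simp only [State.N, Set.mem_sdiff, Set.mem_union, Set.mem_singleton_iff, Set.mem_image] at *
    grind
  have hkN : Name.cont k ∉ c.hatN := by
    subst hc
    exact fun h1 => h1.1.elim hk hk₂
  have e : c.R = .prog ⟨c.hatN, pub, ⟨S₂.loc.override S.loc, c.hatCont⟩,
      .appR [.fn f] :: (c.fetch (t, k₀)).1, .val v, (c.fetch (t, k₀)).2⟩ := by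
    have := h.fetch_append [.appR [.fn f]] t k₀
    subst hc
    refine congrArg State.prog (Prog.ext rfl rfl rfl ?_ rfl ?_)
    · exact congrArg Prod.fst this
    · exact (congrArg Prod.snd this :)
  have e' : c'.R = .sys ⟨c.hatN ∪ {Name.cont k},
      (S₂.loc.override S.loc).Cl (pub ∪ valNames v) ∪ {Name.cont k},
      (⟨S₂.loc.override S.loc, c.hatCont⟩ : Store).setCont k (c.fetch (t, k₀)).1
        (c.fetch (t, k₀)).2⟩ := by
    subst hc'
    exact congrArg State.sys (Sys.ext hN (congrArg (· ∪ {Name.cont k}) hCl) (Store.ext hloc hct))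
  rw [e, e']
  subst hc
  exact .out (.call hf hkN rfl)

theorem R_outRet
    (h : Inv M M' ⟨.prog ⟨N, P, S, [], .val v, k⟩, .sys ⟨N₂, P₂, S₂⟩, pub, pubS, s⟩)
    (hk : S₂.cont k = none)
    (hl : l = s.override (S.loc.restrict (S.loc.Cl (P ∪ valNames v)))) :
    L.LStep (Comp.R ⟨.prog ⟨N, P, S, [], .val v, k⟩, .sys ⟨N₂, P₂, S₂⟩, pub, pubS, s⟩)
      (.ret v k) (l.restrict (l.Cl (valNames v ∪ pub)))
      (Comp.R ⟨.sys ⟨N, S.loc.Cl (P ∪ valNames v), S⟩, .sys ⟨N₂, P₂, S₂⟩,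
        l.Cl (valNames v ∪ pub), pubS, l⟩) := by
  have h' := h.outRet hl
  have hV : valNames v ⊆ N := (h.left.term _ rfl).2
  have hact : (State.prog ⟨N, P, S, [], .val v, k⟩).cur ≠ none := by simp [State.cur]
  have hres := h.loc.observed_restrict (J := ∅) hact hV (by simp) hl
  rw [Set.union_empty] at hres
  rw [hres]
  have hCl := h.loc.observed_Cl hact hV hl
  have hloc : LocInv.merged (S.loc.Cl (P ∪ valNames v)) P₂ S.loc S₂.loc l =
      S₂.loc.override S.loc := by
    refine h'.loc.merged_out fun a ha => ?_
    rw [hl]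
    exact h.loc.observed hact hV ha
  generalize hc : (⟨.prog ⟨N, P, S, [], .val v, k⟩, .sys ⟨N₂, P₂, S₂⟩, pub, pubS,
    s⟩ : Comp) = c at h ⊢
  generalize hc' : (⟨.sys ⟨N, S.loc.Cl (P ∪ valNames v), S⟩, .sys ⟨N₂, P₂, S₂⟩,
        l.Cl (valNames v ∪ pub), pubS, l⟩ : Comp) = c' at h' ⊢
  have hK : c'.K = c.K := by
    ext j
    rw [h'.mem_K, h.mem_K]
    subst hc hc'
    rfl
  have hcc : ContAgree c c' := by
    refine ⟨fun j hj => by rw [hK], fun j hj x => ?_⟩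
    subst hc hc'
    rfl
  -- The current continuation is stored by the partner or has system polarity. The first is
  -- excluded, so it is external and the search stops at once.
  have hkK : k ∉ c.K := by
    rw [h.mem_K]
    subst hc
    rintro ⟨-, -, h1⟩
    rcases (h.cont.left.cur k rfl).2 with ⟨p, h2⟩ | h2
    · exact absurd h2 (by simp [State.store, hk])
    · exact h1 h2
  have hft : c.fetch ([], k) = ([], k) := h.fetch_of_notMem _ hkK
  have hct : c'.hatCont = c.hatCont := by
    refine h.hatCont_eq_of_agree h' hcc fun j hj => h'.hatCont_of_notMem fun h1 => hj ?_
    subst hc hc'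
    exact h1
  have hN : c'.hatN = c.hatN := by
    simp only [Comp.hatN, hK]
    subst hc hc'
    rfl
  have e : c.R = .prog ⟨c.hatN, pub, ⟨S₂.loc.override S.loc, c.hatCont⟩, [], .val v, k⟩ := by
    subst hc
    refine congrArg State.prog (Prog.ext rfl rfl rfl ?_ rfl ?_)
    · exact congrArg Prod.fst hft
    · exact congrArg Prod.snd hft
  have e' : c'.R = .sys ⟨c.hatN, (S₂.loc.override S.loc).Cl (pub ∪ valNames v),
      ⟨S₂.loc.override S.loc, c.hatCont⟩⟩ := by
    subst hc'
    exact congrArg State.sys (Sys.ext hN hCl (Store.ext hloc hct))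
  rw [e, e']
  subst hc
  exact .out (.ret rfl)

theorem R_inCall {F : Func}
    (h : Inv M M' ⟨.sys ⟨N, P, S⟩, .sys ⟨N₂, P₂, S₂⟩, pub, pubS, s⟩)
    (hf : Name.fn f ∈ N) (hd : L.defn f = some F) (hk : S.cont k = none)
    (hk₂ : Name.cont k ∈ N₂ → k ∈ pubS)
    (hh : Handover P S v l) (hpr : pr = (N ∪ N₂) \ pub)
    (hu : SysUpdate pub pr ({Name.fn f} ∪ valNames v) s l) :
    L.LStep (Comp.R ⟨.sys ⟨N, P, S⟩, .sys ⟨N₂, P₂, S₂⟩, pub, pubS, s⟩) (.call f v k)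
      (l.restrict (pub ∪ (valNames v ∪ (l.without pr).names) ∪ {Name.cont k}))
      (Comp.R ⟨.prog ⟨N ∪ {Name.cont k} ∪ (valNames v ∪ l.names),
          P ∪ {Name.cont k} ∪ (valNames v ∪ l.names), S.overrideLoc l, [.appR [.fn f]], .val v, k⟩,
        .sys ⟨N₂, P₂, S₂⟩,
        pub ∪ (valNames v ∪ (l.without pr).names) ∪ {Name.cont k}, pubS ∪ {k}, s.override l⟩) := by
  have h' := h.inCall hf hk hk₂ hh hpr hu
  rw [LocInv.update_restrict hpr Set.subset_union_right hu (by simp)]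
  have hloc := h.loc.merged_update (by simp [State.cur]) (by simp [State.cur]) hpr hu
  have hho := fun ct => h.loc.handover_update hh Set.subset_union_right hpr hu ct
  have hnm := fun x => h.loc.update_names hpr hu (x := x)
  have hnm' := fun x => LocInv.update_notMem hu (x := x)
  generalize hc : (⟨.sys ⟨N, P, S⟩, .sys ⟨N₂, P₂, S₂⟩, pub, pubS, s⟩ : Comp) = c at h ⊢
  generalize hc' : (⟨.prog ⟨N ∪ {Name.cont k} ∪ (valNames v ∪ l.names),
          P ∪ {Name.cont k} ∪ (valNames v ∪ l.names), S.overrideLoc l, [.appR [.fn f]], .val v, k⟩,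
        .sys ⟨N₂, P₂, S₂⟩,
        pub ∪ (valNames v ∪ (l.without pr).names) ∪ {Name.cont k}, pubS ∪ {k}, s.override l⟩ :
        Comp) = c' at h' ⊢
  -- A stored name is used and never has system polarity, whereas `hk₂` gives a used name system
  -- polarity.
  have hk₂' : S₂.cont k = none := by
    rw [Option.eq_none_iff_forall_ne_some]
    intro p hp
    subst hc
    exact (h.cont.right.disj k p hp).2 (hk₂ (h.cont.right.dom k p hp))
  have hkK : k ∉ c.K := by
    rw [h.mem_K]
    subst hc
    exact fun h1 => h1.2.2 (hk₂ h1.2.1)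
  have hK : c'.K = c.K := by
    rw [h.mem_K] at hkK
    ext j
    rw [h'.mem_K, h.mem_K]
    subst hc hc'
    simp only [State.N, Set.mem_union, Set.mem_singleton_iff, Name.cont.injEq,
      cont_notMem_valNames, LocStore.cont_notMem_names, or_false] at hkK ⊢
    grind
  have hcc : ContAgree c c' := by
    refine ⟨fun j hj => by rw [hK], fun j hj x => ?_⟩
    subst hc hc'
    rfl
  have hft : c'.fetch ([.appR [.fn f]], k) = ([.appR [.fn f]], k) :=
    h'.fetch_of_notMem _ (hK ▸ hkK)
  have hct : c'.hatCont = c.hatCont := by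
    refine h.hatCont_eq_of_agree h' hcc fun j hj => ?_
    rw [Option.eq_none_iff_forall_ne_some]
    intro q hq
    obtain ⟨-, p, hp, -⟩ := h'.hatCont_eq_some.1 hq
    refine hj ?_
    subst hc hc'
    exact hp.imp (h.cont.left.dom _ _) (h.cont.right.dom _ _)
  have hck : c.hatCont k = none := by
    rw [Option.eq_none_iff_forall_ne_some]
    intro q hq
    obtain ⟨-, p, hp, -⟩ := h.hatCont_eq_some.1 hq
    subst hc
    simp [State.store, hk, hk₂'] at hp
  have hN : c'.hatN = c.hatN ∪ {Name.cont k} ∪ (valNames v ∪ (l.without pr).names) := by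
    simp only [Comp.hatN, hK]
    have hsub : (l.without pr).names ⊆ l.names := fun x hx => by
      obtain ⟨b, d, hd, hx⟩ := LocStore.mem_names.1 hx
      exact LocStore.mem_names.2 ⟨b, d, ((LocStore.without_apply _ _ _ _).1 hd).2, hx⟩
    subst hc hc'
    ext x
    have h1 := hnm x
    have h2 := @hsub x
    have h3 := fun j => cont_notMem_valNames j v
    have h4 := fun j => LocStore.cont_notMem_names j l
    simp only [State.N, Set.mem_sdiff, Set.mem_union, Set.mem_singleton_iff, Set.mem_image] at *
    grind
  have e : c.R = .sys ⟨c.hatN, pub, ⟨LocInv.merged P P₂ S.loc S₂.loc s, c.hatCont⟩⟩ := by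
    subst hc
    rfl
  have e' : c'.R = .prog ⟨c.hatN ∪ {Name.cont k} ∪ (valNames v ∪ (l.without pr).names),
      pub ∪ {Name.cont k} ∪ (valNames v ∪ (l.without pr).names),
      (⟨LocInv.merged P P₂ S.loc S₂.loc s, c.hatCont⟩ : Store).overrideLoc (l.without pr),
      [.appR [.fn f]], .val v, k⟩ := by
    subst hc'
    refine congrArg State.prog (Prog.ext hN (Set.union_right_comm _ _ _)
      (Store.ext hloc.symm hct) ?_ rfl ?_)
    · exact congrArg Prod.fst hft
    · exact congrArg Prod.snd hft
  rw [e, e']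
  refine .into (.call hd hck ?_ (hho _))
  -- A name of the label that is in use but not public would be private, contrary to the side
  -- condition on the update.
  rintro x ⟨hx, hxN⟩
  by_contra hp
  refine hnm' x hx ?_
  rw [hpr]
  subst hc
  exact ⟨hxN.1, hp⟩

theorem R_inRet
    (h : Inv M M' ⟨.sys ⟨N, P, S⟩, .sys ⟨N₂, P₂, S₂⟩, pub, pubS, s⟩)
    (hk : S.cont k = some (t, k₀)) (hk₂ : Name.cont k ∉ N₂)
    (hh : Handover P S v l) (hpr : pr = (N ∪ N₂) \ pub)
    (hu : SysUpdate pub pr (valNames v) s l) :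
    L.LStep (Comp.R ⟨.sys ⟨N, P, S⟩, .sys ⟨N₂, P₂, S₂⟩, pub, pubS, s⟩) (.ret v k)
      (l.restrict (pub ∪ (valNames v ∪ (l.without pr).names)))
      (Comp.R ⟨.prog ⟨N ∪ (valNames v ∪ l.names), P ∪ (valNames v ∪ l.names),
          S.overrideLoc l, t, .val v, k₀⟩, .sys ⟨N₂, P₂, S₂⟩,
        pub ∪ (valNames v ∪ (l.without pr).names), pubS, s.override l⟩) := by
  have h' := h.inRet hk hh hpr hu
  have hres := LocInv.update_restrict (J := ∅) hpr subset_rfl hu (by simp)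
  rw [Set.union_empty] at hres
  rw [hres]
  have hloc := h.loc.merged_update (by simp [State.cur]) (by simp [State.cur]) hpr hu
  have hho := fun ct => h.loc.handover_update hh subset_rfl hpr hu ct
  have hnm := fun x => h.loc.update_names hpr hu (x := x)
  have hnm' := fun x => LocInv.update_notMem hu (x := x)
  generalize hc : (⟨.sys ⟨N, P, S⟩, .sys ⟨N₂, P₂, S₂⟩, pub, pubS, s⟩ : Comp) = c at h ⊢
  generalize hc' : (⟨.prog ⟨N ∪ (valNames v ∪ l.names), P ∪ (valNames v ∪ l.names),
          S.overrideLoc l, t, .val v, k₀⟩, .sys ⟨N₂, P₂, S₂⟩,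
        pub ∪ (valNames v ∪ (l.without pr).names), pubS, s.override l⟩ : Comp) = c' at h' ⊢
  have hkK : k ∉ c.K := by
    rw [h.mem_K]
    subst hc
    exact fun h1 => hk₂ h1.2.1
  have hK : c'.K = c.K := by
    ext j
    rw [h'.mem_K, h.mem_K]
    subst hc hc'
    simp [State.N, cont_notMem_valNames, LocStore.cont_notMem_names]
  have hcc : ContAgree c c' := by
    refine ⟨fun j hj => by rw [hK], fun j hj x => ?_⟩
    subst hc hc'
    rfl
  have hst : c.X₁.store.cont k = some (t, k₀) := by subst hc; exact hk
  have hft : c'.fetch (t, k₀) = c.fetch (t, k₀) :=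
    h.fetch_of_agree h' hcc (h.tgt _ _ _ (Or.inl hst))
  have hct : c'.hatCont = c.hatCont := by
    refine h.hatCont_eq_of_agree h' hcc fun j hj => ?_
    rw [Option.eq_none_iff_forall_ne_some]
    intro q hq
    obtain ⟨-, p, hp, -⟩ := h'.hatCont_eq_some.1 hq
    refine hj ?_
    subst hc hc'
    exact hp.imp (h.cont.left.dom _ _) (h.cont.right.dom _ _)
  have hck : c.hatCont k = some ((c.fetch (t, k₀)).1, (c.fetch (t, k₀)).2) :=
    h.hatCont_eq_some.2 ⟨hkK, (t, k₀), Or.inl hst, rfl⟩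
  have hN : c'.hatN = c.hatN ∪ (valNames v ∪ (l.without pr).names) := by
    simp only [Comp.hatN, hK]
    have hsub : (l.without pr).names ⊆ l.names := fun x hx => by
      obtain ⟨b, d, hd, hx⟩ := LocStore.mem_names.1 hx
      exact LocStore.mem_names.2 ⟨b, d, ((LocStore.without_apply _ _ _ _).1 hd).2, hx⟩
    subst hc hc'
    ext x
    have h1 := hnm x
    have h2 := @hsub x
    have h3 := fun j => cont_notMem_valNames j v
    have h4 := fun j => LocStore.cont_notMem_names j l
    simp only [State.N, Set.mem_sdiff, Set.mem_union, Set.mem_image] at *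
    grind
  have e : c.R = .sys ⟨c.hatN, pub, ⟨LocInv.merged P P₂ S.loc S₂.loc s, c.hatCont⟩⟩ := by
    subst hc
    rfl
  have e' : c'.R = .prog ⟨c.hatN ∪ (valNames v ∪ (l.without pr).names),
      pub ∪ (valNames v ∪ (l.without pr).names),
      (⟨LocInv.merged P P₂ S.loc S₂.loc s, c.hatCont⟩ : Store).overrideLoc (l.without pr),
      (c.fetch (t, k₀)).1, .val v, (c.fetch (t, k₀)).2⟩ := by
    subst hc'
    refine congrArg State.prog (Prog.ext hN rfl (Store.ext hloc.symm hct) ?_ rfl ?_)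
    · exact congrArg Prod.fst hft
    · exact congrArg Prod.snd hft
  rw [e, e']
  refine .into (.ret hck ?_ (hho _))
  rintro x ⟨hx, hxN⟩
  by_contra hp
  refine hnm' x hx ?_
  rw [hpr]
  subst hc
  exact ⟨hxN.1, hp⟩

end
end Inv

/-! ### Determinism, and the existence of transitions of the composite -/

theorem Mod.Out.det {L : Mod} {p : Prog} {α : Label} {s s' : LocStore} {c c' : Sys}
    (h : L.Out p α s c) (h' : L.Out p α s' c') : c = c' := by
  cases h with
  | call _ _ hP => cases h' with | call _ _ hP' => subst hP hP'; rfl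
  | ret hP => cases h' with | ret hP' => subst hP hP'; rfl

/-- The two sources of choice, the fresh continuation of an outgoing call and the update of an
incoming move, are both recorded in the label and its store. -/
theorem Mod.LStep.det {L : Mod} {X Y Y' : State} {α : Label} {s : LocStore}
    (h : L.LStep X α s Y) (h' : L.LStep X α s Y') : Y = Y' := by
  cases h with
  | out h => cases h' with | out h' => rw [h.det h']
  | into h =>
    cases h' with
    | into h' =>
      cases h with
      | call => cases h'; rfl
      | ret hk =>
        cases h' with
        | ret hk' =>
          rw [hk] at hk'
          cases hk'
          rfl

theorem Mod.Composable.not_both {M M' : Mod} (h : M.Composable M') {f : FunName} {F F' : Func}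
    (h₁ : M.defn f = some F) (h₂ : M'.defn f = some F') : False :=
  Set.disjoint_left.1 h.declared (Mod.defn_mem h₁) (Mod.defn_mem h₂)

/-- `L` defines the functions of `M` and those of `M'`. -/
def Joins (L M M' : Mod) : Prop :=
  ∀ f F, L.defn f = some F ↔ M.defn f = some F ∨ M'.defn f = some F

theorem Joins.swap {L M M' : Mod} (h : Joins L M M') : Joins L M' M :=
  fun f F => (h f F).trans or_comm

theorem Joins.eq_none {L M M' : Mod} (h : Joins L M M') {f : FunName} :
    L.defn f = none ↔ M.defn f = none ∧ M'.defn f = none := by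
  simp only [Option.eq_none_iff_forall_ne_some, ne_eq, h f]
  grind

theorem lookup_append {α β : Type*} [BEq α] (l l' : List (α × β)) (a : α) :
    (l ++ l').lookup a = (l.lookup a).or (l'.lookup a) := by
  induction l with
  | nil => simp
  | cons p l ih =>
    rw [List.cons_append, List.lookup_cons, List.lookup_cons]
    split <;> simp [ih]

theorem Mod.Composable.joins {M M' : Mod} (h : M.Composable M') : Joins (M.comp M') M M' := by
  intro f F
  have h1 : (M.comp M').defn f = (M.defn f).or (M'.defn f) := lookup_append _ _ _
  have h2 := fun F F' => h.not_both (f := f) (F := F) (F' := F')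
  rw [h1]
  rcases Option.eq_none_or_eq_some (M.defn f) with h3 | ⟨F', h3⟩
  · simp [h3]
  · rcases Option.eq_none_or_eq_some (M'.defn f) with h4 | ⟨F'', h4⟩
    · simp [h3, h4]
    · exact (h2 _ _ h3 h4).elim

/-! ### Acceptance by the inactive component -/

namespace Inv

variable {M M' L : Mod} {c c' : Comp} {N P N₂ P₂ pub : Set Name} {S S₂ : Store} {t t₀ : Stack}
  {f : FunName} {F : Func} {v : Value} {k k₀ : ContName} {pubS : Set ContName} {s : LocStore}

/-- A defined function is the only real requirement. Names of the label known to the receiver are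
shared, hence public there, and the store handed over is closed and covers the receiver's public
locations. -/
theorem accepts_call
    (h : Inv M M' ⟨.prog ⟨N, P, S, .appR [.fn f] :: t, .val v, k₀⟩, .sys ⟨N₂, P₂, S₂⟩,
      pub, pubS, s⟩)
    (hf : M'.defn f = some F) (hk₂ : Name.cont k ∉ N₂) :
    ∃ p', M'.In ⟨N₂, P₂, S₂⟩ (.call f v k) (S.loc.restrict (S.loc.Cl (P ∪ valNames v))) p' := by
  have hterm := h.left.term _ rfl
  have hact : (State.prog ⟨N, P, S, .appR [.fn f] :: t, .val v, k₀⟩).cur ≠ none := by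
    simp [State.cur]
  refine ⟨_, .call hf ?_ ?_ (h.loc.handover hact hterm.2)⟩
  · rw [Option.eq_none_iff_forall_ne_some]
    exact fun p hp => hk₂ (h.cont.right.dom k p hp)
  · rintro x ⟨hx, hx₂⟩
    refine h.loc.right.shared x hx₂ ?_
    rw [Set.union_assoc] at hx
    rcases hx with rfl | hx
    · exact hterm.1 (by rw [stackNames_cons]; simp [Frame.names, Data.names])
    · exact h.loc.exposed hterm.2 (LocInv.label_names hx)

theorem accepts_ret
    (h : Inv M M' ⟨.prog ⟨N, P, S, [], .val v, k⟩, .sys ⟨N₂, P₂, S₂⟩, pub, pubS, s⟩)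
    (hk : S₂.cont k = some (t, k₀)) :
    ∃ p', M'.In ⟨N₂, P₂, S₂⟩ (.ret v k) (S.loc.restrict (S.loc.Cl (P ∪ valNames v))) p' := by
  have hterm := h.left.term _ rfl
  have hact : (State.prog ⟨N, P, S, [], .val v, k⟩).cur ≠ none := by simp [State.cur]
  refine ⟨_, .ret hk ?_ (h.loc.handover hact hterm.2)⟩
  rintro x ⟨hx, hx₂⟩
  exact h.loc.right.shared x hx₂ (h.loc.exposed hterm.2 (LocInv.label_names hx))

theorem exists_fresh (h : Inv M M' c) : ∃ k, Name.cont k ∉ c.X₁.N ∧ Name.cont k ∉ c.X₂.N := by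
  have hfin : (Name.cont ⁻¹' (c.X₁.N ∪ c.X₂.N)).Finite :=
    (h.loc.left.fin.union h.loc.right.fin).preimage fun _ _ _ _ h => Name.cont.inj h
  obtain ⟨k, hk⟩ := hfin.exists_notMem
  exact ⟨k, fun h1 => hk (Or.inl h1), fun h1 => hk (Or.inr h1)⟩

theorem exists_tauCall
    (h : Inv M M' ⟨.prog ⟨N, P, S, .appR [.fn f] :: t, .val v, k₀⟩, .sys ⟨N₂, P₂, S₂⟩,
      pub, pubS, s⟩)
    (hM : M.Composable M') (hf : M'.defn f = some F) :
    ∃ c', TauL M M' ⟨.prog ⟨N, P, S, .appR [.fn f] :: t, .val v, k₀⟩, .sys ⟨N₂, P₂, S₂⟩,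
      pub, pubS, s⟩ c' := by
  obtain ⟨k, hk, hk₂⟩ := h.exists_fresh
  obtain ⟨p', hp'⟩ := h.accepts_call hf hk₂
  have hd : M.defn f = none := Option.eq_none_iff_forall_ne_some.2 fun F' hF' => hM.not_both hF' hf
  exact ⟨_, .call (.call hd hk rfl) hp' fun hx => hk₂ (h.names_right_eq.le hx)⟩

/-- A current continuation in `K` lacks system polarity, so the partner stores it and accepts the
return. -/
theorem exists_tauRet
    (h : Inv M M' ⟨.prog ⟨N, P, S, [], .val v, k⟩, .sys ⟨N₂, P₂, S₂⟩, pub, pubS, s⟩)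
    (hk : k ∈ Comp.K ⟨.prog ⟨N, P, S, [], .val v, k⟩, .sys ⟨N₂, P₂, S₂⟩, pub, pubS, s⟩) :
    ∃ c', TauL M M' ⟨.prog ⟨N, P, S, [], .val v, k⟩, .sys ⟨N₂, P₂, S₂⟩, pub, pubS, s⟩ c' := by
  have hk' := h.mem_K.1 hk
  obtain ⟨⟨t, k₀⟩, hp⟩ := (h.cont.left.cur k rfl).2.resolve_right hk'.2.2
  obtain ⟨p', hp'⟩ := h.accepts_ret hp
  exact ⟨_, .ret (.ret rfl) hp'⟩

/-! ### The simulation with the left component active -/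

theorem tau_sim (h : Inv M M' c) (hs : TauL M M' c c') : c.R = c'.R := by
  cases hs with
  | call ho hi hk =>
    have e2 := h.names_right_eq
    cases ho with
    | call hd hk' hP =>
      cases hi with
      | call hd' hc hn hh =>
        subst hP
        exact h.R_tauCall (h.right.all (Or.inr (Mod.defn_mem hd'))) hk'
          (fun hx => hk (e2.ge hx)) rfl
  | ret ho hi =>
    cases ho with
    | ret hP =>
      cases hi with
      | ret hc hn hh =>
        subst hP
        exact h.R_tauRet hc rfl

/-- An internal step changes neither public names nor continuations, so `K`, the completed
continuations and the bottom stack are the same before and after. -/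
theorem embed_of_int {p p' : Prog} {σ : Sys} (hM : M.WellScoped)
    (h : Inv M M' ⟨.prog p, .sys σ, pub, pubS, s⟩)
    (hr : M.Run p p') (hnew : ∀ x ∈ p'.N, x ∈ σ.N → x ∈ p.N) :
    Comp.R ⟨.prog p', .sys σ, pub, pubS, s⟩ = .prog (p'.embed σ.N
      (Comp.K ⟨.prog p, .sys σ, pub, pubS, s⟩) pub σ.s.loc
      (Comp.hatCont ⟨.prog p, .sys σ, pub, pubS, s⟩)
      (Comp.fetch ⟨.prog p, .sys σ, pub, pubS, s⟩ ([], p.k)).1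
      (Comp.fetch ⟨.prog p, .sys σ, pub, pubS, s⟩ ([], p.k)).2) := by
  have h' := h.int hM hr hnew
  rw [h'.R_prog]
  obtain ⟨hP, hk, hc⟩ := hr.unchanged
  have hK : Comp.K ⟨.prog p', .sys σ, pub, pubS, s⟩ = Comp.K ⟨.prog p, .sys σ, pub, pubS, s⟩ := by
    simp only [Comp.K, State.P, hP]
  have hag : ContAgree ⟨.prog p, .sys σ, pub, pubS, s⟩ ⟨.prog p', .sys σ, pub, pubS, s⟩ :=
    ⟨fun k _ => by rw [hK], fun k _ x => by simp only [State.store, hc]⟩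
  have hct : Comp.hatCont ⟨.prog p', .sys σ, pub, pubS, s⟩ =
      Comp.hatCont ⟨.prog p, .sys σ, pub, pubS, s⟩ := by
    refine h.hatCont_eq_of_agree h' hag fun k hk => ?_
    rw [Option.eq_none_iff_forall_ne_some]
    intro q hq
    obtain ⟨-, x, hx, -⟩ := h'.hatCont_eq_some.1 hq
    simp only [State.store, hc] at hx
    exact hk (hx.imp (h.cont.left.dom _ _) (h.cont.right.dom _ _))
  rw [hK, hct, hk, h.fetch_of_agree h' hag (Or.inl (h.cont.left.cur _ rfl).1)]

theorem int_sim (hM : M.WellScoped) (hL : Joins L M M') (h : Inv M M' c) (hs : IntL M M' c c') :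
    L.Step c.R c'.R := by
  cases hs with
  | @int p p' σ pub pubS s hr hn =>
    have e1 : p.names = p.N := h.names_left_eq
    have e2 : σ.names = σ.N := h.names_right_eq
    rw [e1, e2] at hn
    have hnew : ∀ x ∈ p'.N, x ∈ σ.N → x ∈ p.N := fun x h1 h2 =>
      hn ⟨Or.inl (Or.inl (Or.inl (Or.inl (Or.inl h1)))), h2⟩
    rw [h.R_prog, h.embed_of_int hM hr hnew]
    exact .run (hr.embed (fun f F hf => (hL f F).2 (Or.inl hf)) hnew)

theorem int_reflect {p : Prog} {σ : Sys} {Y : State} (hM : M.Composable M') (hL : Joins L M M')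
    (h : Inv M M' ⟨.prog p, .sys σ, pub, pubS, s⟩)
    (hs : L.Step (Comp.R ⟨.prog p, .sys σ, pub, pubS, s⟩) Y)
    (ht : ¬ ∃ c', TauL M M' ⟨.prog p, .sys σ, pub, pubS, s⟩ c') :
    ∃ c', IntL M M' ⟨.prog p, .sys σ, pub, pubS, s⟩ c' ∧ Y = c'.R := by
  have hterm := h.left.term p rfl
  rw [h.R_prog] at hs
  cases hs with
  | @run _ q hr =>
    -- Without a τ-transition a finished program has an external current continuation, and then
    -- nothing is fetched below it.
    have hv : ∀ v, p.t = [] → p.e = .val v →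
        (Comp.fetch ⟨.prog p, .sys σ, pub, pubS, s⟩ ([], p.k)).1 = [] := by
      obtain ⟨N, P, S, t, e, k⟩ := p
      rintro v rfl rfl
      rw [h.fetch_of_notMem [] (k := k) fun hk => ht (h.exists_tauRet hk)]
    have hF : ∀ f t v F, p.t = .appR [.fn f] :: t → p.e = .val v → L.defn f = some F →
        M.defn f = some F := by
      obtain ⟨N, P, S, t, e, k⟩ := p
      rintro f t v F rfl rfl hF
      refine ((hL f F).1 hF).resolve_right fun hf => ht ?_
      exact h.exists_tauCall hM hf
    obtain ⟨p', hp', rfl, hnew⟩ := hr.of_embed (M := M) hv hF hterm.1 hterm.2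
      (h.loc.left.active (by simp [State.cur]))
    have h' := h.int hM.left hp' hnew
    refine ⟨_, .int hp' ?_, (h.embed_of_int hM.left hp' hnew).symm⟩
    have e1 : p'.names = p'.N := h'.names_left_eq
    have e2 : σ.names = σ.N := h.names_right_eq
    rw [e1, e2]
    exact fun x hx => Or.inl (Or.inl (Or.inl (Or.inl (Or.inl (hnew x hx.1 hx.2)))))

theorem ext_sim {α : Label} {s' : LocStore} (hL : Joins L M M')
    (h : Inv M M' c) (hs : ExtL M M' c α s' c') : L.LStep c.R α s' c'.R := by
  have e1 := h.names_left_eq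
  have e2 := h.names_right_eq
  cases hs with
  | progCall ho hi hs hp hk =>
    have hk₂ := fun hx => hk (e2.ge hx)
    cases ho with
    | call hd hk' hP =>
      subst hP hp
      refine h.R_outCall (hL.eq_none.2 ⟨hd, ?_⟩) hk' hk₂ hs
      rw [Option.eq_none_iff_forall_ne_some]
      exact fun F hF => hi (h.accepts_call hF hk₂)
  | progRet ho hi hs hp =>
    cases ho with
    | ret hP =>
      subst hP hp
      refine h.R_outRet ?_ hs
      rw [Option.eq_none_iff_forall_ne_some]
      exact fun p hp => hi (h.accepts_ret hp)
  | @sysCall σ σ' _ _ _ _ _ _ _ _ pr _ hi hpr hu hp hk =>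
    cases hi with
    | call hd hc hn hh =>
      subst hp
      have e1 : Sys.names _ = _ := e1
      have e2 : Sys.names _ = _ := e2
      rw [e1, e2] at hpr
      exact h.R_inCall (h.left.all (Or.inr (Mod.defn_mem hd))) ((hL _ _).2 (Or.inl hd)) hc
        (fun hx => hk (e2.ge hx)) hh hpr hu
  | sysRet hi hpr hu hp hk =>
    cases hi with
    | ret hc hn hh =>
      subst hp
      have hk₂ := fun hx => hk (e2.ge hx)
      have e1 : Sys.names _ = _ := e1
      have e2 : Sys.names _ = _ := e2
      rw [e1, e2] at hpr
      exact h.R_inRet hc hk₂ hh hpr hu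

theorem out_reflect {p : Prog} {σ : Sys} {Y : State} {α : Label} {s' : LocStore}
    (hL : Joins L M M')
    (h : Inv M M' ⟨.prog p, .sys σ, pub, pubS, s⟩)
    (hs : L.LStep (Comp.R ⟨.prog p, .sys σ, pub, pubS, s⟩) α s' Y)
    (ht : ¬ ∃ c', TauL M M' ⟨.prog p, .sys σ, pub, pubS, s⟩ c')
    (hα : Disjoint α.names (Name.cont '' Comp.K ⟨.prog p, .sys σ, pub, pubS, s⟩)) :
    ∃ c', ExtL M M' ⟨.prog p, .sys σ, pub, pubS, s⟩ α s' c' ∧ Y = c'.R := by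
  -- A composite step with the right label and store suffices, since its translation must reach `Y`
  -- by determinism. The equation between the stores is kept separate because the rule produces the
  -- store in its own form.
  suffices ∃ s'' c', ExtL M M' ⟨.prog p, .sys σ, pub, pubS, s⟩ α s'' c' ∧ s'' = s' by
    obtain ⟨_, c', hc', rfl⟩ := this
    exact ⟨c', hc', hs.det (h.ext_sim hL hc')⟩
  have e2 := h.names_right_eq
  obtain ⟨N, P, S, t, e, k⟩ := p
  obtain ⟨N₂, P₂, S₂⟩ := σ
  rw [h.R_prog] at hs
  generalize hq : Prog.embed _ _ _ _ _ _ _ _ = q at hs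
  cases hs with
  | out ho =>
    cases ho with
    | @call N' P' S' t' f v k₁ k' P'' hd hk' hP =>
      simp only [Prog.embed, Prog.mk.injEq] at hq
      obtain ⟨rfl, rfl, rfl, hT, rfl, rfl⟩ := hq
      -- An empty stack would mean that the call frame was fetched from below, which requires a
      -- current continuation in `K` and so a τ-transition.
      rcases t with _ | ⟨φ, t⟩
      · rw [h.fetch_of_notMem [] fun hk => ht (h.exists_tauRet hk)] at hT
        cases hT
      · cases hT
        have hd' := hL.eq_none.1 hd
        -- The concatenation only knows that the name is outside the translated used names, from
        -- which `K` was removed; `hα` excludes the names in `K`.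
        have hkN : Name.cont k' ∉ N ∪ N₂ := fun hx => hk' ⟨hx, fun hx =>
          Set.disjoint_left.1 hα (Or.inr rfl) hx⟩
        have hk₁ : Name.cont k' ∉ N := fun hx => hkN (Or.inl hx)
        have hk₂ : Name.cont k' ∉ N₂ := fun hx => hkN (Or.inr hx)
        refine ⟨_, _, .progCall (.call hd'.1 hk₁ rfl) ?_ rfl rfl fun hx => hk₂ (e2.le hx), ?_⟩
        · rintro ⟨p', hp'⟩
          cases hp' with
          | call hd'' => rw [hd'.2] at hd''; cases hd''
        · subst hP
          exact h.loc.observed_restrict (by simp [State.cur]) (h.left.term _ rfl).2 (by simp) rfl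
    | @ret N' P' S' v k₁ P'' hP =>
      simp only [Prog.embed, Prog.mk.injEq] at hq
      obtain ⟨rfl, rfl, rfl, hT, rfl, rfl⟩ := hq
      obtain ⟨rfl, -⟩ := List.append_eq_nil_iff.1 hT
      have hkK : k ∉ Comp.K ⟨.prog ⟨N, P, S, [], .val v, k⟩, .sys ⟨N₂, P₂, S₂⟩, pub, pubS, s⟩ :=
        fun hk => ht (h.exists_tauRet hk)
      rw [h.fetch_of_notMem [] hkK]
      refine ⟨_, _, .progRet (.ret rfl) ?_ rfl rfl, ?_⟩
      · rintro ⟨p', hp'⟩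
        exact ht ⟨_, .ret (.ret rfl) hp'⟩
      · subst hP
        have := h.loc.observed_restrict (J := ∅) (by simp [State.cur]) (h.left.term _ rfl).2
          (by simp) rfl
        rw [Set.union_empty] at this
        exact this

theorem in_reflect {σ σ' : Sys} {Y : State} {α : Label} {s' : LocStore}
    (hL : Joins L M M')
    (h : Inv M M' ⟨.sys σ, .sys σ', pub, pubS, s⟩)
    (hs : L.LStep (Comp.R ⟨.sys σ, .sys σ', pub, pubS, s⟩) α s' Y)
    (hα : Disjoint α.names (Name.cont '' Comp.K ⟨.sys σ, .sys σ', pub, pubS, s⟩))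
    (hcall : ∀ f v k, α = .call f v k → ∃ F, M.defn f = some F)
    (hret : ∀ v k, α = .ret v k → ∃ p, σ.s.cont k = some p) :
    ∃ c', ExtL M M' ⟨.sys σ, .sys σ', pub, pubS, s⟩ α s' c' ∧ Y = c'.R := by
  suffices ∃ s'' c', ExtL M M' ⟨.sys σ, .sys σ', pub, pubS, s⟩ α s'' c' ∧ s'' = s' by
    obtain ⟨_, c', hc', rfl⟩ := this
    exact ⟨c', hc', hs.det (h.ext_sim hL hc')⟩
  have e1 : σ.names = σ.N := h.names_left_eq
  have e2 : σ'.names = σ'.N := h.names_right_eq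
  have hna : ¬ (State.sys σ).cur ≠ none := by simp [State.cur]
  have hna' : ¬ (State.sys σ').cur ≠ none := by simp [State.cur]
  have hpr : (σ.names ∪ σ'.names) \ pub = (σ.N ∪ σ'.N) \ pub := by rw [e1, e2]
  obtain ⟨N, P, ⟨l, ct⟩⟩ := σ
  obtain ⟨N₂, P₂, S₂⟩ := σ'
  cases hs with
  | into hi =>
    generalize hq : Sys.mk _ _ _ = q at hi
    cases hi with
    | @call N' P' S' f F v k _ hd hk hn hh =>
      simp only [Sys.mk.injEq] at hq
      obtain ⟨rfl, rfl, rfl⟩ := hq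
      obtain ⟨F', hF'⟩ := hcall f v k rfl
      have hkK : k ∉ Comp.K ⟨.sys ⟨N, P, ⟨l, ct⟩⟩, .sys ⟨N₂, P₂, S₂⟩, pub, pubS, s⟩ := fun hx =>
        Set.disjoint_left.1 hα (Or.inr rfl) ⟨k, hx, rfl⟩
      -- Only continuation names were removed from the used names, so the freshness condition of the
      -- concatenation still sees every used location and function.
      have hns : ∀ x ∈ {Name.fn f} ∪ valNames v ∪ s'.names, x ∈ N ∪ N₂ → x ∈ pub := by
        refine fun x hx hxN => hn ⟨hx, hxN, ?_⟩
        rintro ⟨j, -, rfl⟩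
        rcases hx with (hx | hx) | hx
        · cases hx
        · exact cont_notMem_valNames _ _ hx
        · exact LocStore.cont_notMem_names _ _ hx
      have hs' : ∀ x ∈ s'.names, x ∈ N ∪ N₂ → x ∈ pub := fun x hx => hns x (Or.inr hx)
      have hcont : ∀ p, ¬ (ct k = some p ∨ S₂.cont k = some p) := by
        intro p hp
        have : Comp.hatCont ⟨.sys ⟨N, P, ⟨l, ct⟩⟩, .sys ⟨N₂, P₂, S₂⟩, pub, pubS, s⟩ k = none := hk
        rw [h.hatCont_eq_some.2 ⟨hkK, p, hp, rfl⟩] at this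
        cases this
      refine ⟨_, _, .sysCall (.call hF' ?_ ?_ (h.loc.rebuilt_handover hna hna' hh)) rfl
        (h.loc.rebuilt_update hna hna' hpr hh hns) rfl ?_, ?_⟩
      · exact Option.eq_none_iff_forall_ne_some.2 fun p hp => hcont p (Or.inl hp)
      · rintro x ⟨hx | hx, hxN⟩
        · exact h.loc.pub_left (hns x (Or.inl hx) (Or.inl hxN)) hxN
        · exact h.loc.rebuilt_names_left (fun x hx hxN => hs' x hx (Or.inl hxN)) hx hxN
      · intro hx
        rcases h.cont.right.src k (e2.le hx) with ⟨p, hp⟩ | ⟨p, hp⟩ | hp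
        · exact absurd (Or.inr hp) (hcont p)
        · exact absurd (Or.inl hp) (hcont p)
        · exact hp
      · rw [LocInv.update_restrict hpr Set.subset_union_right
          (h.loc.rebuilt_update hna hna' hpr hh hns) (by simp)]
        exact h.loc.rebuilt_without hpr hs'
    | @ret N' P' S' v k₀ k t₀ _ hk hn hh =>
      simp only [Sys.mk.injEq] at hq
      obtain ⟨rfl, rfl, rfl⟩ := hq
      obtain ⟨⟨t, k₁⟩, hp⟩ := hret v k rfl
      have hkK : k ∉ Comp.K ⟨.sys ⟨N, P, ⟨l, ct⟩⟩, .sys ⟨N₂, P₂, S₂⟩, pub, pubS, s⟩ := fun hx =>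
        Set.disjoint_left.1 hα (Or.inr rfl) ⟨k, hx, rfl⟩
      have hns : ∀ x ∈ valNames v ∪ s'.names, x ∈ N ∪ N₂ → x ∈ pub := by
        refine fun x hx hxN => hn ⟨hx, hxN, ?_⟩
        rintro ⟨j, -, rfl⟩
        rcases hx with hx | hx
        · exact cont_notMem_valNames _ _ hx
        · exact LocStore.cont_notMem_names _ _ hx
      have hs' : ∀ x ∈ s'.names, x ∈ N ∪ N₂ → x ∈ pub := fun x hx => hns x (Or.inr hx)
      refine ⟨_, _, .sysRet (.ret hp ?_ (h.loc.rebuilt_handover hna hna' hh)) rfl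
        (h.loc.rebuilt_update hna hna' hpr hh hns) rfl ?_, ?_⟩
      · rintro x ⟨hx | hx, hxN⟩
        · exact h.loc.pub_left (hns x (Or.inl hx) (Or.inl hxN)) hxN
        · exact h.loc.rebuilt_names_left (fun x hx hxN => hs' x hx (Or.inl hxN)) hx hxN
      -- The left component stores this name, so it has no system polarity; were it used on the
      -- right too, it would lie in `K`.
      · exact fun hx => hkK (h.mem_K.2 ⟨h.cont.left.dom k _ hp, e2.le hx,
          (h.cont.left.disj k _ hp).2⟩)
      · have := LocInv.update_restrict (J := ∅) hpr subset_rfl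
          (h.loc.rebuilt_update hna hna' hpr hh hns) (by simp)
        rw [Set.union_empty] at this
        exact this.trans (h.loc.rebuilt_without hpr hs')

/-! ### The translated state is a configuration -/

theorem translatable (h : Inv M M' c) : c.Translatable where
  disjoint := h.disj
  stored _ p _ := ⟨_, h.fetch_spec p, fun _ hq => (h.fetch_spec p).det h.disj hq⟩
  current p _ := ⟨_, h.fetch_spec _, fun _ hq => (h.fetch_spec _).det h.disj hq⟩
  union σ₁ σ₂ h₁ h₂ a d₁ d₂ hd₁ hd₂ := by
    refine h.compatible a ?_ ?_
    · rw [h₁]; exact hd₁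
    · rw [h₂]; exact hd₂
  notBoth p₁ p₂ := by
    rintro ⟨h₁, h₂⟩
    rcases h.passive with h3 | h3
    · rw [h₁] at h3; cases h3
    · rw [h₂] at h3; cases h3

theorem notMem_image_K {x : Name} (hx : ∀ k, x ≠ Name.cont k) : x ∉ Name.cont '' c.K := by
  rintro ⟨k, -, rfl⟩
  exact hx k rfl

/-- Removing `K` loses no public name, because a public continuation shared by both components has
system polarity. -/
theorem pub_sub_hatN (h : Inv M M' c) : c.pub ⊆ c.hatN := by
  refine fun x hx => ⟨(h.loc.pub x hx).imp (h.loc.left.sub ·) (h.loc.right.sub ·), ?_⟩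
  rintro ⟨k, hk, rfl⟩
  have := h.mem_K.1 hk
  exact this.2.2 (h.cont.private' k hx this.1 this.2.1)

theorem fetch_names (h : Inv M M' c) {t : Stack} {k : ContName}
    (ht : stackNames t ⊆ c.X₁.N ∪ c.X₂.N) (hk : Name.cont k ∈ c.X₁.N ∪ c.X₂.N) :
    stackNames (c.fetch (t, k)).1 ⊆ c.hatN ∧ Name.cont (c.fetch (t, k)).2 ∈ c.hatN := by
  have hf := h.fetch_spec (t, k)
  constructor
  · refine fun x hx => ⟨hf.names (c.X₁.N ∪ c.X₂.N) ht ?_ hx, notMem_image_K ?_⟩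
    · rintro k t k' (hk | hk)
      · exact (h.left.stored k t k' hk).trans Set.subset_union_left
      · exact (h.right.stored k t k' hk).trans Set.subset_union_right
    · rintro k rfl
      exact cont_notMem_stackNames _ _ hx
  · refine ⟨hf.mem (Name.cont ⁻¹' (c.X₁.N ∪ c.X₂.N)) hk h.tgt, ?_⟩
    rintro ⟨j, hj, hj'⟩
    cases hj'
    exact hf.notMem hj

theorem hat_names (h : Inv M M' c) {l : LocStore}
    (hl : ∀ a d, l a = some d → Name.loc a ∈ c.X₁.N ∪ c.X₂.N ∧ d.names ⊆ c.X₁.N ∪ c.X₂.N) :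
    (⟨l, c.hatCont⟩ : Store).names ⊆ c.hatN := by
  rintro x (hx | ⟨k, t, k', hk, hx⟩)
  · refine ⟨?_, notMem_image_K ?_⟩
    · obtain ⟨a, d, hd, hx⟩ := LocStore.mem_names.1 hx
      rcases hx with rfl | hx
      · exact (hl a d hd).1
      · exact (hl a d hd).2 hx
    · rintro k rfl
      exact LocStore.cont_notMem_names _ _ hx
  · obtain ⟨hkK, ⟨t₁, k₁⟩, hp, hq⟩ := h.hatCont_eq_some.1 hk
    have hf := h.fetch_names (t := t₁) (k := k₁) ?_ (h.tgt _ _ _ hp)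
    · rw [← hq] at hf
      rcases hx with rfl | hx | rfl
      · refine ⟨hp.imp (h.cont.left.dom _ _) (h.cont.right.dom _ _), ?_⟩
        rintro ⟨j, hj, hj'⟩
        cases hj'
        exact hkK hj
      · exact hf.1 hx
      · exact hf.2
    · rcases hp with hp | hp
      · exact (h.left.stored _ _ _ hp).trans Set.subset_union_left
      · exact (h.right.stored _ _ _ hp).trans Set.subset_union_right

theorem hatN_finite (h : Inv M M' c) : c.hatN.Finite :=
  (h.loc.left.fin.union h.loc.right.fin).subset Set.sdiff_subset

theorem R_wf_prog {p : Prog} {σ : Sys} (h : Inv M M' ⟨.prog p, .sys σ, pub, pubS, s⟩) :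
    (Comp.R ⟨.prog p, .sys σ, pub, pubS, s⟩).WF := by
  have hterm := h.left.term p rfl
  have hf := h.fetch_names (hterm.1.trans Set.subset_union_left)
    (Or.inl (h.cont.left.cur p.k rfl).1)
  refine ⟨h.hatN_finite, ?_⟩
  refine Set.union_subset (Set.union_subset (Set.union_subset (Set.union_subset
    (Set.union_subset subset_rfl h.pub_sub_hatN) (h.hat_names ?_)) hf.1) ?_) ?_
  · intro a d hd
    rcases (LocStore.override_apply _ _ _ _).1 hd with hd | hd
    · exact ⟨Or.inl (h.loc.left.dom a d hd), fun x hx => Or.inl (h.loc.left.rng a d x hd hx)⟩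
    · exact ⟨Or.inr (h.loc.right.dom a d hd.2),
        fun x hx => Or.inr (h.loc.right.rng a d x hd.2 hx)⟩
  · refine fun x hx => ⟨Or.inl (hterm.2 hx), notMem_image_K ?_⟩
    rintro k rfl
    exact cont_notMem_exp _ _ hx
  · rintro _ rfl
    exact hf.2

theorem R_wf_sys {σ σ' : Sys} (h : Inv M M' ⟨.sys σ, .sys σ', pub, pubS, s⟩) :
    (Comp.R ⟨.sys σ, .sys σ', pub, pubS, s⟩).WF := by
  refine ⟨h.hatN_finite, Set.union_subset (Set.union_subset subset_rfl h.pub_sub_hatN)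
    (h.hat_names ?_)⟩
  intro a d hd
  by_cases hP : Name.loc a ∈ σ.P ∧ Name.loc a ∈ σ'.P
  · have hd' := (h.loc.merged_shared hP.1 hP.2).symm.trans hd
    exact ⟨Or.inl (h.loc.left.sub hP.1), fun x hx =>
      (h.loc.rng a d x hd' hx).imp (h.loc.left.sub ·) (h.loc.right.sub ·)⟩
  · have hd' := (LocInv.merged_of_not_shared σ.s.loc σ'.s.loc s hP).symm.trans hd
    rcases (LocStore.override_apply _ _ _ _).1 hd' with hd | hd
    · exact ⟨Or.inr (h.loc.right.dom a d hd), fun x hx => Or.inr (h.loc.right.rng a d x hd hx)⟩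
    · exact ⟨Or.inl (h.loc.left.dom a d hd.2),
        fun x hx => Or.inl (h.loc.left.rng a d x hd.2 hx)⟩

theorem R_wf (h : Inv M M' c) : c.R.WF := by
  have hs := h.R_swap
  have h' := h.swap
  have hp := h.passive
  obtain ⟨X₁, X₂, pub, pubS, s⟩ := c
  cases X₁ <;> cases X₂
  · exact h.R_wf_sys
  · rw [← hs]; exact h'.R_wf_prog
  · exact h.R_wf_prog
  · rcases hp with hp | hp <;> cases hp

/-! ### The simulation in general -/

theorem step_reflect {Y : State} (hM : M.Composable M') (hL : Joins L M M') (h : Inv M M' c)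
    (hs : L.Step c.R Y) (ht : ¬ ∃ c', TauStep M M' c c') :
    ∃ c', IntStep M M' c c' ∧ Y = c'.R := by
  have hR := h.R_swap
  have h' := h.swap
  have hp := h.passive
  obtain ⟨X₁, X₂, pub, pubS, s⟩ := c
  cases X₁ <;> cases X₂
  · cases hs
  · rw [← hR] at hs
    obtain ⟨c', hc', rfl⟩ := h'.int_reflect hM.swap hL.swap hs
      fun ⟨c', hc'⟩ => ht ⟨c'.swap, Or.inr hc'⟩
    exact ⟨c'.swap, Or.inr hc', (h'.of_intL hM.right hc').R_swap.symm⟩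
  · obtain ⟨c', hc', rfl⟩ := h.int_reflect hM hL hs fun ⟨c', hc'⟩ => ht ⟨c', Or.inl hc'⟩
    exact ⟨c', Or.inl hc', rfl⟩
  · rcases hp with hp | hp <;> cases hp

theorem lstep_reflect {Y : State} {α : Label} {s' : LocStore}
    (hL : Joins L M M') (h : Inv M M' c) (hs : L.LStep c.R α s' Y)
    (ht : ¬ ∃ c', TauStep M M' c c') (hα : Disjoint α.names (Name.cont '' c.K)) :
    ∃ c', ExtStep M M' c α s' c' ∧ Y = c'.R := by
  have hR := h.R_swap
  have h' := h.swap
  have hp := h.passive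
  have hα' : Disjoint α.names (Name.cont '' c.swap.K) := by rwa [K_swap]
  have of_right : (∃ c', ExtL M' M c.swap α s' c' ∧ Y = c'.R) →
      ∃ c', ExtStep M M' c α s' c' ∧ Y = c'.R := by
    rintro ⟨c', hc', rfl⟩
    exact ⟨c'.swap, Or.inr hc', (h'.of_extL hc').R_swap.symm⟩
  have of_left : (∃ c', ExtL M M' c α s' c' ∧ Y = c'.R) →
      ∃ c', ExtStep M M' c α s' c' ∧ Y = c'.R :=
    fun ⟨c', hc', hY⟩ => ⟨c', Or.inl hc', hY⟩
  have ht₁ : ¬ ∃ c', TauL M M' c c' := fun ⟨c', hc'⟩ => ht ⟨c', Or.inl hc'⟩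
  have ht₂ : ¬ ∃ c', TauL M' M c.swap c' := fun ⟨c', hc'⟩ => ht ⟨c'.swap, Or.inr hc'⟩
  have hs' := hs
  rw [← hR] at hs'
  obtain ⟨X₁, X₂, pub, pubS, s⟩ := c
  cases X₁ with
  | sys σ =>
    cases X₂ with
    | sys σ' =>
      cases α with
      | call f v k =>
        -- The concatenation has the function from one of the two modules; that module's component
        -- takes the call.
        have : ∃ F, M.defn f = some F ∨ M'.defn f = some F := by
          cases hs with
          | into hi =>
            generalize Sys.mk _ _ _ = q at hi
            cases hi with
            | call hd => exact ⟨_, (hL _ _).1 hd⟩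
        obtain ⟨F, hF | hF⟩ := this
        · refine of_left (h.in_reflect hL hs hα ?_ ?_)
          · rintro _ _ _ ⟨⟩; exact ⟨F, hF⟩
          · rintro _ _ ⟨⟩
        · refine of_right (h'.in_reflect hL.swap hs' hα' ?_ ?_)
          · rintro _ _ _ ⟨⟩; exact ⟨F, hF⟩
          · rintro _ _ ⟨⟩
      | ret v k =>
        have : ∃ p, σ.s.cont k = some p ∨ σ'.s.cont k = some p := by
          cases hs with
          | into hi =>
            generalize hq : Sys.mk _ _ _ = q at hi
            cases hi with
            | ret hk =>
              simp only [Sys.mk.injEq] at hq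
              obtain ⟨-, -, rfl⟩ := hq
              obtain ⟨-, p, hp, -⟩ := h.hatCont_eq_some.1 hk
              exact ⟨p, hp⟩
        obtain ⟨p, hp | hp⟩ := this
        · refine of_left (h.in_reflect hL hs hα ?_ ?_)
          · rintro _ _ _ ⟨⟩
          · rintro _ _ ⟨⟩; exact ⟨p, hp⟩
        · refine of_right (h'.in_reflect hL.swap hs' hα' ?_ ?_)
          · rintro _ _ _ ⟨⟩
          · rintro _ _ ⟨⟩; exact ⟨p, hp⟩
    | prog p => exact of_right (h'.out_reflect hL.swap hs' ht₂ hα')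
  | prog p =>
    cases X₂ with
    | sys σ => exact of_left (h.out_reflect hL hs ht₁ hα)
    | prog p => rcases hp with hp | hp <;> cases hp

end Inv
end SLS

/-! ### The proposition, from the left-active case and symmetry -/

theorem proposition1 (M M' : SLS.Mod) (hM : M.Composable M')
    (c : SLS.Comp) (hc : SLS.Reachable M M' c) :
    (c.Translatable ∧ c.R.WF) ∧
    (∀ c', SLS.TauStep M M' c c' → c.R = c'.R) ∧
    (∀ c', SLS.IntStep M M' c c' → (M.comp M').Step c.R c'.R) ∧
    (∀ Y, (M.comp M').Step c.R Y → (¬ ∃ c', SLS.TauStep M M' c c') →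
      ∃ c', SLS.IntStep M M' c c' ∧ Y = c'.R) ∧
    (∀ α s' c', SLS.ExtStep M M' c α s' c' → (M.comp M').LStep c.R α s' c'.R) ∧
    (∀ α s' Y, (M.comp M').LStep c.R α s' Y → (¬ ∃ c', SLS.TauStep M M' c c') →
      Disjoint α.names (SLS.Name.cont '' c.K) →
      ∃ c', SLS.ExtStep M M' c α s' c' ∧ Y = c'.R) := by
  have h := hc.inv hM
  have hL := hM.joins
  refine ⟨⟨h.translatable, h.R_wf⟩, ?_, ?_, fun Y => h.step_reflect hM hL, ?_,
    fun α s' Y => h.lstep_reflect hL⟩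
  · intro c' hs
    have h' := (hc.tau hs).inv hM
    rcases hs with hs | hs
    · exact h.tau_sim hs
    · rw [← h.R_swap, ← h'.R_swap]
      exact h.swap.tau_sim hs
  · intro c' hs
    have h' := (hc.int hs).inv hM
    rcases hs with hs | hs
    · exact h.int_sim hM.left hL hs
    · rw [← h.R_swap, ← h'.R_swap]
      exact h.swap.int_sim hM.right hL.swap hs
  · intro α s' c' hs
    have h' := (hc.ext hs).inv hM
    rcases hs with hs | hs
    · exact h.ext_sim hL hs
    · rw [← h.R_swap, ← h'.R_swap]
      exact h.swap.ext_sim hL.swap hs
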